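/- **Setting.** For an integer $m\ge 4$ let $G^m=O(2,m-1)$ be the group of real $(m+1)\times(m+1)$ matrices preserving $-t_1^2-t_2^2+x_1^2+\dots+x_{m-1}^2$, with Lie algebra $\mathfrak g_m$, and embed $G^m\subset G^{m+1}$ by $M\mapsto \mathrm{diag}(M,1)$. Let $E_{ab}$ denote the matrix units, with rows and columns numbered $1,\dots,m+1$ in the order of the coordinates $t_1,t_2,x_1,\dots,x_{m-1}$. For $1\le i,j\le m-3$ put $$H=E_{14}+E_{41},\quad H_2=E_{23}+E_{32},\quad M_{ij}=E_{4+i,4+j}-E_{4+j,4+i},$$ $$Y_j^+=E_{1,4+j}+E_{4,4+j}+E_{4+j,1}-E_{4+j,4},\quad Z_j^+=E_{2,4+j}+E_{3,4+j}+E_{4+j,2}-E_{4+j,3},$$ $$Q_1^-=E_{21}-E_{12}+E_{24}+E_{42},\quad Q_2^-=E_{13}+E_{31}+E_{34}-E_{43},$$ $$Y_j^-=(Y_j^+)^t,\quad Z_j^-=(Z_j^+)^t,\quad Q_i^+=(Q_i^-)^t.$$ Let $\mathfrak m_m=\mathrm{span}_{\mathbb R}(M_{ij},Z_j^\pm,H_2)$,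 $\mathfrak a=\mathbb RH$ and $\mathfrak n_m^\pm=\mathrm{span}_{\mathbb R}(Y_j^\pm,Q_1^\pm,Q_2^\pm)$; these are Lie subalgebras of $\mathfrak g_m$, and $\mathfrak n_m^\pm$ are abelian. Let $M_0^m$, $A=\exp(\mathfrak a)$ and $(N^+)^m$ be the connected Lie (analytic) subgroups of $G^m$ with Lie algebras $\mathfrak m_m$, $\mathfrak a$ and $\mathfrak n_m^+$, and let $P_0^m=M_0^mA(N^+)^m$. For $\mu\in\mathbb C$ let $\xi_\mu(\exp(tH))=e^{\mu t}$, and for $k\in\{m-1,m\}$ with $k\ge 4$ let $$\mathrm{Ind}_{P_0^k}^{G^m}(\xi_\mu)=\{u\in C^\infty(G^m,\mathbb C): u(g\,\tilde m\tilde a\tilde n)=\xi_\mu(\tilde a)u(g)\ \text{ for all } g\in G^m,\ \tilde m\in M_0^k,\ \tilde a\in A,\ \tilde n\in(N^+)^k\},$$ on which $G^m$ acts by $(\pi(g)u)(x)=u(g^{-1}x)$. The complex universal enveloping algebra $\mathcal U(\mathfrak g_m)$ acts on $C^\infty(G^m,\mathbb C)$ by left-invariant differential operators, through the extension of $(R(X)u)(x)=\frac{d}{dt}\big|_{t=0}u(x\exp(tX))$,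 $X\in\mathfrak g_m$. An element $\mathcal E\in\mathcal U(\mathfrak n_{n+1}^-)$ is said to *induce* a left $G^{n+1}$-equivariant map between two such spaces of functions on $G^{n+1}$ if the operator $R(\mathcal E)$ restricts to a $G^{n+1}$-equivariant linear map from the first into the second. Let $n\ge4$, $\lambda\in\mathbb C$. In $\mathcal U(\mathfrak n_{n+1}^-)$ put $T_n=Y_{n-2}^-$ and $\Delta_{n-1}=-(Q_1^-)^2+(Q_2^-)^2+\sum_{j=1}^{n-3}(Y_j^-)^2$, and for $K\ge0$ let $$\mathcal D^0_{2K}(\lambda)=\sum_{j=0}^{K}a_j(\lambda)\,\Delta_{n-1}^{\,j}\,T_n^{2K-2j},\qquad \mathcal D^0_{2K+1}(\lambda)=\sum_{j=0}^{K}b_j(\lambda)\,\Delta_{n-1}^{\,j}\,T_n^{2K-2j+1},$$ where $a_K=1$, $b_K=1$, and for $j=1,\dots,K$ $$(K-j+1)(2K-2j+1)\,a_{j-1}(\lambda)+j(n-1+2\lambda-4K+2j)\,a_j(\lambda)=0,$$ $$(K-j+1)(2K-2j+3)\,b_{j-1}(\lambda)+j(n-3+2\lambda-4K+2j)\,b_j(\lambda)=0$$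 (these conditions determine the coefficients uniquely). **Theorem.** Let $n\ge 4$ and $N\ge0$ be integers, let $\lambda\in\mathbb C$ and let $\mathcal E\in\mathcal U(\mathfrak n_{n+1}^-)$. Then $\mathcal E$ induces a left $G^{n+1}$-equivariant map $$\mathrm{Ind}_{P_0^{n+1}}^{G^{n+1}}(\xi_\lambda)\longrightarrow \mathrm{Ind}_{P_0^{n}}^{G^{n+1}}(\xi_{\lambda-N})$$ if and only if $\mathcal E=c\,\mathcal D^0_N(\lambda)$ for some $c\in\mathbb C$. -/

import Mathlib

open scoped ContDiff TensorProduct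

attribute [local instance 100] LieRing.ofAssociativeRing

noncomputable section

namespace AdS

/-! ## The groups `O(2, m - 1)` and their Lie algebras

Everything is indexed by `r = m - 3`: the standard coordinates `t₁, t₂, x₁, x₂ | x₃, …, x_{m-1}` of
`ℝ^{m+1}` are split as `Fin 4 ⊕ Fin r`, so that matrices are written in block form with a `4 × 4`
upper left block and an `r × r` lower right block. -/

/-- The index type of the coordinates `t₁, t₂, x₁, x₂ | x₃, …, x_{r+2}`. -/
abbrev Idx (r : ℕ) : Type := Fin 4 ⊕ Fin r

/-- Real square matrices of size `r + 4`, in `4 + r` block form. -/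
abbrev Mat (r : ℕ) : Type := Matrix (Idx r) (Idx r) ℝ

/-- The Gram matrix of the quadratic form `-t₁² - t₂² + x₁² + ⋯ + x_{r+2}²`. -/
def gram (r : ℕ) : Mat r :=
  Matrix.diagonal (Sum.elim ![-1, -1, 1, 1] fun _ => 1)

/-- `O(2, r + 2)`, as a subgroup of the general linear group. -/
def orthGroup (r : ℕ) : Subgroup (GL (Idx r) ℝ) where
  carrier := {g | (g : Mat r).transpose * gram r * (g : Mat r) = gram r}
  one_mem' := by simp
  mul_mem' := by
    intro a b ha hb
    simp only [Set.mem_ofPred_eq, Units.val_mul, Matrix.transpose_mul] at *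
    calc (b : Mat r).transpose * (a : Mat r).transpose * gram r * ((a : Mat r) * (b : Mat r))
        = (b : Mat r).transpose * ((a : Mat r).transpose * gram r * (a : Mat r)) * (b : Mat r) := by
          simp only [Matrix.mul_assoc]
      _ = gram r := by rw [ha, hb]
  inv_mem' := by
    intro a ha
    simp only [Set.mem_ofPred_eq] at *
    have h1 : (a : Mat r) * ((a⁻¹ : GL (Idx r) ℝ) : Mat r) = 1 := Units.mul_inv a
    have h2 : ((a⁻¹ : GL (Idx r) ℝ) : Mat r).transpose * (a : Mat r).transpose = 1 := by
      rw [← Matrix.transpose_mul, h1, Matrix.transpose_one]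
    calc ((a⁻¹ : GL (Idx r) ℝ) : Mat r).transpose * gram r * ((a⁻¹ : GL (Idx r) ℝ) : Mat r)
        = ((a⁻¹ : GL (Idx r) ℝ) : Mat r).transpose *
            ((a : Mat r).transpose * gram r * (a : Mat r)) *
            ((a⁻¹ : GL (Idx r) ℝ) : Mat r) := by rw [ha]
      _ = (((a⁻¹ : GL (Idx r) ℝ) : Mat r).transpose * (a : Mat r).transpose) * gram r *
            ((a : Mat r) * ((a⁻¹ : GL (Idx r) ℝ) : Mat r)) := by
          simp only [Matrix.mul_assoc]
      _ = gram r := by rw [h1, h2, Matrix.one_mul, Matrix.mul_one]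

/-- The group `G^m = O(2, m - 1)`, where `m = r + 3`. -/
abbrev G (r : ℕ) : Type := orthGroup r

/-- The underlying matrix of an element of `O(2, r + 2)`. -/
abbrev mat {r : ℕ} (g : G r) : Mat r := ((g : GL (Idx r) ℝ) : Mat r)

/-- The Lie algebra `𝔤_m = 𝔬(2, m - 1)`, `m = r + 3`: all matrices `X` with `Xᵀ J = - J X`, where
`J` is the Gram matrix. -/
abbrev so2 (r : ℕ) : LieSubalgebra ℝ (Mat r) := skewAdjointMatricesLieSubalgebra (gram r)

/-- The identification of the index set with one coordinate added: the new coordinate is put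
last. -/
def idxEquiv (r : ℕ) : Idx r ⊕ Fin 1 ≃ Idx (r + 1) :=
  (Equiv.sumAssoc (Fin 4) (Fin r) (Fin 1)).trans
    (Equiv.sumCongr (Equiv.refl (Fin 4)) finSumFinEquiv)

/-- The map `M ↦ diag(M, 1)` on matrices. -/
def inclMat (r : ℕ) : Mat r →* Mat (r + 1) where
  toFun M := Matrix.reindex (idxEquiv r) (idxEquiv r) (Matrix.fromBlocks M 0 0 1)
  map_one' := by simp [Matrix.fromBlocks_one]
  map_mul' A B := by
    simp only [Matrix.reindex_apply, Matrix.submatrix_mul_equiv, Matrix.fromBlocks_multiply]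
    simp

theorem inclMat_gram (r : ℕ) : inclMat r (gram r) = gram (r + 1) := by
  have h : (Matrix.fromBlocks (gram r) 0 0 1 : Matrix (Idx r ⊕ Fin 1) (Idx r ⊕ Fin 1) ℝ)
      = (gram (r + 1)).submatrix (idxEquiv r) (idxEquiv r) := by
    have h1 : (1 : Matrix (Fin 1) (Fin 1) ℝ) = Matrix.diagonal fun _ => 1 := by simp
    rw [h1, gram, Matrix.fromBlocks_diagonal, gram, Matrix.submatrix_diagonal_equiv]
    congr 1
    ext i
    rcases i with (i | i) | i <;> simp [idxEquiv]
  change Matrix.reindex (idxEquiv r) (idxEquiv r) (Matrix.fromBlocks (gram r) 0 0 1) = _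
  rw [h]
  simp [Matrix.reindex_apply]

theorem inclMat_transpose (r : ℕ) (M : Mat r) :
    (inclMat r M).transpose = inclMat r M.transpose := by
  simp [inclMat, Matrix.reindex_apply, Matrix.fromBlocks_transpose]

/-- The inclusion `i : O(2, r + 2) → O(2, r + 3)`, `M ↦ diag(M, 1)`. -/
def incl (r : ℕ) : G r →* G (r + 1) :=
  MonoidHom.codRestrict ((Units.map (inclMat r)).comp (orthGroup r).subtype) (orthGroup (r + 1))
    (by
      intro g
      have hg : (mat g).transpose * gram r * (mat g) = gram r := g.2
      change (inclMat r (mat g)).transpose * gram (r + 1) * inclMat r (mat g) = gram (r + 1)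
      rw [inclMat_transpose, ← inclMat_gram, ← map_mul, ← map_mul, hg])

/-! ### The exponential map -/

theorem gram_mul_gram (r : ℕ) : gram r * gram r = 1 := by
  rw [gram, Matrix.diagonal_mul_diagonal, ← Matrix.diagonal_one]
  congr 1
  ext i
  rcases i with i | i
  · fin_cases i <;> simp
  · simp

theorem exp_mem (r : ℕ) (X : so2 r) :
    (NormedSpace.exp (X : Mat r)).transpose * gram r * NormedSpace.exp (X : Mat r) = gram r := by
  have hX : (X : Mat r).transpose * gram r = gram r * (-(X : Mat r)) :=
    (mem_skewAdjointMatricesSubmodule (gram r) (X : Mat r)).1 X.2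
  have hJ : IsUnit (gram r) := (Units.mk _ _ (gram_mul_gram r) (gram_mul_gram r)).isUnit
  have hJi : (gram r)⁻¹ = gram r := Matrix.inv_eq_left_inv (gram_mul_gram r)
  have h1 : (X : Mat r).transpose = gram r * (-(X : Mat r)) * (gram r)⁻¹ := by
    rw [hJi, ← hX, Matrix.mul_assoc, gram_mul_gram, Matrix.mul_one]
  have h2 : NormedSpace.exp (-(X : Mat r)) * NormedSpace.exp (X : Mat r) = 1 := by
    rw [← Matrix.exp_add_of_commute _ _ (Commute.neg_left (Commute.refl (X : Mat r)))]
    simp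
  rw [← Matrix.exp_transpose, h1, Matrix.exp_conj _ _ hJ, hJi, Matrix.mul_assoc _ (gram r) (gram r),
    gram_mul_gram, Matrix.mul_one, Matrix.mul_assoc, h2, Matrix.mul_one]

/-- The exponential map `𝔬(2, r + 2) → O(2, r + 2)`, given by the matrix exponential. -/
def expG {r : ℕ} (X : so2 r) : G r :=
  ⟨⟨NormedSpace.exp (X : Mat r), NormedSpace.exp (-(X : Mat r)),
    by
      rw [← Matrix.exp_add_of_commute _ _ (Commute.neg_right (Commute.refl (X : Mat r)))]
      simp,
    by
      rw [← Matrix.exp_add_of_commute _ _ (Commute.neg_left (Commute.refl (X : Mat r)))]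
      simp⟩, exp_mem r X⟩

/-- The analytic (connected Lie) subgroup of `O(2, r + 2)` with a given Lie algebra: it is
generated by the exponentials of the elements of the Lie algebra. -/
def analyticSubgroup {r : ℕ} (h : LieSubalgebra ℝ (so2 r)) : Subgroup (G r) :=
  Subgroup.closure (expG '' (h : Set (so2 r)))

/-! ### Root vectors -/

/-- The matrix of `H`. -/
def matH (r : ℕ) : Mat r :=
  Matrix.fromBlocks !![0, 0, 0, 1; 0, 0, 0, 0; 0, 0, 0, 0; 1, 0, 0, 0] 0 0 0

/-- The matrix of `H₂`. -/
def matH2 (r : ℕ) : Mat r :=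
  Matrix.fromBlocks !![0, 0, 0, 0; 0, 0, 1, 0; 0, 1, 0, 0; 0, 0, 0, 0] 0 0 0

/-- The matrix of `M_{ij}`. -/
def matM {r : ℕ} (i j : Fin r) : Mat r :=
  Matrix.fromBlocks 0 0 0 (Matrix.single i j 1 - Matrix.single j i 1)

/-- The matrix of `Y_j⁺`: the upper right block has the rows `e_j, 0, 0, e_j`, the lower left block
has the columns `e_j, 0, 0, -e_j`. -/
def matY {r : ℕ} (j : Fin r) : Mat r :=
  Matrix.fromBlocks 0 (Matrix.of fun a k => if k = j then ![1, 0, 0, 1] a else 0)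
    (Matrix.of fun k a => if k = j then ![1, 0, 0, -1] a else 0) 0

/-- The matrix of `Z_j⁺`: the upper right block has the rows `0, e_j, e_j, 0`, the lower left block
has the columns `0, e_j, -e_j, 0`. -/
def matZ {r : ℕ} (j : Fin r) : Mat r :=
  Matrix.fromBlocks 0 (Matrix.of fun a k => if k = j then ![0, 1, 1, 0] a else 0)
    (Matrix.of fun k a => if k = j then ![0, 1, -1, 0] a else 0) 0

/-- The matrix of `Q₁⁻`. -/
def matQ1 (r : ℕ) : Mat r :=
  Matrix.fromBlocks !![0, -1, 0, 0; 1, 0, 0, 1; 0, 0, 0, 0; 0, 1, 0, 0] 0 0 0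

/-- The matrix of `Q₂⁻`. -/
def matQ2 (r : ℕ) : Mat r :=
  Matrix.fromBlocks !![0, 0, 1, 0; 0, 0, 0, 0; 1, 0, 0, 1; 0, 0, -1, 0] 0 0 0

theorem mem_so2 {r : ℕ} (X : Mat r) : X ∈ so2 r ↔ X.transpose * gram r = -(gram r * X) := by
  rw [mem_skewAdjointMatricesLieSubalgebra, mem_skewAdjointMatricesSubmodule]
  change X.transpose * gram r = gram r * (-X) ↔ _
  rw [Matrix.mul_neg]

theorem transpose_mem_so2 {r : ℕ} {X : Mat r} (h : X ∈ so2 r) : X.transpose ∈ so2 r := by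
  rw [mem_so2] at *
  have h1 : gram r * (X.transpose * gram r) * gram r = -(gram r * (gram r * X) * gram r) := by
    rw [h, Matrix.mul_neg, Matrix.neg_mul]
  rw [← Matrix.mul_assoc (gram r) (gram r) X, gram_mul_gram, Matrix.one_mul, Matrix.mul_assoc,
    Matrix.mul_assoc, gram_mul_gram, Matrix.mul_one] at h1
  rw [h1, Matrix.transpose_transpose, neg_neg]

theorem matH_mem (r : ℕ) : matH r ∈ so2 r := by
  rw [mem_so2]
  ext (a | a) (b | b) <;> simp [gram, matH]
  fin_cases a <;> fin_cases b <;> simp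

theorem matH2_mem (r : ℕ) : matH2 r ∈ so2 r := by
  rw [mem_so2]
  ext (a | a) (b | b) <;> simp [gram, matH2]
  fin_cases a <;> fin_cases b <;> simp

theorem matQ1_mem (r : ℕ) : matQ1 r ∈ so2 r := by
  rw [mem_so2]
  ext (a | a) (b | b) <;> simp [gram, matQ1]
  fin_cases a <;> fin_cases b <;> simp

theorem matQ2_mem (r : ℕ) : matQ2 r ∈ so2 r := by
  rw [mem_so2]
  ext (a | a) (b | b) <;> simp [gram, matQ2]
  fin_cases a <;> fin_cases b <;> simp

theorem matM_mem {r : ℕ} (i j : Fin r) : matM i j ∈ so2 r := by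
  rw [mem_so2]
  ext (a | a) (b | b) <;> simp [gram, matM, Matrix.single_apply, and_comm]

theorem matY_mem {r : ℕ} (j : Fin r) : matY j ∈ so2 r := by
  rw [mem_so2]
  ext (a | a) (b | b) <;> simp [gram, matY]
  · fin_cases a <;> simp <;> split_ifs <;> simp
  · fin_cases b <;> simp <;> split_ifs <;> simp

theorem matZ_mem {r : ℕ} (j : Fin r) : matZ j ∈ so2 r := by
  rw [mem_so2]
  ext (a | a) (b | b) <;> simp [gram, matZ]
  · fin_cases a <;> simp <;> split_ifs <;> simp
  · fin_cases b <;> simp <;> split_ifs <;> simp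

/-- `H`, which spans `𝔞`. -/
def H (r : ℕ) : so2 r := ⟨matH r, matH_mem r⟩

/-- `H₂`. -/
def H2 (r : ℕ) : so2 r := ⟨matH2 r, matH2_mem r⟩

/-- `M_{ij}`. -/
def M {r : ℕ} (i j : Fin r) : so2 r := ⟨matM i j, matM_mem i j⟩

/-- `Y_j⁺`. -/
def Yp {r : ℕ} (j : Fin r) : so2 r := ⟨matY j, matY_mem j⟩

/-- `Y_j⁻ = (Y_j⁺)ᵗ`. -/
def Ym {r : ℕ} (j : Fin r) : so2 r := ⟨(matY j).transpose, transpose_mem_so2 (matY_mem j)⟩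

/-- `Z_j⁺`. -/
def Zp {r : ℕ} (j : Fin r) : so2 r := ⟨matZ j, matZ_mem j⟩

/-- `Z_j⁻ = (Z_j⁺)ᵗ`. -/
def Zm {r : ℕ} (j : Fin r) : so2 r := ⟨(matZ j).transpose, transpose_mem_so2 (matZ_mem j)⟩

/-- `Q₁⁻`. -/
def Q1m (r : ℕ) : so2 r := ⟨matQ1 r, matQ1_mem r⟩

/-- `Q₂⁻`. -/
def Q2m (r : ℕ) : so2 r := ⟨matQ2 r, matQ2_mem r⟩

/-- `Q₁⁺ = (Q₁⁻)ᵗ`. -/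
def Q1p (r : ℕ) : so2 r := ⟨(matQ1 r).transpose, transpose_mem_so2 (matQ1_mem r)⟩

/-- `Q₂⁺ = (Q₂⁻)ᵗ`. -/
def Q2p (r : ℕ) : so2 r := ⟨(matQ2 r).transpose, transpose_mem_so2 (matQ2_mem r)⟩

/-! ### The subalgebras `𝔪`, `𝔞`, `𝔫⁺`, `𝔫⁻` -/

/-- The linear span of a set that spans the brackets of its elements, as a Lie subalgebra. -/
def spanLie {L : Type*} [LieRing L] [LieAlgebra ℝ L] (S : Set L)
    (h : ∀ x ∈ S, ∀ y ∈ S, ⁅x, y⁆ ∈ Submodule.span ℝ S) : LieSubalgebra ℝ L where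
  toSubmodule := Submodule.span ℝ S
  lie_mem' := by
    intro x y hx hy
    change x ∈ Submodule.span ℝ S at hx
    change y ∈ Submodule.span ℝ S at hy
    change ⁅x, y⁆ ∈ Submodule.span ℝ S
    induction hx using Submodule.span_induction with
    | mem x hx =>
      induction hy using Submodule.span_induction with
      | mem y hy => exact h x hx y hy
      | zero => simp
      | add a b _ _ ha hb => rw [lie_add]; exact add_mem ha hb
      | smul c a _ ha => rw [lie_smul]; exact Submodule.smul_mem _ _ ha
    | zero => simp
    | add a b _ _ ha hb => rw [add_lie]; exact add_mem ha hb
    | smul c a _ ha => rw [smul_lie]; exact Submodule.smul_mem _ _ ha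

theorem lie_M_M {r : ℕ} (i j k l : Fin r) : ⁅M i j, M k l⁆ =
    (if j = k then (1 : ℝ) else 0) • M i l - (if i = k then (1 : ℝ) else 0) • M j l -
      (if j = l then (1 : ℝ) else 0) • M i k + (if i = l then (1 : ℝ) else 0) • M j k := by
  apply Subtype.ext
  change matM i j * matM k l - matM k l * matM i j =
    _ • matM i l - _ • matM j l - _ • matM i k + _ • matM j k
  ext (a | a) (b | b) <;>
    simp [-ite_smul, matM, Matrix.mul_apply, Matrix.single_apply, mul_sub, ite_and]
  grind

theorem lie_M_Zp {r : ℕ} (i j k : Fin r) : ⁅M i j, Zp k⁆ =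
    (if j = k then (1 : ℝ) else 0) • Zp i - (if i = k then (1 : ℝ) else 0) • Zp j := by
  apply Subtype.ext
  change matM i j * matZ k - matZ k * matM i j = _ • matZ i - _ • matZ j
  ext (a | a) (b | b) <;> simp [-ite_smul, matM, matZ, Matrix.mul_apply, Matrix.single_apply]
  · fin_cases a <;> simp <;> grind
  · fin_cases b <;> simp <;> grind

theorem lie_M_Zm {r : ℕ} (i j k : Fin r) : ⁅M i j, Zm k⁆ =
    (if j = k then (1 : ℝ) else 0) • Zm i - (if i = k then (1 : ℝ) else 0) • Zm j := by
  apply Subtype.ext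
  change matM i j * (matZ k).transpose - (matZ k).transpose * matM i j =
    _ • (matZ i).transpose - _ • (matZ j).transpose
  ext (a | a) (b | b) <;> simp [-ite_smul, matM, matZ, Matrix.mul_apply, Matrix.single_apply]
  · fin_cases a <;> simp <;> grind
  · fin_cases b <;> simp <;> grind

theorem lie_H2_Zp {r : ℕ} (k : Fin r) : ⁅H2 r, Zp k⁆ = Zp k := by
  apply Subtype.ext
  change matH2 r * matZ k - matZ k * matH2 r = matZ k
  ext (a | a) (b | b) <;> simp [matH2, matZ, Matrix.mul_apply, Fin.sum_univ_four]
  · fin_cases a <;> simp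
  · fin_cases b <;> simp <;> grind

theorem lie_H2_Zm {r : ℕ} (k : Fin r) : ⁅H2 r, Zm k⁆ = -Zm k := by
  apply Subtype.ext
  change matH2 r * (matZ k).transpose - (matZ k).transpose * matH2 r = -(matZ k).transpose
  ext (a | a) (b | b) <;> simp [matH2, matZ, Matrix.mul_apply, Fin.sum_univ_four]
  · fin_cases a <;> simp <;> grind
  · fin_cases b <;> simp

theorem lie_H2_M {r : ℕ} (i j : Fin r) : ⁅H2 r, M i j⁆ = 0 := by
  apply Subtype.ext
  change matH2 r * matM i j - matM i j * matH2 r = 0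
  simp [matH2, matM, Matrix.fromBlocks_multiply]

theorem lie_Zp_Zp {r : ℕ} (i j : Fin r) : ⁅Zp i, Zp j⁆ = 0 := by
  apply Subtype.ext
  change matZ i * matZ j - matZ j * matZ i = 0
  ext (a | a) (b | b) <;> simp [matZ, Matrix.mul_apply, Fin.sum_univ_four]
  · grind

theorem lie_Zm_Zm {r : ℕ} (i j : Fin r) : ⁅Zm i, Zm j⁆ = 0 := by
  apply Subtype.ext
  change (matZ i).transpose * (matZ j).transpose - (matZ j).transpose * (matZ i).transpose = 0
  ext (a | a) (b | b) <;> simp [matZ, Matrix.mul_apply, Fin.sum_univ_four]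
  · grind

theorem lie_Zp_Zm {r : ℕ} (i j : Fin r) : ⁅Zp i, Zm j⁆ =
    (if i = j then (2 : ℝ) else 0) • H2 r + (2 : ℝ) • M i j := by
  apply Subtype.ext
  change matZ i * (matZ j).transpose - (matZ j).transpose * matZ i = _ • matH2 r + _ • matM i j
  ext (a | a) (b | b) <;> simp [-ite_smul, matM, matH2, matZ, Matrix.mul_apply, Fin.sum_univ_four,
    Matrix.single_apply]
  · fin_cases a <;> fin_cases b <;> simp <;> grind
  · grind

/-- The root vectors that span `𝔪`. -/
def genM (r : ℕ) : Set (so2 r) :=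
  Set.range (fun p : Fin r × Fin r => M p.1 p.2) ∪ Set.range Zp ∪ Set.range Zm ∪ {H2 r}

/-- The root vectors that span `𝔫⁻`. -/
def genNm (r : ℕ) : Set (so2 r) := Set.range Ym ∪ {Q1m r, Q2m r}

/-- The root vectors that span `𝔫⁺`. -/
def genNp (r : ℕ) : Set (so2 r) := Set.range Yp ∪ {Q1p r, Q2p r}

theorem genM_lie (r : ℕ) : ∀ x ∈ genM r, ∀ y ∈ genM r, ⁅x, y⁆ ∈ Submodule.span ℝ (genM r) := by
  have hM : ∀ i j, M i j ∈ Submodule.span ℝ (genM r) := fun i j =>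
    Submodule.subset_span (Or.inl (Or.inl (Or.inl ⟨(i, j), rfl⟩)))
  have hp : ∀ i, Zp i ∈ Submodule.span ℝ (genM r) := fun i =>
    Submodule.subset_span (Or.inl (Or.inl (Or.inr ⟨i, rfl⟩)))
  have hm : ∀ i, Zm i ∈ Submodule.span ℝ (genM r) := fun i =>
    Submodule.subset_span (Or.inl (Or.inr ⟨i, rfl⟩))
  have hH : H2 r ∈ Submodule.span ℝ (genM r) := Submodule.subset_span (Or.inr rfl)
  have hs : ∀ (c : ℝ) (x : so2 r), x ∈ Submodule.span ℝ (genM r) →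
      c • x ∈ Submodule.span ℝ (genM r) := fun c x hx => Submodule.smul_mem _ c hx
  have sk : ∀ x y : so2 r, ⁅x, y⁆ ∈ Submodule.span ℝ (genM r) →
      ⁅y, x⁆ ∈ Submodule.span ℝ (genM r) := by
    intro x y h
    rw [← lie_skew]
    exact Submodule.neg_mem _ h
  have b1 : ∀ i j k : Fin r, ⁅M i j, Zp k⁆ ∈ Submodule.span ℝ (genM r) := by
    intro i j k
    rw [lie_M_Zp]
    exact Submodule.sub_mem _ (hs _ _ (hp _)) (hs _ _ (hp _))
  have b2 : ∀ i j k : Fin r, ⁅M i j, Zm k⁆ ∈ Submodule.span ℝ (genM r) := by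
    intro i j k
    rw [lie_M_Zm]
    exact Submodule.sub_mem _ (hs _ _ (hm _)) (hs _ _ (hm _))
  have b3 : ∀ i j : Fin r, ⁅H2 r, M i j⁆ ∈ Submodule.span ℝ (genM r) := by
    intro i j
    rw [lie_H2_M]
    exact Submodule.zero_mem _
  have b4 : ∀ i j : Fin r, ⁅Zp i, Zm j⁆ ∈ Submodule.span ℝ (genM r) := by
    intro i j
    rw [lie_Zp_Zm]
    exact Submodule.add_mem _ (hs _ _ hH) (hs _ _ (hM _ _))
  have b5 : ∀ i : Fin r, ⁅H2 r, Zp i⁆ ∈ Submodule.span ℝ (genM r) := by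
    intro i
    rw [lie_H2_Zp]
    exact hp i
  have b6 : ∀ i : Fin r, ⁅H2 r, Zm i⁆ ∈ Submodule.span ℝ (genM r) := by
    intro i
    rw [lie_H2_Zm]
    exact Submodule.neg_mem _ (hm i)
  rintro x (((⟨⟨i, j⟩, rfl⟩ | ⟨i, rfl⟩) | ⟨i, rfl⟩) | rfl) y
    (((⟨⟨k, l⟩, rfl⟩ | ⟨k, rfl⟩) | ⟨k, rfl⟩) | rfl)
  · change ⁅M i j, M k l⁆ ∈ _
    rw [lie_M_M]
    exact Submodule.add_mem _ (Submodule.sub_mem _ (Submodule.sub_mem _ (hs _ _ (hM _ _))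
      (hs _ _ (hM _ _))) (hs _ _ (hM _ _))) (hs _ _ (hM _ _))
  · exact b1 i j k
  · exact b2 i j k
  · exact sk _ _ (b3 i j)
  · exact sk _ _ (b1 k l i)
  · rw [lie_Zp_Zp]
    exact Submodule.zero_mem _
  · exact b4 i k
  · exact sk _ _ (b5 i)
  · exact sk _ _ (b2 k l i)
  · exact sk _ _ (b4 k i)
  · rw [lie_Zm_Zm]
    exact Submodule.zero_mem _
  · exact sk _ _ (b6 i)
  · exact b3 k l
  · exact b5 k
  · exact b6 k
  · rw [lie_self]
    exact Submodule.zero_mem _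

theorem genNp_comm (r : ℕ) : ∀ x ∈ genNp r, ∀ y ∈ genNp r, ⁅x, y⁆ = 0 := by
  have sk : ∀ x y : so2 r, ⁅x, y⁆ = 0 → ⁅y, x⁆ = 0 := by
    intro x y h
    rw [← lie_skew, h, neg_zero]
  have b1 : ∀ i j : Fin r, ⁅Yp i, Yp j⁆ = 0 := by
    intro i j
    apply Subtype.ext
    change matY i * matY j - matY j * matY i = 0
    ext (a | a) (b | b) <;> simp [matY, Matrix.mul_apply, Fin.sum_univ_four]
    · grind
  have b2 : ∀ i : Fin r, ⁅Yp i, Q1p r⁆ = 0 := by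
    intro i
    apply Subtype.ext
    change matY i * (matQ1 r).transpose - (matQ1 r).transpose * matY i = 0
    ext (a | a) (b | b) <;> simp [matY, matQ1, Matrix.mul_apply, Fin.sum_univ_four]
    fin_cases a <;> simp
  have b3 : ∀ i : Fin r, ⁅Yp i, Q2p r⁆ = 0 := by
    intro i
    apply Subtype.ext
    change matY i * (matQ2 r).transpose - (matQ2 r).transpose * matY i = 0
    ext (a | a) (b | b) <;> simp [matY, matQ2, Matrix.mul_apply, Fin.sum_univ_four]
    fin_cases a <;> simp
  have b4 : ⁅Q1p r, Q2p r⁆ = 0 := by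
    apply Subtype.ext
    change (matQ1 r).transpose * (matQ2 r).transpose - (matQ2 r).transpose * (matQ1 r).transpose = 0
    ext (a | a) (b | b) <;> simp [matQ1, matQ2, Matrix.mul_apply, Fin.sum_univ_four]
    fin_cases a <;> fin_cases b <;> simp
  rintro x (⟨i, rfl⟩ | rfl | rfl) y (⟨j, rfl⟩ | rfl | rfl)
  · exact b1 i j
  · exact b2 i
  · exact b3 i
  · exact sk _ _ (b2 j)
  · exact lie_self _
  · exact b4
  · exact sk _ _ (b3 j)
  · exact sk _ _ b4
  · exact lie_self _

theorem genNm_comm (r : ℕ) : ∀ x ∈ genNm r, ∀ y ∈ genNm r, ⁅x, y⁆ = 0 := by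
  have tr : ∀ x ∈ genNm r, ∃ x' ∈ genNp r, (x' : Mat r) = (x : Mat r).transpose := by
    rintro x (⟨i, rfl⟩ | rfl | rfl)
    · exact ⟨Yp i, Or.inl ⟨i, rfl⟩, (Matrix.transpose_transpose _).symm⟩
    · exact ⟨Q1p r, Or.inr (Or.inl rfl), rfl⟩
    · exact ⟨Q2p r, Or.inr (Or.inr rfl), rfl⟩
  intro x hx y hy
  obtain ⟨x', hx', ex⟩ := tr x hx
  obtain ⟨y', hy', ey⟩ := tr y hy
  have h := congrArg Subtype.val (genNp_comm r y' hy' x' hx')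
  change (y' : Mat r) * (x' : Mat r) - (x' : Mat r) * (y' : Mat r) = 0 at h
  apply Subtype.ext
  change (x : Mat r) * (y : Mat r) - (y : Mat r) * (x : Mat r) = 0
  rw [ex, ey, ← Matrix.transpose_mul, ← Matrix.transpose_mul, ← Matrix.transpose_sub] at h
  exact Matrix.transpose_eq_zero.1 h

/-- `𝔪 = 𝔪_𝔮 ⊕ 𝔤_{f₂} ⊕ 𝔤_{-f₂} ⊕ ℝ H₂`, the span of the `M_{ij}`, the `Z_j^±` and `H₂`. -/
def subM (r : ℕ) : LieSubalgebra ℝ (so2 r) := spanLie (genM r) (genM_lie r)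

/-- `𝔫⁺ = 𝔤_{f₁} ⊕ 𝔤_{f₁+f₂} ⊕ 𝔤_{f₁-f₂}`, the span of the `Y_j⁺`, `Q₁⁺` and `Q₂⁺`. -/
def subNp (r : ℕ) : LieSubalgebra ℝ (so2 r) :=
  spanLie (genNp r) fun x hx y hy => by
    rw [genNp_comm r x hx y hy]
    exact Submodule.zero_mem _

/-- `𝔫⁻ = 𝔤_{-f₁} ⊕ 𝔤_{-f₁-f₂} ⊕ 𝔤_{-f₁+f₂}`, the span of the `Y_j⁻`, `Q₁⁻` and `Q₂⁻`. -/
def subNm (r : ℕ) : LieSubalgebra ℝ (so2 r) :=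
  spanLie (genNm r) fun x hx y hy => by
    rw [genNm_comm r x hx y hy]
    exact Submodule.zero_mem _

/-! ## Smooth functions on the group and the regular representations -/

/-- The space of matrices as a plain space of functions of two indices, with the sup norm. -/
abbrev Ent (r : ℕ) : Type := Idx r → Idx r → ℝ

/-- The entries of a matrix. -/
def ent {r : ℕ} (A : Mat r) : Ent r := fun a b => A a b

/-- `y ↦ y A` on matrices. -/
def mulR {r : ℕ} (A : Mat r) : Ent r →L[ℝ] Ent r :=
  LinearMap.toContinuousLinearMap
    { toFun := fun y => ent (Matrix.of y * A)
      map_add' := fun x y => Matrix.add_mul (Matrix.of x) (Matrix.of y) A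
      map_smul' := fun c x => Matrix.smul_mul c (Matrix.of x) A }

/-- `y ↦ A y` on matrices. -/
def mulL {r : ℕ} (A : Mat r) : Ent r →L[ℝ] Ent r :=
  LinearMap.toContinuousLinearMap
    { toFun := fun y => ent (A * Matrix.of y)
      map_add' := fun x y => Matrix.mul_add A (Matrix.of x) (Matrix.of y)
      map_smul' := fun c x => Matrix.mul_smul A c (Matrix.of x) }

theorem mulR_ent {r : ℕ} (A B : Mat r) : mulR A (ent B) = ent (B * A) := rfl

theorem mulL_ent {r : ℕ} (A B : Mat r) : mulL A (ent B) = ent (A * B) := rfl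

/-- `F` is a smooth extension of `f` to the open set `U` of matrices. -/
structure IsLocalExt {r : ℕ} (f : G r → ℂ) (U : Set (Ent r)) (F : Ent r → ℂ) : Prop where
  isOpen : IsOpen U
  contDiffOn : ContDiffOn ℝ ∞ F U
  eq_on : ∀ x : G r, ent (mat x) ∈ U → f x = F (ent (mat x))

/-- Smoothness of a function on `O(2, r + 2)`, as a function on an embedded submanifold of the
space of all matrices: near every point it is the restriction of a smooth function on an open set
of matrices. -/
def IsSmooth {r : ℕ} (f : G r → ℂ) : Prop :=
  ∀ g : G r, ∃ (U : Set (Ent r)) (F : Ent r → ℂ), ent (mat g) ∈ U ∧ IsLocalExt f U F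

theorem IsLocalExt.mono {r : ℕ} {f : G r → ℂ} {U V : Set (Ent r)} {F : Ent r → ℂ}
    (h : IsLocalExt f U F) (hV : IsOpen V) (hVU : V ⊆ U) : IsLocalExt f V F :=
  ⟨hV, h.contDiffOn.mono hVU, fun x hx => h.eq_on x (hVU hx)⟩

theorem IsLocalExt.add {r : ℕ} {f₁ f₂ : G r → ℂ} {U : Set (Ent r)} {F₁ F₂ : Ent r → ℂ}
    (h₁ : IsLocalExt f₁ U F₁) (h₂ : IsLocalExt f₂ U F₂) :
    IsLocalExt (f₁ + f₂) U (fun x => F₁ x + F₂ x) :=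
  ⟨h₁.isOpen, h₁.contDiffOn.add h₂.contDiffOn, fun x hx => by
    rw [Pi.add_apply, h₁.eq_on x hx, h₂.eq_on x hx]⟩

theorem IsLocalExt.smul {r : ℕ} {f : G r → ℂ} {U : Set (Ent r)} {F : Ent r → ℂ} (c : ℂ)
    (h : IsLocalExt f U F) : IsLocalExt (c • f) U (fun x => c • F x) :=
  ⟨h.isOpen, h.contDiffOn.const_smul c, fun x hx => by rw [Pi.smul_apply, h.eq_on x hx]⟩

/-- `C^∞(O(2, r + 2))`, with complex values. -/
def SmoothFn (r : ℕ) : Submodule ℂ (G r → ℂ) where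
  carrier := {f | IsSmooth f}
  zero_mem' := fun _ =>
    ⟨Set.univ, fun _ => 0, Set.mem_univ _, isOpen_univ, contDiffOn_const, fun _ _ => rfl⟩
  add_mem' := by
    intro f₁ f₂ h₁ h₂ g
    obtain ⟨U₁, F₁, hg₁, e₁⟩ := h₁ g
    obtain ⟨U₂, F₂, hg₂, e₂⟩ := h₂ g
    have ho := e₁.isOpen.inter e₂.isOpen
    exact ⟨U₁ ∩ U₂, _, ⟨hg₁, hg₂⟩, (e₁.mono ho Set.inter_subset_left).add
      (e₂.mono ho Set.inter_subset_right)⟩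
  smul_mem' := by
    intro c f h g
    obtain ⟨U, F, hg, e⟩ := h g
    exact ⟨U, _, hg, e.smul c⟩

/-- The derivative `(R(X) f)(g) = d/dt|_{t = 0} f(g exp(tX))`. -/
def rightDeriv {r : ℕ} (X : so2 r) (f : G r → ℂ) (g : G r) : ℂ :=
  deriv (fun t : ℝ => f (g * expG (t • X))) 0

theorem hasDerivAt_curve {r : ℕ} (X : so2 r) (g : G r) :
    HasDerivAt (fun t : ℝ => ent (mat (g * expG (t • X)))) (mulR (X : Mat r) (ent (mat g))) 0 := by
  let _ : NormedRing (Mat r) := Matrix.linftyOpNormedRing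
  let _ : NormedAlgebra ℝ (Mat r) := Matrix.linftyOpNormedAlgebra
  have h := (hasDerivAt_exp_smul_const (𝕂 := ℝ) (X : Mat r) (0 : ℝ)).const_mul (mat g)
  rw [zero_smul, NormedSpace.exp_zero, one_mul] at h
  rw [mulR_ent, hasDerivAt_pi]
  intro a
  rw [hasDerivAt_pi]
  intro b
  let L : Mat r →ₗ[ℝ] ℝ := Matrix.entryLinearMap ℝ ℝ a b
  have hL := (LinearMap.toContinuousLinearMap L).hasFDerivAt (x := mat g * NormedSpace.exp ((0 : ℝ) • (X : Mat r)))
  exact hL.comp_hasDerivAt (0 : ℝ) h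

theorem IsLocalExt.hasDerivAt {r : ℕ} {f : G r → ℂ} {U : Set (Ent r)} {F : Ent r → ℂ}
    (h : IsLocalExt f U F) (X : so2 r) (g : G r) (hg : ent (mat g) ∈ U) :
    HasDerivAt (fun t : ℝ => f (g * expG (t • X)))
      (fderiv ℝ F (ent (mat g)) (mulR (X : Mat r) (ent (mat g)))) 0 := by
  have hc := hasDerivAt_curve X g
  have h0 : ent (mat (g * expG ((0 : ℝ) • X))) = ent (mat g) := by
    change ent (mat g * NormedSpace.exp ((0 : ℝ) • (X : Mat r))) = ent (mat g)
    simp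
  have hF : HasFDerivAt F (fderiv ℝ F (ent (mat g))) (ent (mat (g * expG ((0 : ℝ) • X)))) := by
    rw [h0]
    exact ((h.contDiffOn.contDiffAt (h.isOpen.mem_nhds hg)).differentiableAt
      (by simp)).hasFDerivAt
  have h1 := hF.comp_hasDerivAt (0 : ℝ) hc
  refine h1.congr_of_eventuallyEq ?_
  have h2 : ∀ᶠ t : ℝ in nhds 0, ent (mat (g * expG (t • X))) ∈ U := by
    apply hc.continuousAt.eventually_mem
    rw [h0]
    exact h.isOpen.mem_nhds hg
  filter_upwards [h2] with t ht
  exact h.eq_on (g * expG (t • X)) ht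

theorem IsLocalExt.rightDeriv_eq {r : ℕ} {f : G r → ℂ} {U : Set (Ent r)} {F : Ent r → ℂ}
    (h : IsLocalExt f U F) (X : so2 r) (g : G r) (hg : ent (mat g) ∈ U) :
    rightDeriv X f g = fderiv ℝ F (ent (mat g)) (mulR (X : Mat r) (ent (mat g))) :=
  (h.hasDerivAt X g hg).deriv

theorem IsLocalExt.rightDeriv {r : ℕ} {f : G r → ℂ} {U : Set (Ent r)} {F : Ent r → ℂ}
    (h : IsLocalExt f U F) (X : so2 r) :
    IsLocalExt (rightDeriv X f) U (fun y => fderiv ℝ F y (mulR (X : Mat r) y)) := by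
  refine ⟨h.isOpen, ?_, fun x hx => h.rightDeriv_eq X x hx⟩
  have h1 : ContDiffOn ℝ ∞ (fderiv ℝ F) U := h.contDiffOn.fderiv_of_isOpen h.isOpen (by simp)
  exact h1.clm_apply (mulR (X : Mat r)).contDiff.contDiffOn

/-- The operator `R(X)` on `C^∞(O(2, r + 2))`, `(R(X) u)(x) = d/dt|_{t = 0} u(x exp(tX))`. -/
def derivOp {r : ℕ} (X : so2 r) : Module.End ℂ (SmoothFn r) where
  toFun f := ⟨rightDeriv X f, fun g => by
    obtain ⟨U, F, hg, e⟩ := f.2 g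
    exact ⟨U, _, hg, e.rightDeriv X⟩⟩
  map_add' := by
    intro f₁ f₂
    apply Subtype.ext
    funext g
    obtain ⟨U₁, F₁, hg₁, e₁⟩ := f₁.2 g
    obtain ⟨U₂, F₂, hg₂, e₂⟩ := f₂.2 g
    have h₁ := e₁.hasDerivAt X g hg₁
    have h₂ := e₂.hasDerivAt X g hg₂
    change rightDeriv X (fun x => f₁.1 x + f₂.1 x) g = rightDeriv X f₁ g + rightDeriv X f₂ g
    rw [e₁.rightDeriv_eq X g hg₁, e₂.rightDeriv_eq X g hg₂]
    exact (h₁.add h₂).deriv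
  map_smul' := by
    intro c f
    apply Subtype.ext
    funext g
    obtain ⟨U, F, hg, e⟩ := f.2 g
    change rightDeriv X (fun x => c • f.1 x) g = c • rightDeriv X f g
    rw [e.rightDeriv_eq X g hg]
    exact ((e.hasDerivAt X g hg).const_smul c).deriv

/-- `X ↦ R(X)` as a homomorphism of real Lie algebras. -/
def derivHom (r : ℕ) : so2 r →ₗ⁅ℝ⁆ Module.End ℂ (SmoothFn r) where
  toFun := derivOp
  map_add' := by
    intro X Y
    ext f g
    obtain ⟨U, F, hg, e⟩ := f.2 g
    change rightDeriv (X + Y) f g = rightDeriv X f g + rightDeriv Y f g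
    rw [e.rightDeriv_eq _ g hg, e.rightDeriv_eq _ g hg, e.rightDeriv_eq _ g hg, ← map_add]
    congr 1
    exact congrArg ent (Matrix.mul_add (mat g) (X : Mat r) (Y : Mat r))
  map_smul' := by
    intro c X
    ext f g
    obtain ⟨U, F, hg, e⟩ := f.2 g
    change rightDeriv (c • X) f g = c • rightDeriv X f g
    rw [e.rightDeriv_eq _ g hg, e.rightDeriv_eq _ g hg, ← (fderiv ℝ F (ent (mat g))).map_smul]
    congr 1
    exact congrArg ent (Matrix.mul_smul (mat g) c (X : Mat r))
  map_lie' := by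
    intro X Y
    ext f g
    obtain ⟨U, F, hg, e⟩ := f.2 g
    change rightDeriv ⁅X, Y⁆ f g = rightDeriv X (rightDeriv Y f) g - rightDeriv Y (rightDeriv X f) g
    rw [e.rightDeriv_eq _ g hg, (e.rightDeriv Y).rightDeriv_eq X g hg,
      (e.rightDeriv X).rightDeriv_eq Y g hg]
    have hs : ContDiffAt ℝ ∞ F (ent (mat g)) := e.contDiffOn.contDiffAt (e.isOpen.mem_nhds hg)
    have hm : minSmoothness ℝ 2 ≤ (∞ : WithTop ℕ∞) := by
      rw [minSmoothness_of_isRCLikeNormedField]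
      exact WithTop.coe_le_coe.2 le_top
    have key := VectorField.fderiv_apply_lieBracket (V := fun y => mulR (X : Mat r) y)
      (W := fun y => mulR (Y : Mat r) y) hs hm
      (mulR (Y : Mat r)).differentiableAt (mulR (X : Mat r)).differentiableAt
    rw [← key]
    congr 1
    rw [VectorField.lieBracket, ContinuousLinearMap.fderiv, ContinuousLinearMap.fderiv]
    change ent (mat g * ((X : Mat r) * (Y : Mat r) - (Y : Mat r) * (X : Mat r))) =
      ent ((mat g * (X : Mat r)) * (Y : Mat r) - (mat g * (Y : Mat r)) * (X : Mat r))
    rw [Matrix.mul_sub, Matrix.mul_assoc, Matrix.mul_assoc]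

/-- The left regular representation `(π(g) u)(x) = u(g⁻¹ x)` on `C^∞(O(2, r + 2))`. -/
def leftRegular (r : ℕ) : Representation ℂ (G r) (SmoothFn r) where
  toFun g :=
    { toFun := fun u => ⟨fun x => u.1 (g⁻¹ * x), fun x => by
        obtain ⟨U, F, hx, e⟩ := u.2 (g⁻¹ * x)
        exact ⟨mulL (mat g⁻¹) ⁻¹' U, fun y => F (mulL (mat g⁻¹) y), hx,
          e.isOpen.preimage (mulL (mat g⁻¹)).continuous,
          e.contDiffOn.comp (mulL (mat g⁻¹)).contDiff.contDiffOn (fun _ hy => hy),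
          fun y hy => e.eq_on (g⁻¹ * y) hy⟩⟩
      map_add' := fun _ _ => rfl
      map_smul' := fun _ _ => rfl }
  map_one' := by
    ext u x
    change u.1 (1⁻¹ * x) = u.1 x
    rw [inv_one, one_mul]
  map_mul' g h := by
    ext u x
    change u.1 ((g * h)⁻¹ * x) = u.1 (h⁻¹ * (g⁻¹ * x))
    rw [mul_inv_rev, mul_assoc]

/-! ## Universal enveloping algebras -/

/-- The complex universal enveloping algebra `𝓤(L)` of a real Lie algebra `L`: the enveloping
algebra over `ℝ` with scalars extended to `ℂ`, which is the same as the enveloping algebra over `ℂ`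
of the complexification of `L`. -/
abbrev CU (L : Type*) [LieRing L] [LieAlgebra ℝ L] : Type _ :=
  ℂ ⊗[ℝ] UniversalEnvelopingAlgebra ℝ L

/-- The canonical map `L → 𝓤(L)`. -/
def toCU {L : Type*} [LieRing L] [LieAlgebra ℝ L] (x : L) : CU L :=
  1 ⊗ₜ[ℝ] UniversalEnvelopingAlgebra.ι ℝ x

/-- The homomorphism `𝓤(𝔥) → 𝓤(L)` induced by a Lie subalgebra `𝔥` of `L`. -/
def mapCU {L : Type*} [LieRing L] [LieAlgebra ℝ L] (h : LieSubalgebra ℝ L) : CU h →ₐ[ℂ] CU L :=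
  Algebra.TensorProduct.map (AlgHom.id ℂ ℂ)
    (UniversalEnvelopingAlgebra.lift ℝ ((UniversalEnvelopingAlgebra.ι ℝ).comp h.incl))

theorem diffOp_commute (r : ℕ) (c : ℂ) (x : UniversalEnvelopingAlgebra ℝ (so2 r)) :
    Commute (Algebra.ofId ℂ (Module.End ℂ (SmoothFn r)) c)
      (UniversalEnvelopingAlgebra.lift ℝ (derivHom r) x) :=
  Algebra.commutes c _

/-- The action `R` of `𝓤(𝔤)` on `C^∞(O(2, r + 2))` by left-invariant differential operators: the
extension of `X ↦ R(X)` to a homomorphism of complex algebras. -/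
def diffOp (r : ℕ) : CU (so2 r) →ₐ[ℂ] Module.End ℂ (SmoothFn r) :=
  Algebra.TensorProduct.lift (Algebra.ofId ℂ (Module.End ℂ (SmoothFn r)))
    (UniversalEnvelopingAlgebra.lift ℝ (derivHom r)) (diffOp_commute r)

/-- `R(X)` is indeed how `X` acts. -/
theorem diffOp_toCU (r : ℕ) (X : so2 r) (u : SmoothFn r) (g : G r) :
    (diffOp r (toCU X) u).1 g = deriv (fun t : ℝ => u.1 (g * expG (t • X))) 0 := by
  have h : diffOp r (toCU X) = derivHom r X := by
    rw [diffOp, toCU, Algebra.TensorProduct.lift_tmul]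
    rw [map_one, one_mul, UniversalEnvelopingAlgebra.lift_ι_apply]
  rw [h]
  rfl

/-! ## Principal series -/

/-- `M₀`, the analytic subgroup with Lie algebra `𝔪`. -/
def M0 (r : ℕ) : Subgroup (G r) := analyticSubgroup (subM r)

/-- `N⁺`, the analytic subgroup with Lie algebra `𝔫⁺`. -/
def Np (r : ℕ) : Subgroup (G r) := analyticSubgroup (subNp r)

/-- For a homomorphism `j : G^k → G^m` (the identity of `G^{n+1}` or the inclusion of `G^n` into
`G^{n+1}`), the space `Ind_{P₀^k}^{G^m}(ξ_μ)` of all `u ∈ C^∞(G^m)` with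
`u(g j(m a ν)) = ξ_μ(a) u(g)` for all `g ∈ G^m` and all `m a ν` in `P₀^k = M₀^k A (N⁺)^k`. Here
`A` consists of the elements `a = exp(tH)`, `t ∈ ℝ`, and `ξ_μ(exp(tH)) = e^{μ t}`. -/
def Ind {k m : ℕ} (j : G k →* G m) (μ : ℂ) : Submodule ℂ (SmoothFn m) where
  carrier := {u | ∀ g : G m, ∀ x ∈ M0 k, ∀ t : ℝ, ∀ ν ∈ Np k,
    u.1 (g * j (x * expG (t • H k) * ν)) = Complex.exp (μ * t) * u.1 g}
  zero_mem' := by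
    intro g x _ t ν _
    change (0 : ℂ) = _ * 0
    rw [mul_zero]
  add_mem' := by
    intro u v hu hv g x hx t ν hν
    change u.1 _ + v.1 _ = _ * (u.1 g + v.1 g)
    rw [hu g x hx t ν hν, hv g x hx t ν hν, mul_add]
  smul_mem' := by
    intro c u hu g x hx t ν hν
    change c * u.1 _ = _ * (c * u.1 g)
    rw [hu g x hx t ν hν, mul_left_comm]

/-- The principal series representation of `G^m` on `Ind_{P₀^k}^{G^m}(ξ_μ)` by left translation. -/
def indRep {k m : ℕ} (j : G k →* G m) (μ : ℂ) : Representation ℂ (G m) (Ind j μ) :=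
  (leftRegular m).subrepresentation (Ind j μ) (by
    intro h u hu g x hx t ν hν
    change u.1 (h⁻¹ * (g * j (x * expG (t • H k) * ν))) = _ * u.1 (h⁻¹ * g)
    rw [← mul_assoc]
    exact hu (h⁻¹ * g) x hx t ν hν)

/-- `E ∈ 𝓤(𝔫⁻_{n+1})` induces a `G^{n+1}`-equivariant map
`Ind_{P₀^{n+1}}^{G^{n+1}}(ξ_μ) → Ind_{P₀^n}^{G^{n+1}}(ξ_ν)` (`n = r + 3`): the differential operator
`R(E)` restricts to a `G^{n+1}`-equivariant linear map between these representations. -/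
def InducesEquivariantMap (r : ℕ) (E : CU (subNm (r + 1))) (μ ν : ℂ) : Prop :=
  ∃ T : (indRep (MonoidHom.id (G (r + 1))) μ).IntertwiningMap (indRep (incl r) ν),
    ∀ u : Ind (MonoidHom.id (G (r + 1))) μ,
      (T u : SmoothFn (r + 1)) = diffOp (r + 1) (mapCU (subNm (r + 1)) E) u

/-! ## The family `𝓓⁰_N(λ)` -/

/-- `Y_j⁻` as an element of `𝓤(𝔫⁻)`. -/
def yCU {r : ℕ} (j : Fin r) : CU (subNm r) :=
  toCU (⟨Ym j, Submodule.subset_span (Or.inl ⟨j, rfl⟩)⟩ : subNm r)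

/-- `Q₁⁻` as an element of `𝓤(𝔫⁻)`. -/
def q1CU (r : ℕ) : CU (subNm r) :=
  toCU (⟨Q1m r, Submodule.subset_span (Or.inr (Or.inl rfl))⟩ : subNm r)

/-- `Q₂⁻` as an element of `𝓤(𝔫⁻)`. -/
def q2CU (r : ℕ) : CU (subNm r) :=
  toCU (⟨Q2m r, Submodule.subset_span (Or.inr (Or.inr rfl))⟩ : subNm r)

/-- `Δ_{n-1} = -(Q₁⁻)² + (Q₂⁻)² + ∑_{j=1}^{n-3} (Y_j⁻)²`, `n = r + 3`, as an element of
`𝓤(𝔫⁻_{n+1})`. Its last root vector `Y_{n-2}⁻` does not occur. -/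
def laplace (r : ℕ) : CU (subNm (r + 1)) :=
  -(q1CU (r + 1)) ^ 2 + (q2CU (r + 1)) ^ 2 + ∑ j : Fin r, (yCU j.castSucc) ^ 2

/-- `T_n = Y_{n-2}⁻ ∈ 𝔫⁻_{n+1}`, `n = r + 3`. -/
def tCU (r : ℕ) : CU (subNm (r + 1)) := yCU (Fin.last r)

/-- `evenAux n K lam k` is the coefficient `a_{K-k}(λ)` of the family of degree `2K`. -/
def evenAux (n K : ℕ) (lam : ℂ) : ℕ → ℂ
  | 0 => 1
  | k + 1 => -(((K : ℂ) - k) * (n - 1 + 2 * lam - 4 * K + 2 * ((K : ℂ) - k)) /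
      (((k : ℂ) + 1) * (2 * k + 1))) * evenAux n K lam k

/-- `oddAux n K lam k` is the coefficient `b_{K-k}(λ)` of the family of degree `2K + 1`. -/
def oddAux (n K : ℕ) (lam : ℂ) : ℕ → ℂ
  | 0 => 1
  | k + 1 => -(((K : ℂ) - k) * (n - 3 + 2 * lam - 4 * K + 2 * ((K : ℂ) - k)) /
      (((k : ℂ) + 1) * (2 * k + 3))) * oddAux n K lam k

/-- The coefficients `a_j(λ)`, `0 ≤ j ≤ K`, of the even family of degree `2K`. -/
def evenCoeff (n K : ℕ) (lam : ℂ) (j : ℕ) : ℂ := evenAux n K lam (K - j)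

/-- The coefficients `b_j(λ)`, `0 ≤ j ≤ K`, of the odd family of degree `2K + 1`. -/
def oddCoeff (n K : ℕ) (lam : ℂ) (j : ℕ) : ℂ := oddAux n K lam (K - j)

/-- The `a_j(λ)` are the unique solution of
`(K-j+1)(2K-2j+1) a_{j-1} + j(n-1+2λ-4K+2j) a_j = 0`, `1 ≤ j ≤ K`, with `a_K = 1`. -/
theorem evenCoeff_unique (n K : ℕ) (lam : ℂ) (a : ℕ → ℂ) :
    (a K = 1 ∧ ∀ j : ℕ, 1 ≤ j → j ≤ K →
      ((K : ℂ) - j + 1) * (2 * K - 2 * j + 1) * a (j - 1) +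
        j * (n - 1 + 2 * lam - 4 * K + 2 * j) * a j = 0) ↔
    ∀ j : ℕ, j ≤ K → a j = evenCoeff n K lam j := by
  have hne : ∀ k : ℕ, (2 * (k : ℂ) + 1) ≠ 0 := fun k => by
    have h : ((2 * k + 1 : ℕ) : ℂ) ≠ 0 := Nat.cast_ne_zero.2 (by omega)
    push_cast at h
    exact h
  have hne' : ∀ k : ℕ, (k : ℂ) + 1 ≠ 0 := fun k => Nat.cast_add_one_ne_zero k
  constructor
  · rintro ⟨h0, h⟩
    have key : ∀ k : ℕ, k ≤ K → a (K - k) = evenAux n K lam k := by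
      intro k
      induction k with
      | zero => intro _; simpa [evenAux] using h0
      | succ k ih =>
        intro hk
        have h1 := h (K - k) (by omega) (by omega)
        rw [ih (by omega), Nat.cast_sub (by omega), show K - k - 1 = K - (k + 1) by omega] at h1
        rw [evenAux, neg_mul, div_mul_eq_mul_div, ← neg_div,
          eq_div_iff (mul_ne_zero (hne' k) (hne k))]
        linear_combination h1
    intro j hj
    rw [evenCoeff, ← key (K - j) (by omega), show K - (K - j) = j by omega]
  · intro h
    refine ⟨by rw [h K le_rfl, evenCoeff, Nat.sub_self, evenAux], ?_⟩
    intro j h1 hj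
    obtain ⟨k, rfl⟩ := Nat.exists_eq_add_of_le hj
    rw [h (j - 1) (by omega), h j hj, evenCoeff, evenCoeff,
      show j + k - (j - 1) = k + 1 by omega, show j + k - j = k by omega, evenAux]
    have key := mul_div_cancel₀ (((j + k : ℂ) - k) *
      (n - 1 + 2 * lam - 4 * (j + k) + 2 * ((j + k : ℂ) - k))) (mul_ne_zero (hne' k) (hne k))
    push_cast
    linear_combination (-(evenAux n (j + k) lam k)) * key

/-- The `b_j(λ)` are the unique solution of
`(K-j+1)(2K-2j+3) b_{j-1} + j(n-3+2λ-4K+2j) b_j = 0`, `1 ≤ j ≤ K`, with `b_K = 1`. -/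
theorem oddCoeff_unique (n K : ℕ) (lam : ℂ) (b : ℕ → ℂ) :
    (b K = 1 ∧ ∀ j : ℕ, 1 ≤ j → j ≤ K →
      ((K : ℂ) - j + 1) * (2 * K - 2 * j + 3) * b (j - 1) +
        j * (n - 3 + 2 * lam - 4 * K + 2 * j) * b j = 0) ↔
    ∀ j : ℕ, j ≤ K → b j = oddCoeff n K lam j := by
  have hne : ∀ k : ℕ, (2 * (k : ℂ) + 3) ≠ 0 := fun k => by
    have h : ((2 * k + 3 : ℕ) : ℂ) ≠ 0 := Nat.cast_ne_zero.2 (by omega)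
    push_cast at h
    exact h
  have hne' : ∀ k : ℕ, (k : ℂ) + 1 ≠ 0 := fun k => Nat.cast_add_one_ne_zero k
  constructor
  · rintro ⟨h0, h⟩
    have key : ∀ k : ℕ, k ≤ K → b (K - k) = oddAux n K lam k := by
      intro k
      induction k with
      | zero => intro _; simpa [oddAux] using h0
      | succ k ih =>
        intro hk
        have h1 := h (K - k) (by omega) (by omega)
        rw [ih (by omega), Nat.cast_sub (by omega), show K - k - 1 = K - (k + 1) by omega] at h1
        rw [oddAux, neg_mul, div_mul_eq_mul_div, ← neg_div,
          eq_div_iff (mul_ne_zero (hne' k) (hne k))]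
        linear_combination h1
    intro j hj
    rw [oddCoeff, ← key (K - j) (by omega), show K - (K - j) = j by omega]
  · intro h
    refine ⟨by rw [h K le_rfl, oddCoeff, Nat.sub_self, oddAux], ?_⟩
    intro j h1 hj
    obtain ⟨k, rfl⟩ := Nat.exists_eq_add_of_le hj
    rw [h (j - 1) (by omega), h j hj, oddCoeff, oddCoeff,
      show j + k - (j - 1) = k + 1 by omega, show j + k - j = k by omega, oddAux]
    have key := mul_div_cancel₀ (((j + k : ℂ) - k) *
      (n - 3 + 2 * lam - 4 * (j + k) + 2 * ((j + k : ℂ) - k))) (mul_ne_zero (hne' k) (hne k))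
    push_cast
    linear_combination (-(oddAux n (j + k) lam k)) * key

/-- The family `𝓓⁰_N(λ) ∈ 𝓤(𝔫⁻_{n+1})`, for `n ≥ 3` (so that `n = r + 3` for `r = n - 3`):
`𝓓⁰_{2K}(λ) = ∑_{j=0}^{K} a_j(λ) Δ_{n-1}^j T_n^{2K-2j}` and
`𝓓⁰_{2K+1}(λ) = ∑_{j=0}^{K} b_j(λ) Δ_{n-1}^j T_n^{2K-2j+1}`. -/
def D0 (n N : ℕ) (lam : ℂ) : CU (subNm (n - 3 + 1)) :=
  if Even N then
    ∑ j ∈ Finset.range (N / 2 + 1),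
      evenCoeff n (N / 2) lam j • (laplace (n - 3) ^ j * tCU (n - 3) ^ (N - 2 * j))
  else
    ∑ j ∈ Finset.range (N / 2 + 1),
      oddCoeff n (N / 2) lam j • (laplace (n - 3) ^ j * tCU (n - 3) ^ (N - 2 * j))

end AdS

end

/-! Membership in an induced space is an infinitesimal condition: the analytic subgroups are
generated by exponentials, so it amounts to `𝔪` and `𝔫⁺` annihilating `u` under `R` and `H` acting
by the character (`mem_Ind_iff_rot`). As `𝔫⁻` is abelian, every element of its enveloping algebra is
a polynomial `p` in the root vectors `x_a` (`polyCU_surjective`). Left-invariant operators commute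
with left translations, so equivariance is automatic and only the mapping property matters.

Let `u` lie in the source space. Moving a vector of `𝔪`, `𝔞` or `𝔫⁺` to the right through `p` until
it meets `u` turns it into a differential operator on `p`: the rotation `ε_b x_a ∂_b - ε_a x_b ∂_a`,
the operator `λ - E` with `E` the Euler operator, and the Bessel operator `2 ε_c (λ - E) ∂_c + x_c
□`. Hence `p` maps into the target space as soon as it is killed by the rotations and Bessel
operators of all variables other than the last one, `T`, and is homogeneous of degree `N`.

These equations are also necessary, because a nonzero polynomial in `𝔫⁻` cannot annihilate the whole
source space at the identity (`eq_zero_of_polyOp_apply_one`). The test functions are `‖g e₊‖^(λ-k)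
l(g e₊)^k`, where `e₊` is the null vector fixed by `M₀` and `N⁺` and scaled by `A`. Along `N⁻` such
a function is `l(y)^k` times a smooth function that does not vanish at the origin, so it detects the
value at `l` of the degree `k` part.

The polynomial system has a one-dimensional solution space for every `λ`. Rotations reduce all
coefficients to those of `x_o^i T^l` with `i` even, and one Bessel equation determines these from
the one with the highest power of `x_o` (`eq_zero_of_bessel`); the factors divided by do not involve
`λ`. Conversely, on `∑ c_j Δ^j T^(N-2j)` all Bessel equations collapse into the single recursion
that defines the coefficients of `𝓓⁰_N(λ)` (`bessel_famPoly`), and the normalisation of the top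
coefficient makes this solution nonzero. -/

noncomputable section

namespace AdS

/-! ### The orthogonal Lie algebra as bivectors. -/

/-- The bilinear form with Gram matrix `gram r`. -/
def form {r : ℕ} (x y : Idx r → ℝ) : ℝ := x ⬝ᵥ (gram r).mulVec y

theorem form_comm {r : ℕ} (x y : Idx r → ℝ) : form x y = form y x := by
  simp only [form, gram, dotProduct, Matrix.mulVec_diagonal]
  exact Finset.sum_congr rfl fun i _ => by ring

/-- The matrix `x (J y)ᵗ - y (J x)ᵗ`. -/
def wedgeMat {r : ℕ} (x y : Idx r → ℝ) : Mat r :=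
  Matrix.vecMulVec x ((gram r).mulVec y) - Matrix.vecMulVec y ((gram r).mulVec x)

theorem wedgeMat_mem {r : ℕ} (x y : Idx r → ℝ) : wedgeMat x y ∈ so2 r := by
  rw [mem_so2]
  ext i j
  simp [wedgeMat, gram, Matrix.mul_diagonal, Matrix.diagonal_mul, Matrix.vecMulVec_apply,
    Matrix.mulVec_diagonal]
  ring

/-- The element `x ∧ y` of the orthogonal Lie algebra. -/
def wedge {r : ℕ} (x y : Idx r → ℝ) : so2 r := ⟨wedgeMat x y, wedgeMat_mem x y⟩

theorem wedgeMat_mulVec {r : ℕ} (x y z : Idx r → ℝ) :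
    (wedgeMat x y).mulVec z = form y z • x - form x z • y := by
  rw [wedgeMat, Matrix.sub_mulVec, Matrix.vecMulVec_mulVec, Matrix.vecMulVec_mulVec,
    form_comm y z, form_comm x z, form, form, dotProduct_comm z, dotProduct_comm z]
  simp

/-- Products of rank-one matrices contract the two inner vectors. The brackets of root vectors used
below are all instances of this identity, which replaces entrywise matrix computations. -/
theorem wedge_lie {r : ℕ} (x y z t : Idx r → ℝ) : ⁅wedge x y, wedge z t⁆ =
    form y z • wedge x t - form y t • wedge x z - form x z • wedge y t + form x t • wedge y z := by
  apply Subtype.ext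
  change wedgeMat x y * wedgeMat z t - wedgeMat z t * wedgeMat x y =
    form y z • wedgeMat x t - form y t • wedgeMat x z - form x z • wedgeMat y t +
      form x t • wedgeMat y z
  have hp : ∀ a b c d : Idx r → ℝ, Matrix.vecMulVec a ((gram r).mulVec b) *
      Matrix.vecMulVec c ((gram r).mulVec d) =
        form b c • Matrix.vecMulVec a ((gram r).mulVec d) := by
    intro a b c d
    rw [Matrix.vecMulVec_mul_vecMulVec, form_comm b c, form, dotProduct_comm c]
    ext i j
    simp [Matrix.vecMulVec_apply]
    ring
  simp only [wedgeMat, Matrix.mul_sub, Matrix.sub_mul, hp, smul_sub]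
  rw [form_comm t x, form_comm t y, form_comm z x, form_comm z y]
  abel

theorem wedge_smul_right {r : ℕ} (c : ℝ) (x y : Idx r → ℝ) : wedge x (c • y) = c • wedge x y := by
  apply Subtype.ext
  change wedgeMat _ _ = c • wedgeMat _ _
  ext i j
  simp [wedgeMat, Matrix.vecMulVec_apply, Matrix.mulVec_smul]
  ring

theorem wedge_add_right {r : ℕ} (x y z : Idx r → ℝ) :
    wedge x (y + z) = wedge x y + wedge x z := by
  apply Subtype.ext
  change wedgeMat _ _ = wedgeMat _ _ + wedgeMat _ _
  ext i j
  simp [wedgeMat, Matrix.vecMulVec_apply, Matrix.mulVec_add]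
  ring

theorem wedge_zero_right {r : ℕ} (x : Idx r → ℝ) : wedge x 0 = 0 := by
  simpa using wedge_smul_right 0 x 0

/-! ### Null vectors, middle coordinates and root vectors. -/

/-- The index type of the coordinates `t₂, x₁ | x₃, …, x_{r+2}` and of the root vectors in
`𝔫^±`. -/
abbrev Mid (r : ℕ) : Type := Fin 2 ⊕ Fin r

/-- The inclusion of `Mid r` into the set of all coordinates. -/
def midIdx {r : ℕ} : Mid r → Idx r := Sum.elim ![Sum.inl 1, Sum.inl 2] Sum.inr

/-- The signs of the middle coordinates. -/
def sgn {r : ℕ} : Mid r → ℝ := Sum.elim ![-1, 1] fun _ => 1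

/-- The basis vectors of the middle coordinates. -/
def midVec {r : ℕ} (a : Mid r) : Idx r → ℝ := Pi.single (midIdx a) 1

/-- The highest weight vector for `𝔞`. -/
def ePlus (r : ℕ) : Idx r → ℝ := Sum.elim ![1, 0, 0, 1] 0

/-- The lowest weight vector for `𝔞`. -/
def eMinus (r : ℕ) : Idx r → ℝ := Sum.elim ![1, 0, 0, -1] 0

theorem sgn_mul_self {r : ℕ} (a : Mid r) : sgn a * sgn a = 1 := by
  rcases a with a | a
  · fin_cases a <;> simp [sgn]
  · simp [sgn]

theorem midIdx_injective {r : ℕ} : Function.Injective (midIdx (r := r)) := by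
  rintro (a | a) (b | b) h
  · fin_cases a <;> fin_cases b <;> simp_all [midIdx]
  · fin_cases a <;> simp [midIdx] at h
  · fin_cases b <;> simp [midIdx] at h
  · simpa [midIdx] using h

theorem form_midVec {r : ℕ} (a b : Mid r) :
    form (midVec a) (midVec b) = if a = b then sgn a else 0 := by
  simp only [form, midVec, single_one_dotProduct, gram, Matrix.mulVec_diagonal,
    Pi.single_apply, midIdx_injective.eq_iff]
  split_ifs
  · rcases a with a | a
    · fin_cases a <;> simp [midIdx, sgn]
    · simp [midIdx, sgn]
  · simp

theorem form_midVec_ePlus {r : ℕ} (a : Mid r) : form (midVec a) (ePlus r) = 0 := by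
  simp only [form, midVec, single_one_dotProduct, gram, Matrix.mulVec_diagonal]
  rcases a with a | a
  · fin_cases a <;> simp [midIdx, ePlus]
  · simp [midIdx, ePlus]

theorem form_midVec_eMinus {r : ℕ} (a : Mid r) : form (midVec a) (eMinus r) = 0 := by
  simp only [form, midVec, single_one_dotProduct, gram, Matrix.mulVec_diagonal]
  rcases a with a | a
  · fin_cases a <;> simp [midIdx, eMinus]
  · simp [midIdx, eMinus]

theorem form_ePlus_ePlus (r : ℕ) : form (ePlus r) (ePlus r) = 0 := by
  simp [form, ePlus, dotProduct, gram, Matrix.mulVec_diagonal, Fin.sum_univ_four]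

theorem form_eMinus_eMinus (r : ℕ) : form (eMinus r) (eMinus r) = 0 := by
  simp [form, eMinus, dotProduct, gram, Matrix.mulVec_diagonal, Fin.sum_univ_four]

theorem form_ePlus_eMinus (r : ℕ) : form (ePlus r) (eMinus r) = -2 := by
  simp [form, eMinus, ePlus, dotProduct, gram, Matrix.mulVec_diagonal, Fin.sum_univ_four]
  norm_num

/-- The root vectors that span `𝔫⁻`. -/
def lower {r : ℕ} (a : Mid r) : so2 r := wedge (eMinus r) (midVec a)

/-- The root vectors that span `𝔫⁺`, up to sign. -/
def upper {r : ℕ} (a : Mid r) : so2 r := wedge (ePlus r) (midVec a)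

/-- The infinitesimal rotations and boosts that span `𝔪`. -/
def rot {r : ℕ} (a b : Mid r) : so2 r := wedge (midVec a) (midVec b)

/-- The two null vectors pair to `-2`, so their wedge multiplies `e₊` by `-2`; the factor restores
the eigenvalue `1`. -/
theorem H_eq (r : ℕ) : H r = -(2⁻¹ : ℝ) • wedge (ePlus r) (eMinus r) := by
  apply Subtype.ext
  change matH r = -(2⁻¹ : ℝ) • wedgeMat (ePlus r) (eMinus r)
  ext (i | i) (j | j)
  · fin_cases i <;> fin_cases j <;>
      norm_num [matH, wedgeMat, Matrix.vecMulVec_apply, ePlus, eMinus, gram,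
        Matrix.mulVec_diagonal]
  all_goals
    simp [matH, wedgeMat, Matrix.vecMulVec_apply, ePlus, eMinus, gram, Matrix.mulVec_diagonal]

theorem lie_H_lower {r : ℕ} (a : Mid r) : ⁅H r, lower a⁆ = -lower a := by
  rw [H_eq, lower, smul_lie, wedge_lie, form_eMinus_eMinus, form_comm (eMinus r),
    form_midVec_eMinus, form_comm _ (midVec a), form_midVec_ePlus, form_ePlus_eMinus]
  module

theorem lie_rot_lower {r : ℕ} (a b c : Mid r) : ⁅rot a b, lower c⁆ =
    (if b = c then sgn b else 0) • lower a - (if a = c then sgn a else 0) • lower b := by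
  have h : ∀ x y : Idx r → ℝ, wedge y x = -wedge x y := by
    intro x y
    apply Subtype.ext
    change wedgeMat _ _ = -wedgeMat _ _
    simp [wedgeMat]
  rw [rot, lower, wedge_lie, form_midVec, form_midVec, form_midVec_eMinus, form_midVec_eMinus,
    h (eMinus r), h (eMinus r), lower, lower]
  module

/-- The bracket falls into `𝔞 ⊕ 𝔪` and not into `𝔫⁻`; this is why `𝔫⁺` acts on polynomials by second
order operators. -/
theorem lie_upper_lower {r : ℕ} (a b : Mid r) : ⁅upper a, lower b⁆ =
    (2 : ℝ) • ((if a = b then sgn a else 0) • H r + rot a b) := by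
  rw [upper, lower, wedge_lie, form_midVec_eMinus, form_midVec, form_ePlus_eMinus,
    form_comm (ePlus r), form_midVec_ePlus, H_eq, rot]
  module

theorem rot_swap {r : ℕ} (a b : Mid r) : rot b a = -rot a b := by
  apply Subtype.ext
  change wedgeMat _ _ = -wedgeMat _ _
  simp [wedgeMat]

theorem Ym_eq {r : ℕ} (j : Fin r) : Ym j = lower (Sum.inr j) := by
  apply Subtype.ext
  change (matY j).transpose = wedgeMat _ _
  ext (i | i) (k | k)
  · fin_cases i <;> fin_cases k <;> simp [matY, wedgeMat, Matrix.vecMulVec_apply, eMinus, gram,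
      Matrix.mulVec_diagonal, midVec, midIdx]
  · fin_cases i <;> simp [matY, wedgeMat, Matrix.vecMulVec_apply, eMinus, gram,
      Matrix.mulVec_diagonal, midVec, midIdx, Pi.single_apply]
  · fin_cases k <;> simp [matY, wedgeMat, Matrix.vecMulVec_apply, eMinus, gram,
      Matrix.mulVec_diagonal, midVec, midIdx, Pi.single_apply]
  · simp [matY, wedgeMat, Matrix.vecMulVec_apply, eMinus, gram, Matrix.mulVec_diagonal]

theorem Yp_eq {r : ℕ} (j : Fin r) : Yp j = upper (Sum.inr j) := by
  apply Subtype.ext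
  change matY j = wedgeMat _ _
  ext (i | i) (k | k)
  · fin_cases i <;> fin_cases k <;> simp [matY, wedgeMat, Matrix.vecMulVec_apply, ePlus, gram,
      Matrix.mulVec_diagonal, midVec, midIdx]
  · fin_cases i <;> simp [matY, wedgeMat, Matrix.vecMulVec_apply, ePlus, gram,
      Matrix.mulVec_diagonal, midVec, midIdx, Pi.single_apply]
  · fin_cases k <;> simp [matY, wedgeMat, Matrix.vecMulVec_apply, ePlus, gram,
      Matrix.mulVec_diagonal, midVec, midIdx, Pi.single_apply] <;> split_ifs <;> simp
  · simp [matY, wedgeMat, Matrix.vecMulVec_apply, ePlus, gram, Matrix.mulVec_diagonal]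

theorem Q1m_eq (r : ℕ) : Q1m r = lower (Sum.inl 0) := by
  apply Subtype.ext
  change matQ1 r = wedgeMat _ _
  ext (i | i) (k | k)
  · fin_cases i <;> fin_cases k <;> simp [matQ1, wedgeMat, Matrix.vecMulVec_apply, eMinus, gram,
      Matrix.mulVec_diagonal, midVec, midIdx]
  all_goals
    simp [matQ1, wedgeMat, Matrix.vecMulVec_apply, eMinus, gram, Matrix.mulVec_diagonal, midVec,
      midIdx]

theorem Q2m_eq (r : ℕ) : Q2m r = lower (Sum.inl 1) := by
  apply Subtype.ext
  change matQ2 r = wedgeMat _ _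
  ext (i | i) (k | k)
  · fin_cases i <;> fin_cases k <;> simp [matQ2, wedgeMat, Matrix.vecMulVec_apply, eMinus, gram,
      Matrix.mulVec_diagonal, midVec, midIdx]
  all_goals
    simp [matQ2, wedgeMat, Matrix.vecMulVec_apply, eMinus, gram, Matrix.mulVec_diagonal, midVec,
      midIdx]

/-- Transposing `lower a` gives `sgn a` times `upper a`, and the index here is the only timelike
one. -/
theorem Q1p_eq (r : ℕ) : Q1p r = -upper (Sum.inl 0) := by
  apply Subtype.ext
  change (matQ1 r).transpose = -wedgeMat _ _
  ext (i | i) (k | k)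
  · fin_cases i <;> fin_cases k <;> simp [matQ1, wedgeMat, Matrix.vecMulVec_apply, ePlus, gram,
      Matrix.mulVec_diagonal, midVec, midIdx]
  all_goals
    simp [matQ1, wedgeMat, Matrix.vecMulVec_apply, ePlus, gram, Matrix.mulVec_diagonal, midVec,
      midIdx]

theorem Q2p_eq (r : ℕ) : Q2p r = upper (Sum.inl 1) := by
  apply Subtype.ext
  change (matQ2 r).transpose = wedgeMat _ _
  ext (i | i) (k | k)
  · fin_cases i <;> fin_cases k <;> simp [matQ2, wedgeMat, Matrix.vecMulVec_apply, ePlus, gram,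
      Matrix.mulVec_diagonal, midVec, midIdx]
  all_goals
    simp [matQ2, wedgeMat, Matrix.vecMulVec_apply, ePlus, gram, Matrix.mulVec_diagonal, midVec,
      midIdx]

theorem M_eq {r : ℕ} (i j : Fin r) : M i j = rot (Sum.inr i) (Sum.inr j) := by
  apply Subtype.ext
  change matM i j = wedgeMat _ _
  ext (k | k) (l | l) <;>
    simp [matM, wedgeMat, Matrix.vecMulVec_apply, gram, midVec, midIdx,
      Pi.single_apply, Matrix.single_apply]
  grind

theorem H2_eq (r : ℕ) : H2 r = rot (Sum.inl 0) (Sum.inl 1) := by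
  apply Subtype.ext
  change matH2 r = wedgeMat _ _
  ext (i | i) (k | k)
  · fin_cases i <;> fin_cases k <;> simp [matH2, wedgeMat, Matrix.vecMulVec_apply, gram,
      midVec, midIdx]
  all_goals
    simp [matH2, wedgeMat, Matrix.vecMulVec_apply, gram, midVec, midIdx]

theorem Zp_eq {r : ℕ} (j : Fin r) :
    Zp j = rot (Sum.inl 0) (Sum.inr j) + rot (Sum.inl 1) (Sum.inr j) := by
  apply Subtype.ext
  change matZ j = wedgeMat _ _ + wedgeMat _ _
  ext (i | i) (k | k)
  · fin_cases i <;> fin_cases k <;> simp [matZ, wedgeMat, Matrix.vecMulVec_apply, gram,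
      midVec, midIdx]
  · fin_cases i <;> simp [matZ, wedgeMat, Matrix.vecMulVec_apply, gram,
      midVec, midIdx, Pi.single_apply]
  · fin_cases k <;> simp [matZ, wedgeMat, Matrix.vecMulVec_apply, gram,
      midVec, midIdx, Pi.single_apply] <;> split_ifs <;> simp
  · simp [matZ, wedgeMat, Matrix.vecMulVec_apply, gram, midVec, midIdx]

theorem Zm_eq {r : ℕ} (j : Fin r) :
    Zm j = rot (Sum.inl 0) (Sum.inr j) - rot (Sum.inl 1) (Sum.inr j) := by
  apply Subtype.ext
  change (matZ j).transpose = wedgeMat _ _ - wedgeMat _ _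
  ext (i | i) (k | k)
  · fin_cases i <;> fin_cases k <;> simp [matZ, wedgeMat, Matrix.vecMulVec_apply, gram,
      midVec, midIdx]
  · fin_cases i <;> simp [matZ, wedgeMat, Matrix.vecMulVec_apply, gram,
      midVec, midIdx, Pi.single_apply] <;> split_ifs <;> simp
  · fin_cases k <;> simp [matZ, wedgeMat, Matrix.vecMulVec_apply, gram,
      midVec, midIdx, Pi.single_apply]
  · simp [matZ, wedgeMat, Matrix.vecMulVec_apply, gram, midVec, midIdx]

/-! ### Induced spaces in terms of left-invariant vector fields. -/

theorem expG_zero (r : ℕ) : expG (0 : so2 r) = 1 := by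
  apply Subtype.ext
  apply Units.ext
  change NormedSpace.exp (0 : Mat r) = 1
  simp

theorem expG_add_of_commute {r : ℕ} (X Y : so2 r) (h : Commute (X : Mat r) (Y : Mat r)) :
    expG (X + Y) = expG X * expG Y := by
  apply Subtype.ext
  apply Units.ext
  exact Matrix.exp_add_of_commute _ _ h

theorem expG_add_smul {r : ℕ} (X : so2 r) (s t : ℝ) :
    expG ((s + t) • X) = expG (s • X) * expG (t • X) := by
  rw [add_smul]
  exact expG_add_of_commute _ _ (((Commute.refl (X : Mat r)).smul_left s).smul_right t)

theorem hasDerivAt_rightDeriv {r : ℕ} (X : so2 r) (u : SmoothFn r) (g : G r) (s : ℝ) :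
    HasDerivAt (fun t : ℝ => u.1 (g * expG (t • X))) (rightDeriv X u.1 (g * expG (s • X))) s := by
  obtain ⟨U, F, hg, e⟩ := u.2 (g * expG (s • X))
  have h := e.hasDerivAt X _ hg
  rw [← e.rightDeriv_eq X _ hg] at h
  have h' : HasDerivAt (fun t : ℝ => u.1 (g * expG (s • X) * expG (t • X)))
      (rightDeriv X u.1 (g * expG (s • X))) (s - s) := by rwa [sub_self]
  have h2 := HasDerivAt.comp_sub_const s s h'
  refine h2.congr_of_eventuallyEq (Filter.Eventually.of_forall fun t => ?_)
  simp only
  rw [mul_assoc, ← expG_add_smul, add_sub_cancel]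

/-- The function `t ↦ e^(-μt) u(g exp(tX))` has zero derivative everywhere, hence is constant. -/
theorem eq_exp_mul_of_derivOp_eq {r : ℕ} {X : so2 r} {u : SmoothFn r} {μ : ℂ}
    (h : derivOp X u = μ • u) (g : G r) (t : ℝ) :
    u.1 (g * expG (t • X)) = Complex.exp (μ * t) * u.1 g := by
  have hX : ∀ x, rightDeriv X u.1 x = μ * u.1 x := fun x =>
    congrFun (congrArg Subtype.val h) x
  have hE : ∀ s : ℝ, HasDerivAt (fun t : ℝ => Complex.exp (-(μ * t)))
      (Complex.exp (-(μ * s)) * -(μ * 1)) s := by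
    intro s
    exact ((Complex.ofRealCLM.hasDerivAt (x := s)).const_mul μ).neg.cexp
  have hd : ∀ s : ℝ, HasDerivAt
      (fun t : ℝ => Complex.exp (-(μ * t)) * u.1 (g * expG (t • X))) 0 s := by
    intro s
    have := (hE s).mul (hasDerivAt_rightDeriv X u g s)
    rw [hX] at this
    convert! this using 1
    ring
  have hc := is_const_of_deriv_eq_zero (fun s => (hd s).differentiableAt)
    (fun s => (hd s).deriv) t 0
  simp only [zero_smul, expG_zero, mul_one, Complex.ofReal_zero, mul_zero, neg_zero,
    Complex.exp_zero, one_mul] at hc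
  rw [← hc, ← mul_assoc, ← Complex.exp_add, add_neg_cancel, Complex.exp_zero, one_mul]

theorem derivOp_eq_of_eq_exp_mul {r : ℕ} {X : so2 r} {u : SmoothFn r} {μ : ℂ}
    (h : ∀ (g : G r) (t : ℝ), u.1 (g * expG (t • X)) = Complex.exp (μ * t) * u.1 g) :
    derivOp X u = μ • u := by
  apply Subtype.ext
  funext g
  change deriv (fun t : ℝ => u.1 (g * expG (t • X))) 0 = μ * u.1 g
  simp only [h]
  have := ((Complex.ofRealCLM.hasDerivAt (x := 0)).const_mul μ).cexp.mul_const (u.1 g)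
  simpa using this.deriv

theorem derivOp_eq_zero_of_mem_span {k m : ℕ} (dj : so2 k →ₗ[ℝ] so2 m) {S : Set (so2 k)}
    {u : SmoothFn m} (h : ∀ X ∈ S, derivOp (dj X) u = 0) {X : so2 k}
    (hX : X ∈ Submodule.span ℝ S) : derivOp (dj X) u = 0 := by
  change derivHom m (dj X) u = 0
  induction hX using Submodule.span_induction with
  | mem X hX => exact h X hX
  | zero => rw [map_zero, map_zero, LinearMap.zero_apply]
  | add X Y _ _ hX hY => rw [map_add, map_add, LinearMap.add_apply, hX, hY, add_zero]
  | smul c X _ hX => rw [map_smul, map_smul, LinearMap.smul_apply, hX, smul_zero]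

/-- The subgroup is generated by exponentials, so it suffices to treat each of them. Here `dj` is
the differential of `j`; keeping it general covers both the identity and the inclusion. -/
theorem invariant_of_mem_analyticSubgroup {k m : ℕ} {j : G k →* G m} {dj : so2 k →ₗ[ℝ] so2 m}
    (hj : ∀ X, j (expG X) = expG (dj X)) {h : LieSubalgebra ℝ (so2 k)} {u : SmoothFn m}
    (hu : ∀ X ∈ h, derivOp (dj X) u = 0) {x : G k} (hx : x ∈ analyticSubgroup h) (g : G m) :
    u.1 (g * j x) = u.1 g := by
  induction hx using Subgroup.closure_induction generalizing g with
  | mem x hx =>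
    obtain ⟨X, hX, rfl⟩ := hx
    have := eq_exp_mul_of_derivOp_eq (μ := 0) (by rw [zero_smul]; exact hu X hX) g 1
    rwa [zero_mul, Complex.exp_zero, one_mul, one_smul, ← hj] at this
  | one => rw [map_one, mul_one]
  | mul x y _ _ hx hy => rw [map_mul, ← mul_assoc, hy, hx]
  | inv x _ hx =>
    rw [← hx (g * j x⁻¹), mul_assoc, ← map_mul, inv_mul_cancel, map_one, mul_one]

/-- The induced representation space in terms of left-invariant vector fields. -/
theorem mem_Ind_iff {k m : ℕ} {j : G k →* G m} {dj : so2 k →ₗ[ℝ] so2 m}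
    (hj : ∀ X, j (expG X) = expG (dj X)) (μ : ℂ) (u : SmoothFn m) :
    u ∈ Ind j μ ↔ (∀ X ∈ genM k, derivOp (dj X) u = 0) ∧
      (∀ X ∈ genNp k, derivOp (dj X) u = 0) ∧ derivOp (dj (H k)) u = μ • u := by
  have e0 : expG ((0 : ℝ) • H k) = 1 := by rw [zero_smul, expG_zero]
  constructor
  · intro hu
    refine ⟨fun X hX => ?_, fun X hX => ?_, ?_⟩
    · rw [← zero_smul ℂ u]
      refine derivOp_eq_of_eq_exp_mul fun g t => ?_
      have := hu g (expG (t • X)) (Subgroup.subset_closure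
        ⟨_, Submodule.smul_mem _ t (Submodule.subset_span hX), rfl⟩) 0 1 (one_mem _)
      rw [e0, mul_one, mul_one, hj, map_smul] at this
      simpa using this
    · rw [← zero_smul ℂ u]
      refine derivOp_eq_of_eq_exp_mul fun g t => ?_
      have := hu g 1 (one_mem _) 0 (expG (t • X)) (Subgroup.subset_closure
        ⟨_, Submodule.smul_mem _ t (Submodule.subset_span hX), rfl⟩)
      rw [e0, mul_one, one_mul, hj, map_smul] at this
      simpa using this
    · refine derivOp_eq_of_eq_exp_mul fun g t => ?_
      have := hu g 1 (one_mem _) t 1 (one_mem _)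
      rwa [one_mul, mul_one, hj, map_smul] at this
  · rintro ⟨hM, hN, hH⟩ g x hx t ν hν
    -- The factors of `m a ν` are removed from the right: `ν` and `m` change nothing, `a`
    -- contributes the exponential.
    rw [map_mul, map_mul, ← mul_assoc, ← mul_assoc,
      invariant_of_mem_analyticSubgroup hj (fun X => derivOp_eq_zero_of_mem_span dj hN) hν, hj,
      map_smul, eq_exp_mul_of_derivOp_eq hH,
      invariant_of_mem_analyticSubgroup hj (fun X => derivOp_eq_zero_of_mem_span dj hM) hx]

/-! ### The embedding of the smaller Lie algebra. -/

/-- `A ↦ diag(A, 0)`. -/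
def inclMatLin (r : ℕ) : Mat r →ₗ[ℝ] Mat (r + 1) where
  toFun A := Matrix.reindex (idxEquiv r) (idxEquiv r) (Matrix.fromBlocks A 0 0 0)
  map_add' A B := by
    ext i j
    simp only [Matrix.reindex_apply, Matrix.submatrix_apply, Matrix.add_apply]
    rcases (idxEquiv r).symm i with i | i <;> rcases (idxEquiv r).symm j with j | j <;> simp
  map_smul' c A := by
    ext i j
    simp only [Matrix.reindex_apply, Matrix.submatrix_apply, Matrix.smul_apply]
    rcases (idxEquiv r).symm i with i | i <;> rcases (idxEquiv r).symm j with j | j <;> simp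

/-- `(A, c) ↦ diag(A, c)`. -/
def blockDiagHom (r : ℕ) : Mat r × ℝ →+* Mat (r + 1) where
  toFun p := Matrix.reindex (idxEquiv r) (idxEquiv r)
    (Matrix.fromBlocks p.1 0 0 (p.2 • (1 : Matrix (Fin 1) (Fin 1) ℝ)))
  map_one' := by simp [Matrix.fromBlocks_one]
  map_mul' p q := by
    simp only [Matrix.reindex_apply, Matrix.submatrix_mul_equiv, Matrix.fromBlocks_multiply]
    simp only [add_zero, zero_add, smul_mul_assoc, one_mul, smul_smul,
      Matrix.mul_zero, Matrix.zero_mul, Prod.fst_mul, Prod.snd_mul]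
  map_zero' := by simp
  map_add' p q := by
    ext i j
    simp only [Matrix.reindex_apply, Matrix.submatrix_apply, Matrix.add_apply]
    rcases (idxEquiv r).symm i with i | i <;> rcases (idxEquiv r).symm j with j | j <;>
      simp [add_smul]

/-- The map `A ↦ diag(A, 0)` is not unital, so it does not commute with `exp`. The ring homomorphism
`(A, c) ↦ diag(A, c)` does, and `exp (A, 0) = (exp A, 1)` produces the corner entry `1`. -/
theorem exp_inclMatLin (r : ℕ) (A : Mat r) :
    NormedSpace.exp (inclMatLin r A) = inclMat r (NormedSpace.exp A) := by
  let _ : NormedRing (Mat r) := Matrix.linftyOpNormedRing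
  let _ : NormedAlgebra ℝ (Mat r) := Matrix.linftyOpNormedAlgebra
  let _ : NormedRing (Mat (r + 1)) := Matrix.linftyOpNormedRing
  let _ : NormedAlgebra ℝ (Mat (r + 1)) := Matrix.linftyOpNormedAlgebra
  let _ : NormedAlgebra ℚ (Mat r) := NormedAlgebra.restrictScalars ℚ ℝ _
  let _ : NormedAlgebra ℚ (Mat (r + 1)) := NormedAlgebra.restrictScalars ℚ ℝ _
  have hc : Continuous (blockDiagHom r) := by
    change Continuous fun p : Mat r × ℝ => Matrix.reindex (idxEquiv r) (idxEquiv r)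
      (Matrix.fromBlocks p.1 0 0 (p.2 • (1 : Matrix (Fin 1) (Fin 1) ℝ)))
    exact (Continuous.matrix_fromBlocks continuous_fst continuous_const continuous_const
      (continuous_snd.smul continuous_const)).matrix_reindex _ _
  have h := NormedSpace.map_exp (blockDiagHom r) hc (A, 0)
  have h1 : blockDiagHom r (A, 0) = inclMatLin r A := by
    simp [blockDiagHom, inclMatLin]
  rw [h1] at h
  refine h.symm.trans ((congrArg (blockDiagHom r) (Prod.ext (y := (NormedSpace.exp A, (1 : ℝ)))
    (Prod.fst_exp _)
    ((Prod.snd_exp (A, (0 : ℝ))).trans (NormedSpace.exp_zero (𝔸 := ℝ))))).trans ?_)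
  simp [blockDiagHom, inclMat]

theorem inclMatLin_mul_inclMat (r : ℕ) (A B : Mat r) :
    inclMatLin r A * inclMat r B = inclMatLin r (A * B) ∧
      inclMat r B * inclMatLin r A = inclMatLin r (B * A) := by
  constructor <;>
  · change Matrix.reindex _ _ _ * Matrix.reindex _ _ _ = Matrix.reindex _ _ _
    simp only [Matrix.reindex_apply, Matrix.submatrix_mul_equiv, Matrix.fromBlocks_multiply]
    simp

/-- The inclusion of Lie algebras `X ↦ diag(X, 0)`. -/
def inclLie (r : ℕ) : so2 r →ₗ[ℝ] so2 (r + 1) where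
  toFun X := ⟨inclMatLin r X, by
    have h := (mem_so2 (X : Mat r)).1 X.2
    have ht : (inclMatLin r (X : Mat r)).transpose = inclMatLin r (X : Mat r).transpose := by
      simp [inclMatLin, Matrix.reindex_apply, Matrix.fromBlocks_transpose]
    rw [mem_so2, ht, ← inclMat_gram, (inclMatLin_mul_inclMat r _ _).1,
      (inclMatLin_mul_inclMat r _ _).2, h, map_neg]⟩
  map_add' X Y := Subtype.ext (map_add (inclMatLin r) (X : Mat r) Y)
  map_smul' c X := Subtype.ext (map_smul (inclMatLin r) c (X : Mat r))

theorem incl_expG (r : ℕ) (X : so2 r) : incl r (expG X) = expG (inclLie r X) := by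
  apply Subtype.ext
  apply Units.ext
  exact (exp_inclMatLin r X).symm

/-- The inclusion of the index sets of the middle coordinates. -/
def midCast {r : ℕ} : Mid r → Mid (r + 1) := Sum.map id Fin.castSucc

/-- Extension of vectors by zero. -/
def extVec {r : ℕ} (x : Idx r → ℝ) : Idx (r + 1) → ℝ := fun i =>
  Sum.elim x 0 ((idxEquiv r).symm i)

theorem inclLie_wedge {r : ℕ} (x y : Idx r → ℝ) :
    inclLie r (wedge x y) = wedge (extVec x) (extVec y) := by
  apply Subtype.ext
  change inclMatLin r (wedgeMat x y) = wedgeMat (extVec x) (extVec y)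
  have hg : ∀ z : Idx r → ℝ, (gram (r + 1)).mulVec (extVec z) = extVec ((gram r).mulVec z) := by
    intro z
    funext i
    simp only [gram, Matrix.mulVec_diagonal, extVec]
    obtain ⟨i, rfl⟩ := (idxEquiv r).surjective i
    rw [Equiv.symm_apply_apply]
    rcases i with (i | i) | i <;> simp [Matrix.mulVec_diagonal, idxEquiv]
  conv_rhs => rw [wedgeMat, hg, hg]
  ext i j
  obtain ⟨i, rfl⟩ := (idxEquiv r).surjective i
  obtain ⟨j, rfl⟩ := (idxEquiv r).surjective j
  rcases i with i | i <;> rcases j with j | j <;>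
    simp [inclMatLin, extVec, Matrix.vecMulVec_apply, wedgeMat]

theorem extVec_apply {r : ℕ} (x : Idx r → ℝ) (y : Idx (r + 1) → ℝ)
    (h0 : ∀ i, y (Sum.inl i) = x (Sum.inl i))
    (h1 : ∀ i, y (Sum.inr (Fin.castSucc i)) = x (Sum.inr i))
    (h2 : y (Sum.inr (Fin.last r)) = 0) : extVec x = y := by
  funext i
  obtain ⟨i, rfl⟩ := (idxEquiv r).surjective i
  rw [extVec, Equiv.symm_apply_apply]
  rcases i with (i | i) | i
  · exact (h0 i).symm
  · exact (h1 i).symm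
  · have : i = 0 := Subsingleton.elim _ _
    subst this
    exact h2.symm

theorem extVec_ePlus (r : ℕ) : extVec (ePlus r) = ePlus (r + 1) :=
  extVec_apply _ _ (fun _ => rfl) (fun _ => rfl) rfl

theorem extVec_eMinus (r : ℕ) : extVec (eMinus r) = eMinus (r + 1) :=
  extVec_apply _ _ (fun _ => rfl) (fun _ => rfl) rfl

theorem extVec_midVec {r : ℕ} (a : Mid r) : extVec (midVec a) = midVec (midCast a) := by
  rcases a with a | a
  · refine extVec_apply _ _ (fun i => ?_) (fun i => ?_) ?_ <;> fin_cases a <;>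
      simp [midVec, midIdx, midCast, Pi.single_apply]
  · refine extVec_apply _ _ (fun i => ?_) (fun i => ?_) ?_ <;>
      simp [midVec, midIdx, midCast, Pi.single_apply, (Fin.castSucc_lt_last _).ne']

theorem inclLie_H (r : ℕ) : inclLie r (H r) = H (r + 1) := by
  rw [H_eq, map_smul, inclLie_wedge, extVec_ePlus, extVec_eMinus, ← H_eq]

theorem inclLie_upper {r : ℕ} (a : Mid r) : inclLie r (upper a) = upper (midCast a) := by
  rw [upper, inclLie_wedge, extVec_ePlus, extVec_midVec, upper]

theorem inclLie_rot {r : ℕ} (a b : Mid r) :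
    inclLie r (rot a b) = rot (midCast a) (midCast b) := by
  rw [rot, inclLie_wedge, extVec_midVec, extVec_midVec, rot]

/-! ### Uniform spanning sets for `𝔪` and `𝔫⁺`. -/

theorem rot_mem_span {r : ℕ} (a b : Mid r) : rot a b ∈ Submodule.span ℝ (genM r) := by
  have h0 : ∀ a : Mid r, rot a a = 0 := fun a => by
    have h := rot_swap a a
    have h2 : (2 : ℝ) • rot a a = 0 := by
      rw [two_smul]
      nth_rewrite 1 [h]
      exact neg_add_cancel _
    exact (smul_eq_zero.1 h2).resolve_left two_ne_zero
  have hH : rot (Sum.inl 0) (Sum.inl 1) ∈ Submodule.span ℝ (genM r) := by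
    rw [← H2_eq]
    exact Submodule.subset_span (Or.inr rfl)
  have hp : ∀ j : Fin r, Zp j ∈ Submodule.span ℝ (genM r) := fun j =>
    Submodule.subset_span (Or.inl (Or.inl (Or.inr ⟨j, rfl⟩)))
  have hm : ∀ j : Fin r, Zm j ∈ Submodule.span ℝ (genM r) := fun j =>
    Submodule.subset_span (Or.inl (Or.inr ⟨j, rfl⟩))
  have hi : ∀ (i : Fin 2) (j : Fin r),
      rot (Sum.inl i) (Sum.inr j) ∈ Submodule.span ℝ (genM r) := by
    intro i j
    fin_cases i
    · have : rot (Sum.inl 0) (Sum.inr j) = (2⁻¹ : ℝ) • (Zp j + Zm j) := by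
        rw [Zp_eq, Zm_eq]; module
      exact this ▸ Submodule.smul_mem _ _ (add_mem (hp j) (hm j))
    · have : rot (Sum.inl 1) (Sum.inr j) = (2⁻¹ : ℝ) • (Zp j - Zm j) := by
        rw [Zp_eq, Zm_eq]; module
      exact this ▸ Submodule.smul_mem _ _ (sub_mem (hp j) (hm j))
  rcases a with a | a <;> rcases b with b | b
  · fin_cases a <;> fin_cases b
    · exact h0 (Sum.inl 0) ▸ zero_mem _
    · exact hH
    · exact rot_swap (r := r) (Sum.inl 0) (Sum.inl 1) ▸ neg_mem hH
    · exact h0 (Sum.inl 1) ▸ zero_mem _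
  · exact hi a b
  · exact rot_swap (r := r) (Sum.inl b) (Sum.inr a) ▸ neg_mem (hi b a)
  · rw [← M_eq]
    exact Submodule.subset_span (Or.inl (Or.inl (Or.inl ⟨(a, b), rfl⟩)))

theorem upper_mem_span {r : ℕ} (a : Mid r) : upper a ∈ Submodule.span ℝ (genNp r) := by
  rcases a with a | a
  · fin_cases a
    · have : upper (Sum.inl 0) = -Q1p r := by rw [Q1p_eq, neg_neg]
      exact this ▸ neg_mem (Submodule.subset_span (Or.inr (Or.inl rfl)))
    · exact Q2p_eq r ▸ Submodule.subset_span (Or.inr (Or.inr rfl))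
  · exact Yp_eq a ▸ Submodule.subset_span (Or.inl ⟨a, rfl⟩)

/-- The induced representation space in terms of the vectors `rot a b`, `upper a` and `H`. -/
theorem mem_Ind_iff_rot {k m : ℕ} {j : G k →* G m} {dj : so2 k →ₗ[ℝ] so2 m}
    (hj : ∀ X, j (expG X) = expG (dj X)) (μ : ℂ) (u : SmoothFn m) :
    u ∈ Ind j μ ↔ (∀ a b, derivOp (dj (rot a b)) u = 0) ∧
      (∀ a, derivOp (dj (upper a)) u = 0) ∧ derivOp (dj (H k)) u = μ • u := by
  rw [mem_Ind_iff hj]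
  refine and_congr ⟨fun h a b => derivOp_eq_zero_of_mem_span dj h (rot_mem_span a b),
    fun h X hX => ?_⟩
    (and_congr ⟨fun h a => derivOp_eq_zero_of_mem_span dj h (upper_mem_span a), fun h X hX => ?_⟩ Iff.rfl)
  · have hadd : ∀ X Y : so2 k, derivOp (dj (X + Y)) u = derivOp (dj X) u + derivOp (dj Y) u :=
      fun X Y => by
        rw [map_add]
        exact LinearMap.congr_fun (map_add (derivHom m) (dj X) (dj Y)) u
    have hsub : ∀ X Y : so2 k, derivOp (dj (X - Y)) u = derivOp (dj X) u - derivOp (dj Y) u :=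
      fun X Y => by
        rw [map_sub]
        exact LinearMap.congr_fun (map_sub (derivHom m) (dj X) (dj Y)) u
    rcases hX with ((⟨⟨i, j⟩, rfl⟩ | ⟨i, rfl⟩) | ⟨i, rfl⟩) | rfl
    · change derivOp (dj (M i j)) u = 0
      rw [M_eq, h]
    · rw [Zp_eq, hadd, h, h, add_zero]
    · rw [Zm_eq, hsub, h, h, sub_zero]
    · rw [H2_eq, h]
  · rcases hX with ⟨i, rfl⟩ | rfl | rfl
    · rw [Yp_eq, h]
    · rw [Q1p_eq, map_neg]
      refine (LinearMap.congr_fun (map_neg (derivHom m) (dj (upper (Sum.inl 0)))) u).trans ?_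
      exact neg_eq_zero.2 (h _)
    · rw [Q2p_eq, h]

/-! ### Rotation, Euler, wave and Bessel operators on polynomials. -/

open MvPolynomial in
/-- The infinitesimal rotation `ε_b x_a ∂_b - ε_a x_b ∂_a`. -/
def rotOp {σ : Type*} (ε : σ → ℂ) (a b : σ) (p : MvPolynomial σ ℂ) : MvPolynomial σ ℂ :=
  C (ε b) * (X a * pderiv b p) - C (ε a) * (X b * pderiv a p)

open MvPolynomial in
/-- The Euler operator. -/
def euler {σ : Type*} [Fintype σ] (p : MvPolynomial σ ℂ) : MvPolynomial σ ℂ :=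
  ∑ a, X a * pderiv a p

open MvPolynomial in
/-- The wave operator `∑ ε_a ∂_a²`. -/
def box {σ : Type*} [Fintype σ] (ε : σ → ℂ) (p : MvPolynomial σ ℂ) : MvPolynomial σ ℂ :=
  ∑ a, C (ε a) * pderiv a (pderiv a p)

open MvPolynomial in
/-- The Bessel operator `2 ε_c (lam - E) ∂_c + x_c □`. -/
def bessel {σ : Type*} [Fintype σ] (ε : σ → ℂ) (lam : ℂ) (c : σ) (p : MvPolynomial σ ℂ) :
    MvPolynomial σ ℂ :=
  C (2 * ε c) * (C lam * pderiv c p - euler (pderiv c p)) + X c * box ε p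

section Operators

open MvPolynomial

variable {σ : Type*}

theorem rotOp_add (ε : σ → ℂ) (a b : σ) (p q : MvPolynomial σ ℂ) :
    rotOp ε a b (p + q) = rotOp ε a b p + rotOp ε a b q := by
  simp only [rotOp, map_add]
  ring

theorem rotOp_C_mul (ε : σ → ℂ) (a b : σ) (c : ℂ) (p : MvPolynomial σ ℂ) :
    rotOp ε a b (C c * p) = C c * rotOp ε a b p := by
  simp only [rotOp, pderiv_C_mul]
  ring

theorem rotOp_mul (ε : σ → ℂ) (a b : σ) (p q : MvPolynomial σ ℂ) :
    rotOp ε a b (p * q) = rotOp ε a b p * q + p * rotOp ε a b q := by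
  simp only [rotOp, pderiv_mul]
  ring

theorem rotOp_X [DecidableEq σ] (ε : σ → ℂ) (a b c : σ) :
    rotOp ε a b (X c) = (if b = c then C (ε b) else 0) * X a -
      (if a = c then C (ε a) else 0) * X b := by
  simp only [rotOp, pderiv_X, Pi.single_apply, @eq_comm _ c]
  split_ifs <;> ring

variable [Fintype σ]

theorem euler_add (p q : MvPolynomial σ ℂ) : euler (p + q) = euler p + euler q := by
  simp only [euler, map_add, mul_add, Finset.sum_add_distrib]

theorem euler_C_mul (c : ℂ) (p : MvPolynomial σ ℂ) : euler (C c * p) = C c * euler p := by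
  simp only [euler, pderiv_C_mul, Finset.mul_sum]
  exact Finset.sum_congr rfl fun _ _ => by ring

theorem euler_mul (p q : MvPolynomial σ ℂ) : euler (p * q) = euler p * q + p * euler q := by
  simp only [euler, pderiv_mul, Finset.mul_sum, Finset.sum_mul, ← Finset.sum_add_distrib]
  exact Finset.sum_congr rfl fun _ _ => by ring

theorem euler_X (c : σ) : euler (X c : MvPolynomial σ ℂ) = X c := by
  classical
  simp [euler, pderiv_X, Pi.single_apply]

theorem box_add (ε : σ → ℂ) (p q : MvPolynomial σ ℂ) :
    box ε (p + q) = box ε p + box ε q := by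
  simp only [box, map_add, mul_add, Finset.sum_add_distrib]

theorem box_C_mul (ε : σ → ℂ) (c : ℂ) (p : MvPolynomial σ ℂ) :
    box ε (C c * p) = C c * box ε p := by
  simp only [box, pderiv_C_mul, Finset.mul_sum]
  exact Finset.sum_congr rfl fun _ _ => by ring

theorem box_mul (ε : σ → ℂ) (p q : MvPolynomial σ ℂ) :
    box ε (p * q) = box ε p * q + p * box ε q +
      2 * ∑ a, C (ε a) * (pderiv a p * pderiv a q) := by
  simp only [box, pderiv_mul, map_add, Finset.mul_sum, Finset.sum_mul, ← Finset.sum_add_distrib]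
  exact Finset.sum_congr rfl fun _ _ => by ring

theorem box_X_mul (ε : σ → ℂ) (c : σ) (p : MvPolynomial σ ℂ) :
    box ε (X c * p) = X c * box ε p + 2 * C (ε c) * pderiv c p := by
  classical
  rw [box_mul]
  have h : box ε (X c) = 0 := by
    rw [box]
    refine Finset.sum_eq_zero fun a _ => ?_
    rw [pderiv_X, Pi.single_apply]
    split_ifs <;> simp
  simp [h, pderiv_X, Pi.single_apply]
  ring

theorem bessel_add (ε : σ → ℂ) (lam : ℂ) (c : σ) (p q : MvPolynomial σ ℂ) :
    bessel ε lam c (p + q) = bessel ε lam c p + bessel ε lam c q := by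
  simp only [bessel, map_add, euler_add, box_add]
  ring

theorem bessel_C_mul (ε : σ → ℂ) (lam : ℂ) (c : σ) (z : ℂ) (p : MvPolynomial σ ℂ) :
    bessel ε lam c (C z * p) = C z * bessel ε lam c p := by
  simp only [bessel, pderiv_C_mul, euler_C_mul, box_C_mul]
  ring

/-- This mirrors the bracket of `upper c` with `lower a`. Together with additivity and vanishing on
constants it characterises the Bessel operator, which is how the operator enters the problem. -/
theorem bessel_X_mul [DecidableEq σ] (ε : σ → ℂ) (lam : ℂ) (c a : σ) (p : MvPolynomial σ ℂ) :
    bessel ε lam c (X a * p) = X a * bessel ε lam c p +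
      2 * ((if c = a then C (ε c) else 0) * (C lam * p - euler p) + rotOp ε c a p) := by
  simp only [bessel, pderiv_mul, pderiv_X, Pi.single_apply, box_X_mul, euler_add, euler_mul,
    euler_X, rotOp, map_mul, map_ofNat]
  by_cases h : a = c
  · subst h
    simp only [if_true, one_mul]
    have h1 : euler (1 : MvPolynomial σ ℂ) = 0 := by simp [euler]
    rw [h1]
    ring
  · have h1 : euler (0 : MvPolynomial σ ℂ) = 0 := by simp [euler]
    simp only [h, Ne.symm h, if_false, h1]
    ring

theorem rotOp_C (ε : σ → ℂ) (a b : σ) (z : ℂ) : rotOp ε a b (C z) = 0 := by simp [rotOp]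

theorem euler_C (z : ℂ) : euler (C z : MvPolynomial σ ℂ) = 0 := by simp [euler]

theorem bessel_C (ε : σ → ℂ) (lam : ℂ) (c : σ) (z : ℂ) : bessel ε lam c (C z) = 0 := by
  simp [bessel, box, euler]

end Operators

/-! ### The enveloping algebra of the abelian Lie algebra `𝔫⁻` -/

theorem lower_mem_genNm {r : ℕ} (a : Mid r) : lower a ∈ genNm r := by
  rcases a with a | a
  · fin_cases a
    · exact Or.inr (Or.inl (Q1m_eq r).symm)
    · exact Or.inr (Or.inr (Q2m_eq r).symm)
  · exact Or.inl ⟨a, Ym_eq a⟩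

/-- The root vectors in `𝔫⁻`, as elements of this Lie algebra. -/
def lowerN {r : ℕ} (a : Mid r) : subNm r := ⟨lower a, Submodule.subset_span (lower_mem_genNm a)⟩

theorem subNm_lie_eq_zero {r : ℕ} (x y : subNm r) : ⁅x, y⁆ = 0 := by
  apply Subtype.ext
  obtain ⟨x, hx⟩ := x
  obtain ⟨y, hy⟩ := y
  change x ∈ Submodule.span ℝ (genNm r) at hx
  change y ∈ Submodule.span ℝ (genNm r) at hy
  change ⁅x, y⁆ = 0
  induction hx using Submodule.span_induction with
  | mem x hx =>
    induction hy using Submodule.span_induction with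
    | mem y hy => exact genNm_comm r x hx y hy
    | zero => exact lie_zero _
    | add a b _ _ ha hb => rw [lie_add, ha, hb, add_zero]
    | smul c a _ ha => rw [lie_smul, ha, smul_zero]
  | zero => exact zero_lie _
  | add a b _ _ ha hb => rw [add_lie, ha, hb, add_zero]
  | smul c a _ ha => rw [smul_lie, ha, smul_zero]

theorem subNm_mem_span_lowerN {r : ℕ} (x : subNm r) :
    x ∈ Submodule.span ℝ (Set.range (lowerN (r := r))) := by
  have key : ∀ y ∈ Submodule.span ℝ (genNm r), ∃ z ∈ Submodule.span ℝ (Set.range (lowerN (r := r))),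
      (z : so2 r) = y := by
    intro y hy
    induction hy using Submodule.span_induction with
    | mem y hy =>
      rcases hy with ⟨i, rfl⟩ | rfl | rfl
      · exact ⟨_, Submodule.subset_span ⟨Sum.inr i, rfl⟩, (Ym_eq i).symm⟩
      · exact ⟨_, Submodule.subset_span ⟨Sum.inl 0, rfl⟩, (Q1m_eq r).symm⟩
      · exact ⟨_, Submodule.subset_span ⟨Sum.inl 1, rfl⟩, (Q2m_eq r).symm⟩
    | zero => exact ⟨0, zero_mem _, rfl⟩
    | add a b _ _ ha hb =>
      obtain ⟨a', ha, rfl⟩ := ha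
      obtain ⟨b', hb, rfl⟩ := hb
      exact ⟨a' + b', add_mem ha hb, rfl⟩
    | smul c a _ ha =>
      obtain ⟨a', ha, rfl⟩ := ha
      exact ⟨c • a', Submodule.smul_mem _ c ha, rfl⟩
  obtain ⟨z, hz, hzx⟩ := key x x.2
  rwa [← Subtype.ext hzx]

/-- By the universal property `ι` lifts to a map into `S`; followed by the inclusion it fixes the
generators, so it is the identity and every element lies in `S`. -/
theorem subalgebra_uea_eq_top {L : Type*} [LieRing L] [LieAlgebra ℝ L]
    (S : Subalgebra ℝ (UniversalEnvelopingAlgebra ℝ L))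
    (h : ∀ x, UniversalEnvelopingAlgebra.ι ℝ x ∈ S) : S = ⊤ := by
  let f : L →ₗ⁅ℝ⁆ S :=
    { toFun := fun x => ⟨UniversalEnvelopingAlgebra.ι ℝ x, h x⟩
      map_add' := fun x y => Subtype.ext (map_add (UniversalEnvelopingAlgebra.ι ℝ) x y)
      map_smul' := fun c x => Subtype.ext (map_smul (UniversalEnvelopingAlgebra.ι ℝ) c x)
      map_lie' := fun {x y} => Subtype.ext (LieHom.map_lie (UniversalEnvelopingAlgebra.ι ℝ) x y) }
  have hc : S.val.comp (UniversalEnvelopingAlgebra.lift ℝ f) = AlgHom.id ℝ _ := by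
    apply UniversalEnvelopingAlgebra.hom_ext
    ext x
    change S.val (UniversalEnvelopingAlgebra.lift ℝ f (UniversalEnvelopingAlgebra.ι ℝ x)) =
      UniversalEnvelopingAlgebra.ι ℝ x
    rw [UniversalEnvelopingAlgebra.lift_ι_apply]
    rfl
  rw [eq_top_iff]
  intro x _
  have : (UniversalEnvelopingAlgebra.lift ℝ f x : UniversalEnvelopingAlgebra ℝ L) = x :=
    AlgHom.congr_fun hc x
  exact this.subst (motive := (· ∈ S)) (UniversalEnvelopingAlgebra.lift ℝ f x).2

/-- Two centralizer arguments: the centralizer of the generators contains the generators, hence is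
everything; so the centralizer of any `a` contains the generators and is everything as well. -/
theorem uea_mul_comm {L : Type*} [LieRing L] [LieAlgebra ℝ L] (h : ∀ x y : L, ⁅x, y⁆ = 0)
    (a b : UniversalEnvelopingAlgebra ℝ L) : a * b = b * a := by
  have h1 : ∀ x y : L, UniversalEnvelopingAlgebra.ι ℝ x * UniversalEnvelopingAlgebra.ι ℝ y =
      UniversalEnvelopingAlgebra.ι ℝ y * UniversalEnvelopingAlgebra.ι ℝ x := by
    intro x y
    rw [← sub_eq_zero, ← LieRing.of_associative_ring_bracket, ← LieHom.map_lie, h, map_zero]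
  have h2 : Subalgebra.centralizer ℝ (Set.range (UniversalEnvelopingAlgebra.ι ℝ (L := L))) = ⊤ := by
    refine subalgebra_uea_eq_top _ fun x => ?_
    rw [Subalgebra.mem_centralizer_iff]
    rintro _ ⟨y, rfl⟩
    exact h1 y x
  have h3 : Subalgebra.centralizer ℝ {a} = ⊤ := by
    refine subalgebra_uea_eq_top _ fun x => ?_
    rw [Subalgebra.mem_centralizer_iff]
    intro g hg
    rw [Set.mem_singleton_iff.1 hg]
    have : a ∈ Subalgebra.centralizer ℝ (Set.range (UniversalEnvelopingAlgebra.ι ℝ (L := L))) :=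
      h2 ▸ Algebra.mem_top
    exact ((Subalgebra.mem_centralizer_iff ℝ).1 this _ ⟨x, rfl⟩).symm
  have : b ∈ Subalgebra.centralizer ℝ {a} := h3 ▸ Algebra.mem_top
  exact (Subalgebra.mem_centralizer_iff ℝ).1 this a rfl

theorem cu_subNm_mul_comm {r : ℕ} (a b : CU (subNm r)) : a * b = b * a := by
  induction a using TensorProduct.induction_on with
  | zero => rw [zero_mul, mul_zero]
  | add a₁ a₂ h₁ h₂ => rw [add_mul, mul_add, h₁, h₂]
  | tmul z x =>
    induction b using TensorProduct.induction_on with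
    | zero => rw [zero_mul, mul_zero]
    | add a₁ a₂ h₁ h₂ => rw [add_mul, mul_add, h₁, h₂]
    | tmul w y =>
      rw [Algebra.TensorProduct.tmul_mul_tmul, Algebra.TensorProduct.tmul_mul_tmul, mul_comm z,
        uea_mul_comm subNm_lie_eq_zero x]

/-- The commutative ring structure on the enveloping algebra of `𝔫⁻`. -/
abbrev cuCommRing (r : ℕ) : CommRing (CU (subNm r)) :=
  { (inferInstance : Ring (CU (subNm r))) with mul_comm := cu_subNm_mul_comm }

/-- Polynomials in the root vectors, as elements of the enveloping algebra of `𝔫⁻`. -/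
def polyCU (r : ℕ) : MvPolynomial (Mid r) ℂ →ₐ[ℂ] CU (subNm r) :=
  -- `aeval` needs a commutative target. The structure used here extends the original ring
  -- structure, so the result is an algebra map for the latter.
  letI := cuCommRing r
  MvPolynomial.aeval fun a => toCU (lowerN a)

theorem polyCU_X {r : ℕ} (a : Mid r) : polyCU r (MvPolynomial.X a) = toCU (lowerN a) :=
  letI := cuCommRing r
  MvPolynomial.aeval_X _ _

/-- Surjectivity is all that is required: injectivity in the sense of Poincaré–Birkhoff–Witt is not
used, since polynomials are later separated by their action on functions. -/
theorem polyCU_surjective (r : ℕ) : Function.Surjective (polyCU r) := by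
  have h1 : ((polyCU r).range.restrictScalars ℝ).comap Algebra.TensorProduct.includeRight = ⊤ := by
    refine subalgebra_uea_eq_top _ fun x => ?_
    have hx := subNm_mem_span_lowerN x
    induction hx using Submodule.span_induction with
    | mem x hx =>
      obtain ⟨a, rfl⟩ := hx
      exact ⟨MvPolynomial.X a, polyCU_X a⟩
    | zero => rw [map_zero]; exact zero_mem _
    | add x y _ _ hx hy => rw [map_add]; exact add_mem hx hy
    | smul c x _ hx => rw [map_smul]; exact Subalgebra.smul_mem _ hx c
  intro E
  change E ∈ (polyCU r).range
  induction E using TensorProduct.induction_on with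
  | zero => exact zero_mem _
  | add a b ha hb => exact add_mem ha hb
  | tmul z x =>
    have hx : x ∈ ((polyCU r).range.restrictScalars ℝ).comap
        Algebra.TensorProduct.includeRight := h1 ▸ Algebra.mem_top
    have hx' : (1 : ℂ) ⊗ₜ[ℝ] x ∈ (polyCU r).range := hx
    have := Subalgebra.smul_mem _ hx' z
    rwa [TensorProduct.smul_tmul', smul_eq_mul, mul_one] at this

/-! ### Moving `𝔪`, `𝔞` and `𝔫⁺` through polynomials in `𝔫⁻`. -/

/-- Polynomials in the root vectors in `𝔫⁻`, as differential operators. -/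
def polyOp (r : ℕ) : MvPolynomial (Mid r) ℂ →ₐ[ℂ] Module.End ℂ (SmoothFn r) :=
  (diffOp r).comp ((mapCU (subNm r)).comp (polyCU r))

theorem mapCU_toCU {L : Type*} [LieRing L] [LieAlgebra ℝ L] (h : LieSubalgebra ℝ L) (x : h) :
    mapCU h (toCU x) = toCU (x : L) := by
  rw [mapCU, toCU, Algebra.TensorProduct.map_tmul, UniversalEnvelopingAlgebra.lift_ι_apply]
  rfl

theorem diffOp_toCU_eq (r : ℕ) (Y : so2 r) : diffOp r (toCU Y) = derivOp Y := by
  ext u g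
  exact diffOp_toCU r Y u g

theorem polyOp_X {r : ℕ} (a : Mid r) : polyOp r (MvPolynomial.X a) = derivOp (lower a) := by
  change diffOp r (mapCU (subNm r) (polyCU r (MvPolynomial.X a))) = _
  rw [polyCU_X, mapCU_toCU, diffOp_toCU_eq]
  rfl

theorem polyOp_X_mul {r : ℕ} (a : Mid r) (p : MvPolynomial (Mid r) ℂ) (u : SmoothFn r) :
    polyOp r (MvPolynomial.X a * p) u = derivOp (lower a) (polyOp r p u) := by
  rw [map_mul, polyOp_X]
  rfl

theorem polyOp_C_mul {r : ℕ} (c : ℂ) (p : MvPolynomial (Mid r) ℂ) (u : SmoothFn r) :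
    polyOp r (MvPolynomial.C c * p) u = c • polyOp r p u := by
  rw [← MvPolynomial.smul_eq_C_mul, map_smul]
  rfl

theorem polyOp_C {r : ℕ} (c : ℂ) (u : SmoothFn r) : polyOp r (MvPolynomial.C c) u = c • u := by
  rw [← mul_one (MvPolynomial.C c), polyOp_C_mul, map_one]
  rfl

theorem polyOp_add {r : ℕ} (p q : MvPolynomial (Mid r) ℂ) (u : SmoothFn r) :
    polyOp r (p + q) u = polyOp r p u + polyOp r q u := by
  rw [map_add]
  rfl

theorem polyOp_sub {r : ℕ} (p q : MvPolynomial (Mid r) ℂ) (u : SmoothFn r) :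
    polyOp r (p - q) u = polyOp r p u - polyOp r q u := by
  rw [map_sub]
  rfl

theorem derivOp_derivOp {r : ℕ} (Y Z : so2 r) (u : SmoothFn r) :
    derivOp Y (derivOp Z u) = derivOp ⁅Y, Z⁆ u + derivOp Z (derivOp Y u) := by
  have h := LieHom.map_lie (derivHom r) Y Z
  rw [LieRing.of_associative_ring_bracket] at h
  have h' := LinearMap.congr_fun h u
  change derivOp ⁅Y, Z⁆ u = derivOp Y (derivOp Z u) - derivOp Z (derivOp Y u) at h'
  rw [h', sub_add_cancel]

theorem derivOp_add {r : ℕ} (Y Z : so2 r) (u : SmoothFn r) :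
    derivOp (Y + Z) u = derivOp Y u + derivOp Z u :=
  LinearMap.congr_fun (map_add (derivHom r) Y Z) u

theorem derivOp_sub {r : ℕ} (Y Z : so2 r) (u : SmoothFn r) :
    derivOp (Y - Z) u = derivOp Y u - derivOp Z u :=
  LinearMap.congr_fun (map_sub (derivHom r) Y Z) u

theorem derivOp_neg {r : ℕ} (Y : so2 r) (u : SmoothFn r) : derivOp (-Y) u = -derivOp Y u :=
  LinearMap.congr_fun (map_neg (derivHom r) Y) u

theorem derivOp_smul {r : ℕ} (c : ℝ) (Y : so2 r) (u : SmoothFn r) :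
    derivOp (c • Y) u = (c : ℂ) • derivOp Y u :=
  LinearMap.congr_fun (map_smul (derivHom r) c Y) u

/-- The signs of the middle coordinates, as complex numbers. -/
abbrev csgn {r : ℕ} (a : Mid r) : ℂ := (sgn a : ℂ)

section Action

variable {r : ℕ} {lam : ℂ} {u : SmoothFn r}

/-- Since the rotations kill `u`, only the brackets with the variables survive, and these define a
derivation of the polynomial ring. -/
theorem derivOp_rot_polyOp (hM : ∀ a b : Mid r, derivOp (rot a b) u = 0) (a b : Mid r)
    (p : MvPolynomial (Mid r) ℂ) :
    derivOp (rot a b) (polyOp r p u) = polyOp r (rotOp csgn a b p) u := by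
  induction p using MvPolynomial.induction_on with
  | C z => rw [polyOp_C, map_smul, hM, rotOp_C, map_zero, smul_zero]; rfl
  | add p q hp hq => rw [polyOp_add, map_add, hp, hq, rotOp_add, polyOp_add]
  | mul_X p c hp =>
    rw [mul_comm, polyOp_X_mul, derivOp_derivOp, hp, lie_rot_lower, derivOp_sub, derivOp_smul,
      derivOp_smul, rotOp_mul, rotOp_X, polyOp_add, polyOp_X_mul, sub_mul, polyOp_sub]
    congr 2
    · split_ifs
      · rw [mul_assoc, polyOp_C_mul, polyOp_X_mul]
      · simp
    · split_ifs
      · rw [mul_assoc, polyOp_C_mul, polyOp_X_mul]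
      · simp

/-- Each variable has `H`-weight `-1` and `u` has weight `λ`. -/
theorem derivOp_H_polyOp (hH : derivOp (H r) u = lam • u) (p : MvPolynomial (Mid r) ℂ) :
    derivOp (H r) (polyOp r p u) = polyOp r (MvPolynomial.C lam * p - euler p) u := by
  induction p using MvPolynomial.induction_on with
  | C z =>
    rw [polyOp_C, map_smul, hH, euler_C, sub_zero, polyOp_C_mul, polyOp_C, smul_comm]
  | add p q hp hq =>
    rw [polyOp_add, map_add, hp, hq, euler_add, ← polyOp_add]
    congr 2
    ring
  | mul_X p c hp =>
    rw [mul_comm, polyOp_X_mul, derivOp_derivOp, hp, lie_H_lower, derivOp_neg, euler_mul, euler_X,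
      ← polyOp_X_mul, ← polyOp_X_mul, ← sub_eq_neg_add, ← polyOp_sub]
    congr 2
    ring

/-- Each bracket with a variable leaves an element of `𝔞 ⊕ 𝔪`, which has to be moved through the
remaining factors in turn by the two preceding lemmas. -/
theorem derivOp_upper_polyOp (hM : ∀ a b : Mid r, derivOp (rot a b) u = 0)
    (hN : ∀ a : Mid r, derivOp (upper a) u = 0) (hH : derivOp (H r) u = lam • u) (c : Mid r)
    (p : MvPolynomial (Mid r) ℂ) :
    derivOp (upper c) (polyOp r p u) = polyOp r (bessel csgn lam c p) u := by
  induction p using MvPolynomial.induction_on with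
  | C z => rw [polyOp_C, map_smul, hN, bessel_C, map_zero, smul_zero]; rfl
  | add p q hp hq => rw [polyOp_add, map_add, hp, hq, bessel_add, polyOp_add]
  | mul_X p a hp =>
    rw [mul_comm, polyOp_X_mul, derivOp_derivOp, hp, lie_upper_lower, derivOp_smul, derivOp_add,
      derivOp_smul, derivOp_rot_polyOp hM, derivOp_H_polyOp hH, bessel_X_mul, add_comm, polyOp_add,
      polyOp_X_mul]
    congr 1
    rw [show (2 : MvPolynomial (Mid r) ℂ) = MvPolynomial.C 2 from (map_ofNat _ 2).symm,
      polyOp_C_mul, polyOp_add]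
    congr 2
    split_ifs
    · rw [polyOp_C_mul]
    · simp

end Action

/-! ### Smooth vectors in the induced representation -/

theorem hasSum_exp_mulVec {r : ℕ} (A : Mat r) (v : Idx r → ℝ) :
    HasSum (fun n : ℕ => (n.factorial : ℝ)⁻¹ • (A ^ n).mulVec v)
      ((NormedSpace.exp A).mulVec v) := by
  let _ : NormedRing (Mat r) := Matrix.linftyOpNormedRing
  let _ : NormedAlgebra ℝ (Mat r) := Matrix.linftyOpNormedAlgebra
  have h := NormedSpace.exp_series_hasSum_exp' (𝕂 := ℝ) A
  have hc : Continuous fun B : Mat r => B.mulVec v :=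
    Continuous.matrix_mulVec continuous_id continuous_const
  have := h.map ({ toFun := fun B => B.mulVec v
                   map_zero' := Matrix.zero_mulVec v
                   map_add' := fun B C => Matrix.add_mulVec B C v } : Mat r →+ (Idx r → ℝ)) hc
  convert! this using 1
  funext n
  exact (Matrix.smul_mulVec _ _ _).symm

theorem exp_mulVec_of_eigenvector {r : ℕ} {A : Mat r} {v : Idx r → ℝ} {c : ℝ}
    (h : A.mulVec v = c • v) : (NormedSpace.exp A).mulVec v = Real.exp c • v := by
  have hn : ∀ n : ℕ, (A ^ n).mulVec v = c ^ n • v := by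
    intro n
    induction n with
    | zero => simp
    | succ n ih => rw [pow_succ, ← Matrix.mulVec_mulVec, h, Matrix.mulVec_smul, ih, smul_smul,
        pow_succ']
  have h1 := hasSum_exp_mulVec A v
  have h2 := (NormedSpace.exp_series_hasSum_exp' (𝕂 := ℝ) c).smul_const v
  rw [← congrFun Real.exp_eq_exp_ℝ c] at h2
  refine h1.unique ?_
  convert! h2 using 1
  funext n
  rw [hn, smul_smul, smul_eq_mul]

/-- The square of the Euclidean norm. -/
def sqNorm {r : ℕ} (v : Idx r → ℝ) : ℝ := ∑ i, v i ^ 2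

/-- The Euclidean norm is used because the invariant form vanishes on the orbit of the null vector
`e₊`. -/
theorem sqNorm_ne_zero {r : ℕ} {v : Idx r → ℝ} (hv : v ≠ 0) : sqNorm v ≠ 0 := by
  intro h
  apply hv
  funext i
  have := (Finset.sum_eq_zero_iff_of_nonneg fun i _ => sq_nonneg (v i)).1 h i (Finset.mem_univ i)
  exact pow_eq_zero_iff two_ne_zero |>.1 this

/-- The linear form on the middle coordinates with coefficients `l`. -/
def midForm {r : ℕ} (l : Mid r → ℝ) (v : Idx r → ℝ) : ℝ := ∑ a, l a * v (midIdx a)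

/-- The function `‖v‖^(lam - k) l(v)^k`, homogeneous of degree `lam`. -/
def homogFn {r : ℕ} (lam : ℂ) (k : ℕ) (l : Mid r → ℝ) (v : Idx r → ℝ) : ℂ :=
  Complex.exp ((lam - k) / 2 * (Real.log (sqNorm v) : ℝ)) * ((midForm l v : ℝ) : ℂ) ^ k

theorem homogFn_exp_smul {r : ℕ} (lam : ℂ) (k : ℕ) (l : Mid r → ℝ) (s : ℝ) {v : Idx r → ℝ}
    (hv : v ≠ 0) :
    homogFn lam k l (Real.exp s • v) = Complex.exp (lam * s) * homogFn lam k l v := by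
  have h1 : sqNorm (Real.exp s • v) = Real.exp (2 * s) * sqNorm v := by
    simp only [sqNorm, Pi.smul_apply, smul_eq_mul, mul_pow, ← Finset.mul_sum]
    rw [← Real.exp_nat_mul]
    norm_num
  have h2 : midForm l (Real.exp s • v) = Real.exp s * midForm l v := by
    simp only [midForm, Pi.smul_apply, smul_eq_mul, Finset.mul_sum]
    exact Finset.sum_congr rfl fun _ _ => by ring
  rw [homogFn, homogFn, h1, h2, Real.log_mul (Real.exp_ne_zero _) (sqNorm_ne_zero hv),
    Real.log_exp]
  push_cast
  rw [mul_pow, ← Complex.exp_nat_mul, ← mul_assoc, ← mul_assoc, ← Complex.exp_add,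
    ← Complex.exp_add]
  congr 2
  ring

theorem contDiffOn_homogFn {r : ℕ} (lam : ℂ) (k : ℕ) (l : Mid r → ℝ) {E : Type*}
    [NormedAddCommGroup E] [NormedSpace ℝ E] {f : E → Idx r → ℝ} (hf : ContDiff ℝ ∞ f) :
    ContDiffOn ℝ ∞ (fun y => homogFn lam k l (f y)) {y | sqNorm (f y) ≠ 0} := by
  have hfi : ∀ i, ContDiff ℝ ∞ fun y => f y i := fun i => (contDiff_pi.1 hf) i
  have h1 : ContDiff ℝ ∞ fun y => sqNorm (f y) := by
    unfold sqNorm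
    exact ContDiff.sum fun i _ => (hfi i).pow 2
  have h2 : ContDiff ℝ ∞ fun y => midForm l (f y) := by
    unfold midForm
    exact ContDiff.sum fun a _ => contDiff_const.mul (hfi _)
  have h3 : ContDiffOn ℝ ∞ (fun y => Real.log (sqNorm (f y))) {y | sqNorm (f y) ≠ 0} :=
    h1.contDiffOn.log fun y hy => hy
  have h4 := Complex.ofRealCLM.contDiff.comp_contDiffOn h3 (n := ∞)
  have h5 := (Complex.ofRealCLM.contDiff.comp h2 (n := ∞)).pow k
  exact ((contDiffOn_const.mul h4).cexp).mul h5.contDiffOn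

theorem mulVec_ePlus_ne_zero {r : ℕ} (g : G r) : (mat g).mulVec (ePlus r) ≠ 0 := by
  intro h
  have h1 : (mat g⁻¹ * mat g).mulVec (ePlus r) = 0 := by
    rw [← Matrix.mulVec_mulVec, h, Matrix.mulVec_zero]
  have h2 : mat g⁻¹ * mat g = 1 := Units.inv_mul (g : GL (Idx r) ℝ)
  rw [h2, Matrix.one_mulVec] at h1
  simpa [ePlus] using congrFun h1 (Sum.inl 0)

/-- The smooth function `g ↦ ‖g e‖^(lam - k) l(g e)^k`, where `e` is the highest weight vector. -/
def testFn {r : ℕ} (lam : ℂ) (k : ℕ) (l : Mid r → ℝ) : SmoothFn r :=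
  ⟨fun g => homogFn lam k l ((mat g).mulVec (ePlus r)), fun g => by
    have hf : ContDiff ℝ ∞ fun y : Ent r => (Matrix.of y).mulVec (ePlus r) := by
      refine contDiff_pi.2 fun i => ?_
      simp only [Matrix.mulVec, dotProduct, Matrix.of_apply]
      fun_prop
    refine ⟨{y | sqNorm ((Matrix.of y).mulVec (ePlus r)) ≠ 0}, _,
      sqNorm_ne_zero (mulVec_ePlus_ne_zero g), ?_, contDiffOn_homogFn lam k l hf, fun x _ => rfl⟩
    refine isOpen_ne.preimage ?_
    have := hf.continuous
    unfold sqNorm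
    fun_prop⟩

/-- The test function sees `g` only through `g e₊`; right translation by `exp(tY)` scales this
vector by `e^(tc)`, and homogeneity of degree `λ` gives the factor. -/
theorem derivOp_testFn {r : ℕ} (lam : ℂ) (k : ℕ) (l : Mid r → ℝ) {Y : so2 r} {c : ℝ}
    (hY : (Y : Mat r).mulVec (ePlus r) = c • ePlus r) :
    derivOp Y (testFn lam k l) = (lam * c) • testFn lam k l := by
  refine derivOp_eq_of_eq_exp_mul fun g t => ?_
  have h : (mat (g * expG (t • Y))).mulVec (ePlus r) =
      Real.exp (t * c) • (mat g).mulVec (ePlus r) := by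
    change (mat g * NormedSpace.exp (t • (Y : Mat r))).mulVec _ = _
    rw [← Matrix.mulVec_mulVec, exp_mulVec_of_eigenvector (c := t * c), Matrix.mulVec_smul]
    rw [Matrix.smul_mulVec, hY, smul_smul]
  change homogFn lam k l _ = _ * homogFn lam k l _
  rw [h, homogFn_exp_smul _ _ _ _ (mulVec_ePlus_ne_zero g)]
  push_cast
  ring_nf

theorem testFn_mem_Ind {r : ℕ} (lam : ℂ) (k : ℕ) (l : Mid r → ℝ) :
    testFn lam k l ∈ Ind (MonoidHom.id (G r)) lam := by
  rw [mem_Ind_iff_rot (dj := LinearMap.id) fun _ => rfl]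
  refine ⟨fun a b => ?_, fun a => ?_, ?_⟩
  · have := derivOp_testFn lam k l (Y := rot a b) (c := 0) (by
      change (wedgeMat _ _).mulVec _ = _
      rw [wedgeMat_mulVec, form_midVec_ePlus, form_midVec_ePlus]
      simp)
    simpa using this
  · have := derivOp_testFn lam k l (Y := upper a) (c := 0) (by
      change (wedgeMat _ _).mulVec _ = _
      rw [wedgeMat_mulVec, form_midVec_ePlus, form_ePlus_ePlus]
      simp)
    simpa using this
  · have := derivOp_testFn lam k l (Y := H r) (c := 1) (by
      rw [H_eq]
      change (-(2⁻¹ : ℝ) • wedgeMat _ _).mulVec _ = _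
      rw [Matrix.smul_mulVec, wedgeMat_mulVec, form_comm (eMinus r), form_ePlus_eMinus,
        form_ePlus_ePlus]
      module)
    simpa using this

/-! ### Jets along `N⁻` -/

/-- The vector with given middle coordinates. -/
def midSum {r : ℕ} (y : Mid r → ℝ) : Idx r → ℝ := ∑ a, y a • midVec a

/-- The element of `𝔫⁻` with given coordinates. -/
def lowerSum {r : ℕ} (y : Mid r → ℝ) : so2 r := wedge (eMinus r) (midSum y)

theorem form_midSum_right {r : ℕ} (x : Idx r → ℝ) (hx : ∀ a, form (midVec a) x = 0)
    (y : Mid r → ℝ) : form x (midSum y) = 0 := by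
  simp only [form, midSum, Matrix.mulVec_sum, dotProduct_sum, Matrix.mulVec_smul, dotProduct_smul]
  refine Finset.sum_eq_zero fun a _ => ?_
  have := hx a
  rw [form_comm, form] at this
  rw [this, smul_zero]

/-- As `𝔫⁻` is abelian, a step in a coordinate direction is a right translation. Left-invariant
fields from `𝔫⁻` therefore become partial derivatives in `y`. -/
theorem expG_lowerSum_add {r : ℕ} (y : Mid r → ℝ) (a : Mid r) (t : ℝ) :
    expG (lowerSum (y + t • Pi.single a 1)) = expG (lowerSum y) * expG (t • lower a) := by
  have h : midSum (y + t • Pi.single a 1) = midSum y + t • midVec a := by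
    simp [midSum, add_smul, Finset.sum_add_distrib, Pi.single_apply]
  rw [lowerSum, h, wedge_add_right, wedge_smul_right]
  refine expG_add_of_commute _ _ (Commute.smul_right ?_ t)
  have hl := wedge_lie (eMinus r) (midSum y) (eMinus r) (midVec a)
  rw [form_comm (midSum y) (eMinus r), form_midSum_right _ form_midVec_eMinus,
    form_eMinus_eMinus, form_comm (eMinus r) (midVec a), form_midVec_eMinus] at hl
  have h0 : wedge (eMinus r) (eMinus r) = 0 := by
    apply Subtype.ext
    change wedgeMat _ _ = 0
    simp [wedgeMat]
  rw [h0] at hl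
  have := congrArg Subtype.val hl
  simp only [zero_smul, smul_zero, sub_zero, add_zero] at this
  exact sub_eq_zero.1 this

/-- The generator sends `e₊` to `2y`, then to `2⟨y, y⟩ e₋`, then to `0`, so the exponential series
stops at the quadratic term, where `1/2!` cancels the `2`. -/
theorem expG_lowerSum_mulVec {r : ℕ} (y : Mid r → ℝ) :
    (mat (expG (lowerSum y))).mulVec (ePlus r) =
      ePlus r + (2 : ℝ) • midSum y + form (midSum y) (midSum y) • eMinus r := by
  set A : Mat r := wedgeMat (eMinus r) (midSum y) with hA
  change (NormedSpace.exp A).mulVec _ = _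
  have h1 : A.mulVec (ePlus r) = (2 : ℝ) • midSum y := by
    rw [hA, wedgeMat_mulVec, form_comm (midSum y), form_midSum_right _ form_midVec_ePlus,
      form_comm, form_ePlus_eMinus]
    module
  have h2 : A.mulVec (midSum y) = form (midSum y) (midSum y) • eMinus r := by
    rw [hA, wedgeMat_mulVec, form_midSum_right _ form_midVec_eMinus]
    module
  have h3 : A.mulVec (eMinus r) = 0 := by
    rw [hA, wedgeMat_mulVec, form_eMinus_eMinus, form_comm,
      form_midSum_right _ form_midVec_eMinus]
    module
  have p2 : (A ^ 2).mulVec (ePlus r) = (2 : ℝ) • form (midSum y) (midSum y) • eMinus r := by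
    rw [pow_two, ← Matrix.mulVec_mulVec, h1, Matrix.mulVec_smul, h2]
  have p3 : ∀ n : ℕ, (A ^ (n + 3)).mulVec (ePlus r) = 0 := by
    intro n
    rw [show n + 3 = n + 1 + 2 from rfl, pow_add, pow_succ, ← Matrix.mulVec_mulVec, p2,
      ← Matrix.mulVec_mulVec, Matrix.mulVec_smul, Matrix.mulVec_smul, Matrix.mulVec_smul,
      h3]
    simp
  refine (hasSum_exp_mulVec A (ePlus r)).unique ?_
  have hs := hasSum_sum_of_ne_finset_zero (L := SummationFilter.unconditional ℕ) (s := Finset.range 3)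
    (f := fun n : ℕ => (n.factorial : ℝ)⁻¹ • (A ^ n).mulVec (ePlus r)) (by
      intro n hn
      obtain ⟨m, rfl⟩ := Nat.exists_eq_add_of_le' (not_lt.1 fun h => hn (Finset.mem_range.2 h))
      rw [p3, smul_zero])
  convert! hs using 1
  simp [Finset.sum_range_succ, h1, p2]

/-- The restriction of a function to `N⁻`, in coordinates. -/
def pull {r : ℕ} (u : SmoothFn r) (y : Mid r → ℝ) : ℂ := u.1 (expG (lowerSum y))

theorem hasLineDerivAt_pull {r : ℕ} (u : SmoothFn r) (a : Mid r) (y : Mid r → ℝ) :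
    HasLineDerivAt ℝ (pull u) (pull (derivOp (lower a) u) y) y (Pi.single a 1) := by
  have h := hasDerivAt_rightDeriv (lower a) u (expG (lowerSum y)) 0
  rw [zero_smul, expG_zero, mul_one] at h
  simp only [← expG_lowerSum_add] at h
  exact h

/-- The linear function with coefficients `l`. -/
def linFn {r : ℕ} (l y : Mid r → ℝ) : ℂ := ((∑ a, l a * y a : ℝ) : ℂ)

theorem hasLineDerivAt_linFn {r : ℕ} (l : Mid r → ℝ) (a : Mid r) (y : Mid r → ℝ) :
    HasLineDerivAt ℝ (linFn l) (l a : ℂ) y (Pi.single a 1) := by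
  have h : ∀ t : ℝ, linFn l (y + t • Pi.single a 1) = linFn l y + t * l a := by
    intro t
    simp only [linFn, Pi.add_apply, Pi.smul_apply, Pi.single_apply, mul_add,
      Finset.sum_add_distrib]
    simp [mul_comm]
  unfold HasLineDerivAt
  simp only [h]
  have := ((Complex.ofRealCLM.hasDerivAt (x := 0)).mul_const (l a : ℂ)).const_add (linFn l y)
  simpa using this

/-- The null vectors have no middle coordinates, so `l` takes the value `2 l(y)` at the translate of
`e₊`. What remains is a power of a norm that never vanishes. -/
theorem pull_testFn {r : ℕ} (lam : ℂ) (k : ℕ) (l : Mid r → ℝ) :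
    ∃ Ψ : (Mid r → ℝ) → ℂ, ContDiff ℝ ∞ Ψ ∧ Ψ 0 ≠ 0 ∧
      ∀ y, pull (testFn lam k l) y = linFn l y ^ k * Ψ y := by
  have hf : ContDiff ℝ ∞ fun y : Mid r → ℝ =>
      ePlus r + (2 : ℝ) • midSum y + form (midSum y) (midSum y) • eMinus r := by
    have hm : ContDiff ℝ ∞ fun y : Mid r → ℝ => midSum y := by
      unfold midSum
      fun_prop
    have hmi : ∀ i, ContDiff ℝ ∞ fun y : Mid r → ℝ => midSum y i := contDiff_pi.1 hm
    have hq : ContDiff ℝ ∞ fun y : Mid r → ℝ => form (midSum y) (midSum y) := by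
      simp only [form, gram, Matrix.mulVec_diagonal, dotProduct]
      fun_prop
    fun_prop
  -- With exponent `0` the linear form drops out, leaving the pure power `‖·‖^(λ-k)`.
  refine ⟨fun y => 2 ^ k * homogFn (lam - k) 0 l
    (ePlus r + (2 : ℝ) • midSum y + form (midSum y) (midSum y) • eMinus r), ?_, ?_, ?_⟩
  · have h := contDiffOn_homogFn (lam - k) 0 l hf
    have huniv : {y : Mid r → ℝ | sqNorm (ePlus r + (2 : ℝ) • midSum y +
        form (midSum y) (midSum y) • eMinus r) ≠ 0} = Set.univ := by
      refine Set.eq_univ_of_forall fun y => sqNorm_ne_zero ?_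
      rw [← expG_lowerSum_mulVec]
      exact mulVec_ePlus_ne_zero _
    rw [huniv, contDiffOn_univ] at h
    exact contDiff_const.mul h
  · simp [homogFn, Complex.exp_ne_zero]
  · intro y
    have hl : midForm l (ePlus r + (2 : ℝ) • midSum y + form (midSum y) (midSum y) • eMinus r) =
        2 * ∑ a, l a * y a := by
      have hm : ∀ a : Mid r, midSum y (midIdx a) = y a := by
        intro a
        simp [midSum, midVec, Pi.single_apply, midIdx_injective.eq_iff]
      have he : ∀ a : Mid r, ePlus r (midIdx a) = 0 ∧ eMinus r (midIdx a) = 0 := by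
        rintro (a | a)
        · fin_cases a <;> simp [ePlus, eMinus, midIdx]
        · simp [ePlus, eMinus, midIdx]
      rw [midForm, Finset.mul_sum]
      refine Finset.sum_congr rfl fun a _ => ?_
      simp only [Pi.add_apply, Pi.smul_apply, hm, (he a).1, (he a).2, smul_eq_mul]
      ring
    change homogFn lam k l ((mat (expG (lowerSum y))).mulVec (ePlus r)) = _
    simp only [expG_lowerSum_mulVec, homogFn, hl, linFn]
    push_cast
    ring_nf

/-- The shape `ℓ^j (c Ψ + ℓ Ψ')` persists under differentiation, which lowers `j` by one and
multiplies `c` by the old exponent and `l a`. At the origin only `j = 0` contributes, and the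
unspecified `Ψ'` does not matter. -/
theorem pull_monomial {r k : ℕ} {l : Mid r → ℝ} {u : SmoothFn r} {Ψ : (Mid r → ℝ) → ℂ}
    (hΨ : ContDiff ℝ ∞ Ψ) (hu : ∀ y, pull u y = linFn l y ^ k * Ψ y) (m j : ℕ) (hmj : m + j = k)
    (β : Mid r →₀ ℕ) (hβ : β.degree = m) :
    ∃ Ψ' : (Mid r → ℝ) → ℂ, ContDiff ℝ ∞ Ψ' ∧
      ∀ y, pull (polyOp r (MvPolynomial.monomial β 1) u) y = linFn l y ^ j *
        (k.descFactorial m * MvPolynomial.eval (fun a => (l a : ℂ)) (MvPolynomial.monomial β 1) *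
          Ψ y + linFn l y * Ψ' y) := by
  induction m generalizing j β with
  | zero =>
    have h0 : β = 0 := (Finsupp.degree_eq_zero_iff β).1 hβ
    subst h0
    refine ⟨0, contDiff_const, fun y => ?_⟩
    obtain rfl : j = k := by omega
    have h1 : MvPolynomial.monomial (0 : Mid r →₀ ℕ) (1 : ℂ) = 1 := rfl
    rw [h1, map_one, map_one, Module.End.one_apply, hu]
    simp
  | succ m ih =>
    obtain ⟨a, ha⟩ : ∃ a, β a ≠ 0 := by
      by_contra! h
      have : β = 0 := Finsupp.ext h
      rw [this, map_zero] at hβ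
      omega
    obtain ⟨γ, rfl⟩ : ∃ γ : Mid r →₀ ℕ, β = Finsupp.single a 1 + γ :=
      exists_add_of_le (Finsupp.single_le_iff.2 (Nat.one_le_iff_ne_zero.2 ha))
    rw [map_add, Finsupp.degree_single] at hβ
    obtain ⟨Ψ', hΨ', h⟩ := ih (j + 1) (by omega) γ (by omega)
    have hX : MvPolynomial.monomial (Finsupp.single a 1 + γ) (1 : ℂ) =
        MvPolynomial.X a * MvPolynomial.monomial γ 1 := by
      rw [MvPolynomial.X, MvPolynomial.monomial_mul, one_mul]
    set c : ℂ := k.descFactorial m *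
      MvPolynomial.eval (fun a => (l a : ℂ)) (MvPolynomial.monomial γ 1) with hc
    have hline : ∀ {F : (Mid r → ℝ) → ℂ}, ContDiff ℝ ∞ F → ∀ y,
        HasLineDerivAt ℝ F (fderiv ℝ F y (Pi.single a 1)) y (Pi.single a 1) := fun hF y =>
      ((hF.differentiable (by simp)) y).hasFDerivAt.hasLineDerivAt _
    have hsm : ∀ {F : (Mid r → ℝ) → ℂ}, ContDiff ℝ ∞ F →
        ContDiff ℝ ∞ fun y => fderiv ℝ F y (Pi.single a 1) := fun hF =>
      (hF.fderiv_right (m := ∞) (by simp)).clm_apply contDiff_const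
    have hL : ContDiff ℝ ∞ (linFn l) := by
      have hs : ContDiff ℝ ∞ fun y : Mid r → ℝ => ∑ a, l a * y a :=
        ContDiff.sum fun a _ => contDiff_const.mul (contDiff_apply ℝ ℝ a)
      exact Complex.ofRealCLM.contDiff.comp hs
    -- The terms of the product rule that carry `ℓ^(j+1)`, with that power divided out.
    refine ⟨fun y => (j + 1) * l a * Ψ' y + (c * fderiv ℝ Ψ y (Pi.single a 1) +
      (l a * Ψ' y + linFn l y * fderiv ℝ Ψ' y (Pi.single a 1))), ?_, fun y => ?_⟩
    · exact (contDiff_const.mul hΨ').add ((contDiff_const.mul (hsm hΨ)).add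
        ((contDiff_const.mul hΨ').add (hL.mul (hsm hΨ'))))
    · have d1 := hasLineDerivAt_linFn l a y
      have d2 := hline hΨ y
      have d3 := hline hΨ' y
      unfold HasLineDerivAt at d1 d2 d3
      have d4 := (d1.pow (j + 1)).mul ((d2.const_mul c).add (d1.mul d3))
      have d5 := hasLineDerivAt_pull (polyOp r (MvPolynomial.monomial γ 1) u) a y
      unfold HasLineDerivAt at d5
      simp only [h] at d5
      rw [hX, polyOp_X_mul, d5.unique d4, map_mul, MvPolynomial.eval_X]
      have hk : (k.descFactorial (m + 1) : ℂ) = (j + 1) * k.descFactorial m := by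
        rw [Nat.descFactorial_succ, show k - m = j + 1 by omega]
        push_cast
        ring
      rw [hk]
      simp only [zero_smul, add_zero, Pi.add_apply, Pi.mul_apply, Pi.pow_apply,
        Nat.add_sub_cancel]
      rw [hc]
      push_cast
      ring

/-- A differential operator in the directions of `𝔫⁻` that annihilates the induced
representation at the identity is zero. -/
theorem eq_zero_of_polyOp_apply_one {r : ℕ} (lam : ℂ) (q : MvPolynomial (Mid r) ℂ)
    (hq : ∀ u ∈ Ind (MonoidHom.id (G r)) lam, (polyOp r q u).1 1 = 0) : q = 0 := by
  by_contra hne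
  -- With this exponent all monomials of lower degree give `0` at the identity, while the top part
  -- gives `k! Ψ(0)` times its value at `l`.
  set k := q.totalDegree with hk
  have htop : MvPolynomial.homogeneousComponent k q = 0 := by
    -- Test functions exist only for real `l`, but a complex polynomial vanishing at all real points
    -- is zero.
    refine MvPolynomial.funext_set (s := fun _ => Set.range ((↑) : ℝ → ℂ))
      (fun _ => Set.infinite_range_of_injective Complex.ofReal_injective) ?_
    intro x hx
    choose l hl using fun a => hx a (Set.mem_univ a)
    obtain rfl : (fun a => (l a : ℂ)) = x := funext hl
    obtain ⟨Ψ, hΨ, hΨ0, hu⟩ := pull_testFn lam k l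
    have h0 : ∀ v : SmoothFn r, pull v 0 = v.1 1 := by
      intro v
      have : lowerSum (0 : Mid r → ℝ) = 0 := by
        rw [lowerSum, show midSum (0 : Mid r → ℝ) = 0 by simp [midSum], wedge_zero_right]
      rw [pull, this, expG_zero]
    have hL : linFn l 0 = 0 := by simp [linFn]
    let T : MvPolynomial (Mid r) ℂ →ₗ[ℂ] ℂ :=
      { toFun := fun p => (polyOp r p (testFn lam k l)).1 1
        map_add' := fun p p' => by rw [polyOp_add]; rfl
        map_smul' := fun c p => by rw [map_smul]; rfl }
    have hT : ∀ β : Mid r →₀ ℕ, β ∈ q.support → T (MvPolynomial.monomial β 1) =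
        if β.degree = k then k.factorial * Ψ 0 *
          MvPolynomial.eval (fun a => (l a : ℂ)) (MvPolynomial.monomial β 1) else 0 := by
      intro β hβ
      have hle : β.degree ≤ k := MvPolynomial.le_totalDegree hβ
      obtain ⟨j, hj⟩ := Nat.exists_eq_add_of_le hle
      obtain ⟨Ψ', -, h⟩ := pull_monomial hΨ hu β.degree j hj.symm β rfl
      change (polyOp r _ _).1 1 = _
      rw [← h0, h, hL]
      split_ifs with hd
      · obtain rfl : j = 0 := by omega
        rw [hd, Nat.descFactorial_self]
        ring
      · rw [zero_pow (by omega), zero_mul]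
    have hTq : T q = 0 := hq _ (testFn_mem_Ind lam k l)
    rw [q.as_sum, map_sum] at hTq
    have hterm : ∀ β ∈ q.support, T (MvPolynomial.monomial β (q.coeff β)) =
        k.factorial * Ψ 0 * if β.degree = k then
          MvPolynomial.eval (fun a => (l a : ℂ)) (MvPolynomial.monomial β (q.coeff β)) else 0 := by
      intro β hβ
      have hs : MvPolynomial.monomial β (q.coeff β) =
          q.coeff β • MvPolynomial.monomial β (1 : ℂ) := by
        rw [MvPolynomial.smul_monomial, smul_eq_mul, mul_one]
      rw [hs, map_smul, hT β hβ, MvPolynomial.smul_eval]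
      split_ifs
      · rw [smul_eq_mul]; ring
      · simp
    rw [Finset.sum_congr rfl hterm, ← Finset.mul_sum, ← Finset.sum_filter] at hTq
    rw [MvPolynomial.homogeneousComponent_apply, map_sum, map_zero]
    refine (mul_eq_zero.1 hTq).resolve_left (mul_ne_zero ?_ hΨ0)
    exact Nat.cast_ne_zero.2 (Nat.factorial_ne_zero k)
  obtain ⟨β, hβ, hd⟩ := Finset.exists_mem_eq_sup q.support
    (MvPolynomial.support_nonempty.2 hne) fun s => s.degree
  have hd' : β.degree = k := by
    rw [hk, MvPolynomial.totalDegree]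
    exact hd.symm
  have := congrArg (MvPolynomial.coeff β) htop
  rw [MvPolynomial.coeff_homogeneousComponent, if_pos hd', MvPolynomial.coeff_zero] at this
  exact MvPolynomial.mem_support_iff.1 hβ this

/-! ### The polynomial solutions of the system of differential equations -/

section Polynomials

open MvPolynomial

variable {σ : Type*}

/-- Rotation invariance read off at `x_o x_b x^γ`: a factor `x_b²` can be traded for `x_o²` up to a
nonzero constant. -/
theorem coeff_rotOp_step {ε : σ → ℂ} {p : MvPolynomial σ ℂ} {o b : σ} (h : rotOp ε o b p = 0)
    (γ : σ →₀ ℕ) :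
    ε b * ((γ b + 2) * coeff (γ + Finsupp.single b 2) p) =
      ε o * ((γ o + 2) * coeff (γ + Finsupp.single o 2) p) := by
  have h1 := congrArg (coeff (Finsupp.single o 1 + (Finsupp.single b 1 + γ))) h
  rw [rotOp, coeff_sub, coeff_C_mul, coeff_C_mul, coeff_X_mul, add_left_comm, coeff_X_mul,
    coeff_pderiv, coeff_pderiv, coeff_zero] at h1
  have e1 : ∀ c : σ, Finsupp.single c 1 + γ + Finsupp.single c 1 = γ + Finsupp.single c 2 := by
    intro c
    rw [add_comm _ γ, add_assoc, ← Finsupp.single_add]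
  rw [e1, e1] at h1
  simp at h1
  linear_combination h1

variable [DecidableEq σ]

theorem coeff_X_mul_pderiv_self (a : σ) (p : MvPolynomial σ ℂ) (α : σ →₀ ℕ) :
    coeff α (X a * pderiv a p) = α a * coeff α p := by
  rw [coeff_X_mul', coeff_pderiv]
  split_ifs with h
  · have h1 : Finsupp.single a 1 ≤ α :=
      Finsupp.single_le_iff.2 (Nat.one_le_iff_ne_zero.2 (Finsupp.mem_support_iff.1 h))
    obtain ⟨γ, rfl⟩ := exists_add_of_le h1
    rw [add_tsub_cancel_left, add_comm γ]
    simp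
    ring
  · rw [Finsupp.notMem_support_iff.1 h]
    simp

theorem coeff_euler [Fintype σ] (p : MvPolynomial σ ℂ) (α : σ →₀ ℕ) :
    coeff α (euler p) = α.degree * coeff α p := by
  rw [euler, coeff_sum]
  simp only [coeff_X_mul_pderiv_self]
  rw [← Finset.sum_mul, Finsupp.degree_eq_sum]
  push_cast
  rfl

theorem coeff_box [Fintype σ] (ε : σ → ℂ) (p : MvPolynomial σ ℂ) (α : σ →₀ ℕ) :
    coeff α (box ε p) =
      ∑ a, ε a * ((α a + 1) * (α a + 2) * coeff (α + Finsupp.single a 2) p) := by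
  rw [box, coeff_sum]
  refine Finset.sum_congr rfl fun a _ => ?_
  rw [coeff_C_mul, coeff_pderiv, coeff_pderiv, add_assoc, ← Finsupp.single_add,
    one_add_one_eq_two]
  simp only [Finsupp.add_apply, Finsupp.single_eq_same, Nat.cast_add, Nat.cast_one]
  ring

variable {ε : σ → ℂ} {p : MvPolynomial σ ℂ} {o b : σ}

/-- At the monomial `x^γ x_o`, free of `x_b`, the second term of the rotation cannot contribute. -/
theorem coeff_eq_zero_of_rotOp_left (hε : ∀ a, ε a ≠ 0) (hob : o ≠ b) (h : rotOp ε o b p = 0)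
    (γ : σ →₀ ℕ) (hγ : γ b = 0) : coeff (γ + Finsupp.single b 1) p = 0 := by
  have h1 := congrArg (coeff (γ + Finsupp.single o 1)) h
  rw [rotOp, coeff_sub, coeff_C_mul, coeff_C_mul, add_comm γ, coeff_X_mul, coeff_X_mul',
    if_neg (by simp [hγ, hob]), coeff_pderiv, coeff_zero, hγ] at h1
  simpa [hε] using h1

theorem coeff_eq_zero_of_rotOp_right (hε : ∀ a, ε a ≠ 0) (hob : o ≠ b) (h : rotOp ε o b p = 0)
    (γ : σ →₀ ℕ) (hγ : γ o = 0) : coeff (γ + Finsupp.single o 1) p = 0 := by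
  have h1 := congrArg (coeff (γ + Finsupp.single b 1)) h
  rw [rotOp, coeff_sub, coeff_C_mul, coeff_C_mul, add_comm γ, coeff_X_mul, coeff_X_mul',
    if_neg (by simp [hγ, hob.symm]), coeff_pderiv, coeff_zero, hγ] at h1
  simpa [hε] using h1

/-- Trading `x_o²` for `x_b²` lowers an odd exponent of `x_o` to `1`, where the coefficient
vanishes. -/
theorem coeff_eq_zero_of_odd (hε : ∀ a, ε a ≠ 0) (hob : o ≠ b) (h : rotOp ε o b p = 0) (j : ℕ)
    (α : σ →₀ ℕ) (hα : α o = 2 * j + 1) : coeff α p = 0 := by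
  induction j generalizing α with
  | zero =>
    obtain ⟨γ, rfl⟩ := exists_add_of_le (Finsupp.single_le_iff.2 (show 1 ≤ α o by omega))
    rw [add_comm]
    refine coeff_eq_zero_of_rotOp_right hε hob h γ ?_
    simpa using hα
  | succ j ih =>
    obtain ⟨γ, rfl⟩ := exists_add_of_le (Finsupp.single_le_iff.2 (show 2 ≤ α o by omega))
    have hγ : γ o = 2 * j + 1 := by
      simp at hα
      omega
    have h1 := coeff_rotOp_step h γ
    rw [ih (γ + Finsupp.single b 2) (by simp [hγ, hob]), mul_zero, mul_zero] at h1
    rw [add_comm]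
    have h2 : ((γ o : ℂ) + 2) ≠ 0 := by exact_mod_cast (by omega : γ o + 2 ≠ 0)
    exact ((mul_eq_zero.1 ((mul_eq_zero.1 h1.symm).resolve_left (hε o))).resolve_left h2)

variable [Fintype σ] {T : σ}

/-- Induction on the total exponent `s` outside `o` and `T`: a variable of exponent `1` forces the
coefficient to vanish, and a square is traded for `x_o²`, which lowers `s`. -/
theorem eq_zero_of_coeff_plane (hε : ∀ a, ε a ≠ 0) (hR : ∀ b, b ≠ o → b ≠ T → rotOp ε o b p = 0)
    (hoT : o ≠ T)
    (h : ∀ i l : ℕ, coeff (Finsupp.single o i + Finsupp.single T l) p = 0) : p = 0 := by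
  suffices key : ∀ (s : ℕ) (α : σ →₀ ℕ), ∑ b ∈ (Finset.univ.erase o).erase T, α b = s →
      coeff α p = 0 by
    ext α
    rw [key _ α rfl, coeff_zero]
  intro s
  induction s using Nat.strong_induction_on with
  | _ s ih =>
    intro α hα
    by_cases h0 : ∀ b ∈ (Finset.univ.erase o).erase T, α b = 0
    · have : α = Finsupp.single o (α o) + Finsupp.single T (α T) := by
        ext b
        by_cases hb : b = o
        · subst hb
          simp [hoT.symm]
        · by_cases hb' : b = T
          · subst hb'
            simp [hoT]
          · rw [h0 b (by simp [hb, hb'])]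
            simp [Ne.symm hb, Ne.symm hb']
      rw [this]
      exact h _ _
    · push Not at h0
      obtain ⟨b, hb, hne⟩ := h0
      have hbT : b ≠ T := (Finset.mem_erase.1 hb).1
      have hbo : b ≠ o := (Finset.mem_erase.1 (Finset.mem_erase.1 hb).2).1
      have hr := hR b hbo hbT
      by_cases h1 : α b = 1
      · obtain ⟨γ, rfl⟩ := exists_add_of_le (Finsupp.single_le_iff.2 h1.ge)
        rw [add_comm]
        refine coeff_eq_zero_of_rotOp_left hε hbo.symm hr γ ?_
        simpa using h1
      · obtain ⟨γ, rfl⟩ := exists_add_of_le (Finsupp.single_le_iff.2 (show 2 ≤ α b by omega))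
        have hs := coeff_rotOp_step hr γ
        have hz : coeff (γ + Finsupp.single o 2) p = 0 := by
          refine ih _ ?_ _ rfl
          rw [← hα]
          refine Finset.sum_lt_sum (fun c hc => ?_) ⟨b, hb, ?_⟩
          · have hco : c ≠ o := (Finset.mem_erase.1 (Finset.mem_erase.1 hc).2).1
            simp [Finsupp.single_apply, hco.symm]
          · simp [hbo]
        rw [hz, mul_zero, mul_zero] at hs
        rw [add_comm]
        have h2 : ((γ b : ℂ) + 2) ≠ 0 := by exact_mod_cast (by omega : γ b + 2 ≠ 0)
        exact (mul_eq_zero.1 ((mul_eq_zero.1 hs).resolve_left (hε b))).resolve_left h2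

/-- A homogeneous rotation invariant polynomial that is annihilated by a Bessel operator vanishes
if one particular coefficient does. -/
theorem eq_zero_of_bessel {lam : ℂ} {N : ℕ} (hε : ∀ a, ε a ≠ 0) (hoT : o ≠ T)
    (hb : ∃ b, b ≠ o ∧ b ≠ T) (hR : ∀ b, b ≠ o → b ≠ T → rotOp ε o b p = 0)
    (hE : euler p = C (N : ℂ) * p) (hB : bessel ε lam o p = 0)
    (h0 : coeff (Finsupp.single o (2 * (N / 2)) + Finsupp.single T (N - 2 * (N / 2))) p = 0) :
    p = 0 := by
  have hdown : ∀ d : ℕ, d ≤ N / 2 → coeff (Finsupp.single o (2 * (N / 2 - d)) +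
      Finsupp.single T (N - 2 * (N / 2 - d))) p = 0 := by
    intro d
    induction d with
    | zero => intro _; exact h0
    | succ d ih =>
      intro hd
      have ih := ih (by omega)
      obtain ⟨i, hi⟩ : ∃ i, N / 2 - d = i + 1 := ⟨N / 2 - d - 1, by omega⟩
      rw [hi] at ih
      rw [show N / 2 - (d + 1) = i by omega]
      -- The Bessel equation is read off at `x_o x^ν`. It links `ν + 2o`, known to vanish, with the
      -- next coefficient `ν + 2T`.
      set ν : σ →₀ ℕ := Finsupp.single o (2 * i) + Finsupp.single T (N - 2 * (i + 1)) with hν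
      have hνo : ν + Finsupp.single o 2 =
          Finsupp.single o (2 * (i + 1)) + Finsupp.single T (N - 2 * (i + 1)) := by
        rw [hν, add_right_comm, ← Finsupp.single_add]
        rfl
      have hνT : ν + Finsupp.single T 2 =
          Finsupp.single o (2 * i) + Finsupp.single T (N - 2 * i) := by
        rw [hν, add_assoc, ← Finsupp.single_add]
        congr 2
        omega
      have h1 := congrArg (coeff (Finsupp.single o 1 + ν)) hB
      -- This removes the term with `λ - E`, so the descent works for every `λ`.
      have h2 : coeff (Finsupp.single o 1 + ν) (pderiv o p) = 0 := by
        rw [coeff_pderiv, add_comm _ ν, add_assoc, ← Finsupp.single_add, hνo, ih, zero_mul]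
      rw [bessel, coeff_add, coeff_C_mul, coeff_sub, coeff_C_mul, coeff_euler, h2, coeff_X_mul,
        coeff_box, coeff_zero, Finset.sum_eq_single T] at h1
      · rw [hνT] at h1
        have h3 : ((ν T : ℂ) + 1) * (ν T + 2) ≠ 0 := by
          exact_mod_cast (Nat.mul_ne_zero (by omega) (by omega) : (ν T + 1) * (ν T + 2) ≠ 0)
        simpa [hε, h3] using h1
      · intro a _ haT
        by_cases hao : a = o
        · rw [hao, hνo, ih, mul_zero, mul_zero]
        -- The other summands of the wave operator are rotated into the vanishing coefficient at `ν
        -- + 2o`.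
        · have hs := coeff_rotOp_step (hR a hao haT) ν
          rw [hνo, ih, mul_zero, mul_zero] at hs
          have h4 : ((ν a : ℂ) + 2) ≠ 0 := by exact_mod_cast (by omega : ν a + 2 ≠ 0)
          have h5 := (mul_eq_zero.1 ((mul_eq_zero.1 hs).resolve_left (hε a))).resolve_left h4
          rw [h5, mul_zero, mul_zero]
      · simp
  obtain ⟨b, hbo, hbT⟩ := hb
  refine eq_zero_of_coeff_plane hε hR hoT fun i l => ?_
  by_cases hil : i + l = N
  · rcases Nat.even_or_odd' i with ⟨j, rfl | rfl⟩
    · have := hdown (N / 2 - j) (by omega)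
      rwa [show N / 2 - (N / 2 - j) = j by omega, show N - 2 * j = l by omega] at this
    · exact coeff_eq_zero_of_odd hε hbo.symm (hR b hbo hbT) j _ (by simp [hoT.symm])
  · have h1 := congrArg (coeff (Finsupp.single o i + Finsupp.single T l)) hE
    rw [coeff_euler, coeff_C_mul, map_add, Finsupp.degree_single, Finsupp.degree_single,
      ← sub_eq_zero, ← sub_mul] at h1
    refine (mul_eq_zero.1 h1).resolve_left (sub_ne_zero.2 ?_)
    exact_mod_cast hil

/-- The quadratic form in the variables other than `T`. -/
def quad (ε : σ → ℂ) (T : σ) : MvPolynomial σ ℂ :=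
  ∑ a ∈ Finset.univ.erase T, C (ε a) * X a ^ 2

theorem pderiv_quad {c : σ} (hc : c ≠ T) : pderiv c (quad ε T) = C (2 * ε c) * X c := by
  rw [quad, map_sum, Finset.sum_eq_single c]
  · rw [pderiv_C_mul, pderiv_pow, pderiv_X_self, map_mul, map_ofNat]
    push_cast
    ring
  · intro a _ hac
    rw [pderiv_C_mul, pderiv_pow, pderiv_X_of_ne hac]
    simp
  · simp [hc]

theorem pderiv_quad_self : pderiv T (quad ε T) = 0 := by
  rw [quad, map_sum]
  refine Finset.sum_eq_zero fun a ha => ?_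
  rw [pderiv_C_mul, pderiv_pow, pderiv_X_of_ne (Finset.ne_of_mem_erase ha)]
  simp

theorem rotOp_quad_pow_mul (hε : ∀ a, ε a * ε a = 1) {a b : σ} (ha : a ≠ T) (hb : b ≠ T) (j k : ℕ) :
    rotOp ε a b (quad ε T ^ j * X T ^ k) = 0 := by
  have hq : rotOp ε a b (quad ε T) = 0 := by
    rw [rotOp, pderiv_quad ha, pderiv_quad hb]
    have hC : ∀ a, C (ε a) * C (ε a) = (1 : MvPolynomial σ ℂ) := fun a => by
      rw [← map_mul, hε, map_one]
    simp only [map_mul, map_ofNat]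
    linear_combination (2 * X a * X b) * (hC b - hC a)
  have hX : rotOp ε a b (X T) = 0 := by simp [rotOp_X, ha, hb]
  have hpow : ∀ (q : MvPolynomial σ ℂ), rotOp ε a b q = 0 → ∀ j : ℕ, rotOp ε a b (q ^ j) = 0 := by
    intro q hq j
    induction j with
    | zero => simpa using rotOp_C ε a b 1
    | succ j ih => rw [pow_succ, rotOp_mul, ih, hq]; ring
  rw [rotOp_mul, hpow _ hq, hpow _ hX]
  ring

theorem euler_quad_pow_mul (j k : ℕ) : euler (quad ε T ^ j * X T ^ k) =
    C ((2 * j + k : ℕ) : ℂ) * (quad ε T ^ j * X T ^ k) := by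
  have hq : euler (quad ε T) = 2 * quad ε T := by
    rw [euler, ← Finset.add_sum_erase _ _ (Finset.mem_univ T), pderiv_quad_self, quad,
      Finset.mul_sum, mul_zero, zero_add]
    refine Finset.sum_congr rfl fun a ha => ?_
    rw [← quad, pderiv_quad (Finset.ne_of_mem_erase ha), map_mul, map_ofNat]
    ring
  have hpow : ∀ (q : MvPolynomial σ ℂ) (d : ℕ), euler q = d * q →
      ∀ j : ℕ, euler (q ^ j) = (d * j : ℕ) * q ^ j := by
    intro q d hq j
    induction j with
    | zero => simpa using euler_C (σ := σ) 1
    | succ j ih =>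
      rw [pow_succ, euler_mul, ih, hq]
      push_cast
      ring
  rw [euler_mul, hpow _ 2 (by simpa using hq), hpow _ 1 (by simpa using euler_X T)]
  rw [map_natCast]
  push_cast
  ring

theorem pderiv_quad_pow {c : σ} (hc : c ≠ T) (j : ℕ) : pderiv c (quad ε T ^ j) =
    C (2 * j * ε c) * (X c * quad ε T ^ (j - 1)) := by
  rw [pderiv_pow, pderiv_quad hc]
  simp only [map_mul, map_ofNat, map_natCast]
  ring

/-- The radial formula for the wave operator; the cardinality is the dimension of the space without
`T`. For `j = 0` the truncated exponent meets a zero coefficient. -/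
theorem box_quad_pow (hε : ∀ a, ε a * ε a = 1) (j : ℕ) : box ε (quad ε T ^ j) =
    C (2 * j * (((Finset.univ.erase T).card : ℂ) + 2 * j - 2)) * quad ε T ^ (j - 1) := by
  have hC : ∀ a, C (ε a) * C (ε a) = (1 : MvPolynomial σ ℂ) := fun a => by
    rw [← map_mul, hε, map_one]
  have h1 : box ε (quad ε T) = 2 * ((Finset.univ.erase T).card : MvPolynomial σ ℂ) := by
    rw [box, ← Finset.add_sum_erase _ _ (Finset.mem_univ T), pderiv_quad_self, map_zero, mul_zero,
      zero_add, Finset.sum_congr rfl (g := fun _ => 2), Finset.sum_const, nsmul_eq_mul, mul_comm]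
    intro a ha
    rw [pderiv_quad (Finset.ne_of_mem_erase ha), pderiv_C_mul, pderiv_X_self, map_mul, map_ofNat]
    linear_combination 2 * hC a
  induction j with
  | zero => simp [box]
  | succ j ih =>
    have h2 : ∑ a, C (ε a) * (pderiv a (quad ε T) * pderiv a (quad ε T ^ j)) =
        4 * (j : MvPolynomial σ ℂ) * quad ε T ^ j := by
      rw [← Finset.add_sum_erase _ _ (Finset.mem_univ T), pderiv_quad_self, zero_mul, mul_zero,
        zero_add]
      have h3 : ∀ a ∈ Finset.univ.erase T,
          C (ε a) * (pderiv a (quad ε T) * pderiv a (quad ε T ^ j)) =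
            C (ε a) * X a ^ 2 * (4 * (j : MvPolynomial σ ℂ) * quad ε T ^ (j - 1)) := by
        intro a ha
        rw [pderiv_quad (Finset.ne_of_mem_erase ha), pderiv_quad_pow (Finset.ne_of_mem_erase ha)]
        simp only [map_mul, map_ofNat, map_natCast]
        linear_combination (4 * C (ε a) * X a ^ 2 * j * quad ε T ^ (j - 1)) * hC a
      rw [Finset.sum_congr rfl h3, ← Finset.sum_mul, ← quad]
      rcases j with _ | j
      · simp
      · rw [Nat.add_sub_cancel, pow_succ]
        ring
    rw [pow_succ', box_mul, h1, ih, h2, Nat.add_sub_cancel]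
    rcases j with _ | j
    · simp
      exact Or.inl (map_ofNat C 2).symm
    · rw [Nat.add_sub_cancel, pow_succ]
      simp only [map_mul, map_ofNat, map_natCast, map_add, map_sub]
      push_cast
      ring

/-- The cofactor of `X c` does not depend on `c`, so the Bessel equations for all variables are the
same recursion. Truncated exponents occur only with coefficient zero. -/
theorem bessel_quad_pow_mul (hε : ∀ a, ε a * ε a = 1) (hT : ε T = 1) {c : σ} (hc : c ≠ T)
    (lam : ℂ) (j k : ℕ) : bessel ε lam c (quad ε T ^ j * X T ^ k) = X c *
      (C (2 * j * (2 * lam - 2 * (2 * j + k) + (Finset.univ.erase T).card + 2 * j)) *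
          (quad ε T ^ (j - 1) * X T ^ k) +
        C ((k : ℂ) * (k - 1)) * (quad ε T ^ j * X T ^ (k - 2))) := by
  have hC : C (ε c) * C (ε c) = (1 : MvPolynomial σ ℂ) := by
    rw [← map_mul, hε, map_one]
  have hcT : pderiv c (X T ^ k : MvPolynomial σ ℂ) = 0 := by
    rw [pderiv_pow, pderiv_X_of_ne hc.symm, mul_zero]
  have hbT : box ε (X T ^ k) = C ((k : ℂ) * (k - 1)) * X T ^ (k - 2) := by
    rw [box, Finset.sum_eq_single T]
    · rw [pderiv_pow, pderiv_X_self, mul_one, hT, map_one, one_mul,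
        ← map_natCast (C : ℂ →+* MvPolynomial σ ℂ), pderiv_C_mul, pderiv_pow, pderiv_X_self]
      rcases k with _ | k
      · simp
      · simp only [map_mul, map_sub, map_one, Nat.add_sub_cancel, map_natCast]
        push_cast
        ring
    · intro a _ ha
      rw [pderiv_pow, pderiv_X_of_ne ha.symm]
      simp
    · simp
  have hmix : ∑ a, C (ε a) * (pderiv a (quad ε T ^ j) * pderiv a (X T ^ k)) = 0 := by
    refine Finset.sum_eq_zero fun a _ => ?_
    by_cases ha : a = T
    · subst ha
      rw [pderiv_pow (f := quad ε a), pderiv_quad_self]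
      ring
    · rw [pderiv_pow (f := X T), pderiv_X_of_ne (Ne.symm ha)]
      ring
  rw [bessel, box_mul, hmix, hbT, box_quad_pow hε, pderiv_mul, hcT, pderiv_quad_pow hc]
  rcases j with _ | j
  · simp only [euler, Nat.cast_zero, mul_zero, zero_mul, map_zero, add_zero, Finset.sum_const_zero,
      sub_zero, pow_zero, zero_add, one_mul]
  · have h1 : euler (C (2 * ((j + 1 : ℕ) : ℂ) * ε c) * (X c * quad ε T ^ j) * X T ^ k +
        quad ε T ^ (j + 1) * 0) = C ((1 + 2 * j + k : ℕ) : ℂ) *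
          (C (2 * ((j + 1 : ℕ) : ℂ) * ε c) * (X c * quad ε T ^ j) * X T ^ k) := by
      rw [mul_zero, add_zero, mul_assoc (C _), euler_C_mul, mul_assoc (X c), euler_mul, euler_X,
        euler_quad_pow_mul]
      simp only [map_natCast]
      push_cast
      ring
    rw [Nat.add_sub_cancel, h1]
    simp only [map_mul, map_ofNat, map_natCast, map_add, map_sub, map_one]
    push_cast
    linear_combination (4 * (j + 1) * (C lam - (1 + 2 * j + k)) *
      (X c * (quad ε T ^ j * X T ^ k))) * hC

/-- The polynomial `∑ c_j Δ^j T^{N - 2j}`. -/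
def famPoly (ε : σ → ℂ) (T : σ) (N : ℕ) (c : ℕ → ℂ) : MvPolynomial σ ℂ :=
  ∑ j ∈ Finset.range (N / 2 + 1), C (c j) * (quad ε T ^ j * X T ^ (N - 2 * j))

theorem rotOp_famPoly (hε : ∀ a, ε a * ε a = 1) {a b : σ} (ha : a ≠ T) (hb : b ≠ T) (N : ℕ) (c : ℕ → ℂ) :
    rotOp ε a b (famPoly ε T N c) = 0 := by
  rw [famPoly]
  induction Finset.range (N / 2 + 1) using Finset.induction_on with
  | empty => simp [rotOp]
  | insert j s hj ih =>
    rw [Finset.sum_insert hj, rotOp_add, ih, rotOp_C_mul, rotOp_quad_pow_mul hε ha hb]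
    ring

theorem euler_famPoly (N : ℕ) (c : ℕ → ℂ) :
    euler (famPoly ε T N c) = C (N : ℂ) * famPoly ε T N c := by
  have h : ∀ s : Finset ℕ, (∀ j ∈ s, 2 * j ≤ N) →
      euler (∑ j ∈ s, C (c j) * (quad ε T ^ j * X T ^ (N - 2 * j))) =
        C (N : ℂ) * ∑ j ∈ s, C (c j) * (quad ε T ^ j * X T ^ (N - 2 * j)) := by
    intro s
    induction s using Finset.induction_on with
    | empty => simp [euler]
    | insert j s hj ih =>
      intro hs
      rw [Finset.sum_insert hj, euler_add, ih fun i hi => hs i (Finset.mem_insert_of_mem hi),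
        euler_C_mul, euler_quad_pow_mul, Nat.add_sub_cancel' (hs j (Finset.mem_insert_self j s))]
      ring
  exact h _ fun j hj => by
    have := Finset.mem_range.1 hj
    omega

/-- The monomial `X d Δ^j T^(N-2j-2)` arises from the summands `j + 1` and `j`, and the recursion
says that the two contributions cancel. -/
theorem bessel_famPoly (hε : ∀ a, ε a * ε a = 1) (hT : ε T = 1) {d : σ} (hd : d ≠ T) {lam : ℂ}
    {N : ℕ} {c : ℕ → ℂ}
    (hc : ∀ j < N / 2, 2 * (j + 1) * (2 * lam - 2 * N + (Finset.univ.erase T).card + 2 * (j + 1)) *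
      c (j + 1) + ((N : ℂ) - 2 * j) * (N - 2 * j - 1) * c j = 0) :
    bessel ε lam d (famPoly ε T N c) = 0 := by
  have h : ∀ s : Finset ℕ, bessel ε lam d (∑ j ∈ s, C (c j) * (quad ε T ^ j * X T ^ (N - 2 * j))) =
      ∑ j ∈ s, C (c j) * bessel ε lam d (quad ε T ^ j * X T ^ (N - 2 * j)) := by
    intro s
    induction s using Finset.induction_on with
    | empty => simpa using bessel_C ε lam d 0
    | insert j s hj ih =>
      rw [Finset.sum_insert hj, Finset.sum_insert hj, bessel_add, ih, bessel_C_mul]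
  rw [famPoly, h]
  have h1 : ∀ j ∈ Finset.range (N / 2 + 1),
      C (c j) * bessel ε lam d (quad ε T ^ j * X T ^ (N - 2 * j)) =
        C (c j * (2 * j * (2 * lam - 2 * N + (Finset.univ.erase T).card + 2 * j))) *
            (X d * (quad ε T ^ (j - 1) * X T ^ (N - 2 * j))) +
          C (c j * (((N : ℂ) - 2 * j) * (N - 2 * j - 1))) *
            (X d * (quad ε T ^ j * X T ^ (N - 2 * (j + 1)))) := by
    intro j hj
    have hjN : 2 * j ≤ N := by
      have := Finset.mem_range.1 hj
      omega
    rw [bessel_quad_pow_mul hε hT hd, show N - 2 * j - 2 = N - 2 * (j + 1) by omega,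
      Nat.cast_sub hjN]
    push_cast
    rw [add_sub_cancel, map_mul (C : ℂ →+* MvPolynomial σ ℂ) (c j),
      map_mul (C : ℂ →+* MvPolynomial σ ℂ) (c j)]
    ring
  rw [Finset.sum_congr rfl h1, Finset.sum_add_distrib, Finset.sum_range_succ', Finset.sum_range_succ
    (fun j => C (c j * (((N : ℂ) - 2 * j) * (N - 2 * j - 1))) *
            (X d * (quad ε T ^ j * X T ^ (N - 2 * (j + 1)))))]
  -- The last summand has no partner, but it contains `T` to the power `0` or `1`, which `∂_T²`
  -- kills.
  have hlast : c (N / 2) * (((N : ℂ) - 2 * (N / 2 : ℕ)) * (N - 2 * (N / 2 : ℕ) - 1)) = 0 := by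
    have : N - 2 * (N / 2) = 0 ∨ N - 2 * (N / 2) = 1 := by omega
    have h2 : (N : ℂ) - 2 * (N / 2 : ℕ) = (N - 2 * (N / 2) : ℕ) := by
      rw [Nat.cast_sub (by omega)]
      push_cast
      ring
    rw [h2]
    rcases this with h3 | h3 <;> rw [h3] <;> simp
  rw [hlast]
  simp only [Nat.cast_zero, mul_zero, zero_mul, map_zero, add_zero, ← Finset.sum_add_distrib]
  refine Finset.sum_eq_zero fun j hj => ?_
  rw [Nat.add_sub_cancel, ← add_mul, ← map_add]
  have := hc j (Finset.mem_range.1 hj)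
  rw [show c (j + 1) * (2 * ((j + 1 : ℕ) : ℂ) * (2 * lam - 2 * N + (Finset.univ.erase T).card +
    2 * ((j + 1 : ℕ) : ℂ))) + c j * (((N : ℂ) - 2 * j) * (N - 2 * j - 1)) = 0 by
      push_cast
      linear_combination this, map_zero, zero_mul]

/-- After splitting off the common factor `T^(N - 2(N/2))`, evaluation at the basis vector `o`
leaves only the top power of `Δ`. -/
theorem famPoly_ne_zero (hoT : o ≠ T) (hε : ε o ≠ 0) (N : ℕ) {c : ℕ → ℂ} (hc : c (N / 2) ≠ 0) :
    famPoly ε T N c ≠ 0 := by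
  have h1 : famPoly ε T N c = X T ^ (N - 2 * (N / 2)) *
      ∑ j ∈ Finset.range (N / 2 + 1), C (c j) * (quad ε T ^ j * X T ^ (2 * (N / 2) - 2 * j)) := by
    rw [famPoly, Finset.mul_sum]
    refine Finset.sum_congr rfl fun j hj => ?_
    have := Finset.mem_range.1 hj
    rw [show N - 2 * j = N - 2 * (N / 2) + (2 * (N / 2) - 2 * j) by omega, pow_add]
    ring
  rw [h1]
  refine mul_ne_zero (pow_ne_zero _ (X_ne_zero T)) fun h => ?_
  have h2 := congrArg (eval (Pi.single o 1)) h
  have hq : eval (Pi.single o 1) (quad ε T) = ε o := by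
    rw [quad, map_sum, Finset.sum_eq_single o]
    · simp
    · intro a _ ha
      simp [ha]
    · simp [hoT]
  rw [map_sum, map_zero, Finset.sum_range_succ, Finset.sum_eq_zero, zero_add] at h2
  · simp [hq, hε, hc] at h2
  · intro j hj
    have := Finset.mem_range.1 hj
    rw [map_mul, map_mul, map_pow (eval _) (X T), eval_X, Pi.single_eq_of_ne hoT.symm,
      zero_pow (by omega)]
    ring

end Polynomials

/-! ### From equivariant maps to the polynomial system and its solutions. -/

theorem csgn_mul_self {r : ℕ} (a : Mid r) : (csgn a : ℂ) * csgn a = 1 := by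
  rw [csgn, ← Complex.ofReal_mul, sgn_mul_self, Complex.ofReal_one]

theorem csgn_ne_zero {r : ℕ} (a : Mid r) : (csgn a : ℂ) ≠ 0 := fun h => by
  have := csgn_mul_self a
  rw [h, mul_zero] at this
  exact zero_ne_one this

/-- The index of the last coordinate. -/
def lastMid (r : ℕ) : Mid (r + 1) := Sum.inr (Fin.last r)

theorem midCast_ne_lastMid {r : ℕ} (a : Mid r) : midCast a ≠ lastMid r := by
  rcases a with a | a
  · simp [midCast, lastMid]
  · simp [midCast, lastMid, (Fin.castSucc_lt_last a).ne]

theorem exists_midCast_eq {r : ℕ} {a : Mid (r + 1)} (h : a ≠ lastMid r) :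
    ∃ b : Mid r, midCast b = a := by
  rcases a with a | a
  · exact ⟨Sum.inl a, rfl⟩
  · refine ⟨Sum.inr (a.castPred fun h' => h (congrArg Sum.inr h')), ?_⟩
    simp [midCast]

theorem card_erase_lastMid (r : ℕ) : (Finset.univ.erase (lastMid r)).card = r + 2 := by
  rw [Finset.card_erase_of_mem (Finset.mem_univ _), Finset.card_univ, Fintype.card_sum,
    Fintype.card_fin, Fintype.card_fin]
  omega

theorem polyOp_leftRegular {r : ℕ} (p : MvPolynomial (Mid r) ℂ) (g : G r) (u : SmoothFn r) :
    polyOp r p (leftRegular r g u) = leftRegular r g (polyOp r p u) := by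
  induction p using MvPolynomial.induction_on with
  | C z => rw [polyOp_C, polyOp_C, map_smul]
  | add p q hp hq => rw [polyOp_add, polyOp_add, map_add, hp, hq]
  | mul_X p c hp =>
    rw [mul_comm, polyOp_X_mul, polyOp_X_mul, hp]
    apply Subtype.ext
    funext x
    change deriv (fun t : ℝ => (polyOp r p u).1 (g⁻¹ * (x * expG (t • lower c)))) 0 =
      deriv (fun t : ℝ => (polyOp r p u).1 (g⁻¹ * x * expG (t • lower c))) 0
    simp only [mul_assoc]

/-- Left-invariant operators commute with left translations, so the restricted operator is
equivariant as soon as it has the right range. -/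
theorem inducesEquivariantMap_polyCU_iff (r : ℕ) (p : MvPolynomial (Mid (r + 1)) ℂ) (μ ν : ℂ) :
    InducesEquivariantMap r (polyCU (r + 1) p) μ ν ↔
      ∀ u ∈ Ind (MonoidHom.id (G (r + 1))) μ, polyOp (r + 1) p u ∈ Ind (incl r) ν := by
  constructor
  · rintro ⟨T, hT⟩ u hu
    have h := (T ⟨u, hu⟩).2
    rw [hT ⟨u, hu⟩] at h
    exact h
  · intro h
    refine ⟨⟨(polyOp (r + 1) p).restrict h, fun g => ?_⟩, fun u => rfl⟩
    ext1 u
    apply Subtype.ext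
    exact polyOp_leftRegular p g u

/-- The system of differential equations for the polynomials that induce equivariant maps. -/
theorem inducesEquivariantMap_iff_system (r : ℕ) (p : MvPolynomial (Mid (r + 1)) ℂ) (lam : ℂ)
    (N : ℕ) :
    InducesEquivariantMap r (polyCU (r + 1) p) lam (lam - N) ↔
      (∀ a b, a ≠ lastMid r → b ≠ lastMid r → rotOp csgn a b p = 0) ∧
      (∀ a, a ≠ lastMid r → bessel csgn lam a p = 0) ∧
      euler p = MvPolynomial.C (N : ℂ) * p := by
  rw [inducesEquivariantMap_polyCU_iff]
  have hid := fun u : SmoothFn (r + 1) =>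
    mem_Ind_iff_rot (j := MonoidHom.id (G (r + 1))) (dj := LinearMap.id) (fun _ => rfl) lam u
  have hincl := mem_Ind_iff_rot (incl_expG r) (lam - N)
  simp only [inclLie_rot, inclLie_upper, inclLie_H] at hincl
  constructor
  · intro h
    -- Each equation says that a certain polynomial vanishes; its operator kills the whole source
    -- space, so evaluation at the identity suffices.
    refine ⟨fun a b ha hb => ?_, fun a ha => ?_, ?_⟩
    · obtain ⟨a, rfl⟩ := exists_midCast_eq ha
      obtain ⟨b, rfl⟩ := exists_midCast_eq hb
      refine eq_zero_of_polyOp_apply_one lam _ fun u hu => ?_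
      obtain ⟨hM, -, -⟩ := (hid u).1 hu
      rw [← derivOp_rot_polyOp hM, ((hincl _).1 (h u hu)).1]
      rfl
    · obtain ⟨a, rfl⟩ := exists_midCast_eq ha
      refine eq_zero_of_polyOp_apply_one lam _ fun u hu => ?_
      obtain ⟨hM, hN, hH⟩ := (hid u).1 hu
      rw [← derivOp_upper_polyOp hM hN hH, ((hincl _).1 (h u hu)).2.1]
      rfl
    · have : MvPolynomial.C lam * p - euler p - MvPolynomial.C (lam - N) * p = 0 := by
        refine eq_zero_of_polyOp_apply_one lam _ fun u hu => ?_
        obtain ⟨-, -, hH⟩ := (hid u).1 hu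
        rw [polyOp_sub, ← derivOp_H_polyOp hH, ((hincl _).1 (h u hu)).2.2, polyOp_C_mul, sub_self]
        rfl
      rw [map_sub] at this
      linear_combination -this
  · rintro ⟨hR, hB, hE⟩ u hu
    obtain ⟨hM, hN, hH⟩ := (hid u).1 hu
    refine (hincl _).2 ⟨fun a b => ?_, fun a => ?_, ?_⟩
    · rw [derivOp_rot_polyOp hM, hR _ _ (midCast_ne_lastMid a) (midCast_ne_lastMid b), map_zero]
      rfl
    · rw [derivOp_upper_polyOp hM hN hH, hB _ (midCast_ne_lastMid a), map_zero]
      rfl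
    · rw [derivOp_H_polyOp hH, hE, ← polyOp_C_mul]
      congr 2
      rw [map_sub]
      ring

theorem inducesEquivariantMap_iff_famPoly (r N : ℕ) (lam : ℂ) {c : ℕ → ℂ} (h0 : c (N / 2) = 1)
    (hc : ∀ j < N / 2, 2 * (j + 1) * (2 * lam - 2 * N + (r + 2) + 2 * (j + 1)) * c (j + 1) +
      ((N : ℂ) - 2 * j) * (N - 2 * j - 1) * c j = 0)
    (E : CU (subNm (r + 1))) :
    InducesEquivariantMap r E lam (lam - N) ↔
      ∃ z : ℂ, E = z • polyCU (r + 1) (famPoly csgn (lastMid r) N c) := by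
  have hT : csgn (lastMid r) = 1 := by simp [lastMid, sgn]
  have hoT : (Sum.inl 1 : Mid (r + 1)) ≠ lastMid r := by simp [lastMid]
  have hbT : (Sum.inl 0 : Mid (r + 1)) ≠ lastMid r := by simp [lastMid]
  set D := famPoly csgn (lastMid r) N c with hD
  have hDR : ∀ a b, a ≠ lastMid r → b ≠ lastMid r → rotOp csgn a b D = 0 := fun a b ha hb =>
    rotOp_famPoly csgn_mul_self ha hb N c
  have hDB : ∀ a, a ≠ lastMid r → bessel csgn lam a D = 0 := fun a ha => by
    refine bessel_famPoly csgn_mul_self hT ha fun j hj => ?_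
    rw [card_erase_lastMid]
    push_cast
    exact hc j hj
  have hDE : euler D = MvPolynomial.C (N : ℂ) * D := euler_famPoly N c
  have hD0 : D ≠ 0 := famPoly_ne_zero hoT (csgn_ne_zero _) N (by rw [h0]; exact one_ne_zero)
  obtain ⟨p, rfl⟩ := polyCU_surjective (r + 1) E
  constructor
  · intro h
    obtain ⟨hR, hB, hE⟩ := (inducesEquivariantMap_iff_system r p lam N).1 h
    have key : ∀ q : MvPolynomial (Mid (r + 1)) ℂ,
        (∀ a b, a ≠ lastMid r → b ≠ lastMid r → rotOp csgn a b q = 0) →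
        (∀ a, a ≠ lastMid r → bessel csgn lam a q = 0) →
        euler q = MvPolynomial.C (N : ℂ) * q →
        MvPolynomial.coeff (Finsupp.single (Sum.inl 1) (2 * (N / 2)) +
          Finsupp.single (lastMid r) (N - 2 * (N / 2))) q = 0 → q = 0 :=
      fun q hqR hqB hqE hq0 => eq_zero_of_bessel csgn_ne_zero hoT ⟨Sum.inl 0, by simp, hbT⟩
        (fun b _ hb => hqR _ b hoT hb) hqE (hqB _ hoT) hq0
    set α : Mid (r + 1) →₀ ℕ := Finsupp.single (Sum.inl 1) (2 * (N / 2)) +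
      Finsupp.single (lastMid r) (N - 2 * (N / 2)) with hα
    -- Uniqueness applied to `D` itself. Subtracting the right multiple of `D` from `p` then cancels
    -- the coefficient at `α` and leaves zero.
    have hDα : MvPolynomial.coeff α D ≠ 0 := fun h => hD0 (key D hDR hDB hDE h)
    refine ⟨MvPolynomial.coeff α p / MvPolynomial.coeff α D, ?_⟩
    rw [← map_smul]
    congr 1
    rw [MvPolynomial.smul_eq_C_mul, ← sub_eq_zero, sub_eq_add_neg, ← neg_mul, ← map_neg]
    refine key _ (fun a b ha hb => ?_) (fun a ha => ?_) ?_ ?_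
    · rw [rotOp_add, rotOp_C_mul, hR a b ha hb, hDR a b ha hb, mul_zero, add_zero]
    · rw [bessel_add, bessel_C_mul, hB a ha, hDB a ha, mul_zero, add_zero]
    · rw [euler_add, euler_C_mul, hE, hDE]
      ring
    · rw [MvPolynomial.coeff_add, MvPolynomial.coeff_C_mul, neg_mul, div_mul_cancel₀ _ hDα,
        add_neg_cancel]
  · rintro ⟨z, hz⟩
    rw [hz, ← map_smul, inducesEquivariantMap_iff_system, MvPolynomial.smul_eq_C_mul]
    refine ⟨fun a b ha hb => ?_, fun a ha => ?_, ?_⟩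
    · rw [rotOp_C_mul, hDR a b ha hb, mul_zero]
    · rw [bessel_C_mul, hDB a ha, mul_zero]
    · rw [euler_C_mul, hDE]
      ring

/-! ### Identification with `𝓓⁰_N(λ)`. -/

theorem polyCU_quad (r : ℕ) : polyCU (r + 1) (quad csgn (lastMid r)) = laplace r := by
  have h : quad (csgn (r := r + 1)) (lastMid r) = -MvPolynomial.X (Sum.inl 0) ^ 2 +
      MvPolynomial.X (Sum.inl 1) ^ 2 +
        ∑ j : Fin r, MvPolynomial.X (Sum.inr j.castSucc) ^ 2 := by
    -- Adding the missing square of `T` on both sides turns the sum into one over all indices, which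
    -- can be split.
    rw [← add_right_inj (MvPolynomial.C (csgn (lastMid r)) * MvPolynomial.X (lastMid r) ^ 2), quad,
      Finset.add_sum_erase _ (fun a => MvPolynomial.C (csgn a) * MvPolynomial.X a ^ 2)
        (Finset.mem_univ _), Fintype.sum_sum_type, Fin.sum_univ_two, Fin.sum_univ_castSucc]
    simp [csgn, sgn, lastMid]
    ring
  have h1 : toCU (lowerN (Sum.inl 0)) = q1CU (r + 1) :=
    congrArg toCU (Subtype.ext (Q1m_eq (r + 1)).symm)
  have h2 : toCU (lowerN (Sum.inl 1)) = q2CU (r + 1) :=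
    congrArg toCU (Subtype.ext (Q2m_eq (r + 1)).symm)
  have h3 : ∀ j : Fin (r + 1), toCU (lowerN (Sum.inr j)) = yCU j := fun j =>
    congrArg toCU (Subtype.ext (Ym_eq j).symm)
  rw [h, map_add, map_add, map_neg, map_sum, map_pow, map_pow, polyCU_X, polyCU_X, h1, h2, laplace]
  simp only [map_pow, polyCU_X, h3]

theorem D0_eq (n N : ℕ) (lam : ℂ) : D0 n N lam = polyCU (n - 3 + 1)
    (famPoly csgn (lastMid (n - 3)) N
      (if Even N then evenCoeff n (N / 2) lam else oddCoeff n (N / 2) lam)) := by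
  have hT : polyCU (n - 3 + 1) (MvPolynomial.X (lastMid (n - 3))) = tCU (n - 3) := by
    rw [polyCU_X]
    exact congrArg toCU (Subtype.ext (Ym_eq _).symm)
  rw [famPoly, map_sum, D0]
  simp only [map_mul, map_pow, polyCU_quad, hT, ← MvPolynomial.smul_eq_C_mul, map_smul]
  split_ifs <;> rfl

theorem famCoeff_last (n N : ℕ) (lam : ℂ) :
    (if Even N then evenCoeff n (N / 2) lam else oddCoeff n (N / 2) lam) (N / 2) = 1 := by
  split_ifs
  · exact ((evenCoeff_unique n (N / 2) lam _).2 fun _ _ => rfl).1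
  · exact ((oddCoeff_unique n (N / 2) lam _).2 fun _ _ => rfl).1

/-- Written in terms of `N`, the even and odd recursions coincide after doubling: `(N-2j)(N-2j-1)`
is twice `(K-j)(2K-2j-1)` for `N = 2K` and twice `(K-j)(2K-2j+1)` for `N = 2K+1`. -/
theorem famCoeff_step (n N : ℕ) (lam : ℂ) (j : ℕ) (hj : j < N / 2) :
    2 * (j + 1) * (2 * lam - 2 * N + (n - 1) + 2 * (j + 1)) *
        (if Even N then evenCoeff n (N / 2) lam else oddCoeff n (N / 2) lam) (j + 1) +
      ((N : ℂ) - 2 * j) * (N - 2 * j - 1) *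
        (if Even N then evenCoeff n (N / 2) lam else oddCoeff n (N / 2) lam) j = 0 := by
  split_ifs with hN
  · have h := ((evenCoeff_unique n (N / 2) lam _).2 fun _ _ => rfl).2 (j + 1) (by omega) hj
    obtain ⟨K, hK⟩ := hN.two_dvd
    have hKN : N / 2 = K := by omega
    rw [hKN, Nat.add_sub_cancel] at h
    rw [hKN, hK]
    push_cast at h ⊢
    linear_combination 2 * h
  · have h := ((oddCoeff_unique n (N / 2) lam _).2 fun _ _ => rfl).2 (j + 1) (by omega) hj
    obtain ⟨K, hK⟩ := Nat.not_even_iff_odd.1 hN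
    have hKN : N / 2 = K := by omega
    rw [hKN, Nat.add_sub_cancel] at h
    rw [hKN, hK]
    push_cast at h ⊢
    linear_combination 2 * h

end AdS

end

theorem theorem5p1 (n : ℕ) (hn : 4 ≤ n) (N : ℕ) (lam : ℂ)
    (E : AdS.CU (AdS.subNm (n - 3 + 1))) :
    AdS.InducesEquivariantMap (n - 3) E lam (lam - (N : ℂ)) ↔
      ∃ c : ℂ, E = c • AdS.D0 n N lam := by
  rw [AdS.D0_eq]
  refine AdS.inducesEquivariantMap_iff_famPoly (n - 3) N lam (AdS.famCoeff_last n N lam)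
    (fun j hj => ?_) E
  rw [Nat.cast_sub (by omega : 3 ≤ n), show ((n : ℂ) - (3 : ℕ) + 2) = n - 1 by push_cast; ring]
  exact AdS.famCoeff_step n N lam j hj
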